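/- Let $0<\alpha<1$ and let $\underline E=(E_i)_{i\ge 1}$ (the energy landscape) be i.i.d. exponential random variables with parameter $\alpha$; put $x_i=e^{-E_i}$ and $\tau_i=x_i^{-1}=e^{E_i}$. Given $\underline E$ and $N\ge 1$, let $Y_N$ be the continuous-time random walk on the complete graph with vertex set $\{1,\dots,N\}$ with rates $c_{i,j}=x_i/N$ for $i\ne j$ and uniform initial distribution, i.e. the right-continuous Markov chain with transition probabilities $p_t(i,j)=(e^{-t\mathbb L_N})_{i,j}$, where $(\mathbb L_N)_{i,j}=-x_i/N$ for $i\neq j$ and $(\mathbb L_N)_{i,i}=(N-1)x_i/N$. Let $\mathbb P_N,\mathbb E_N$ be the corresponding probability and expectation given $\underline E$, and set $x_N(t)=x_k$, $\tau_N(t)=\tau_k$ if $Y_N(t)=k$. There is a random variable $Z$ with values in $(0,\infty)$, unique in law, with Laplace transform $$\mathbb E\bigl(e^{-\theta Z}\bigr)=\frac{\sin(\pi\alpha)}{\pi}\int_{\frac{\theta}{\theta+1}}^1u^{-\alpha}(1-u)^{\alpha-1}\,du,\qquad \theta\ge 0,$$ and its distribution function is continuous. For almost every landscape $\underline E$ the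 following holds for every bounded piecewise continuous $h:(0,\infty)\to\mathbb R$ (finitely many discontinuities in each compact subinterval of $(0,\infty)$) and every rectifiable loop $\gamma$ in $\mathbb C\setminus[0,1]$ that winds once, in the positive sense, around $[0,1]$: for every $t>0$, $$\lim_{N\to\infty}\mathbb E_N\bigl(h(t\,x_N(t))\bigr)=\frac1{2\pi i}\int_\gamma\frac{e^{-t\lambda}}{\lambda}\;\frac{\int_0^1\frac{h(xt)}{\lambda-x}\,x^{\alpha-1}dx}{\int_0^1\frac{1}{\lambda-x}\,x^{\alpha-1}dx}\,d\lambda ,$$ and both sides converge to $\mathbb E(h(Z))$ as $t\to\infty$; in particular $$\lim_{t\to\infty}\lim_{N\to\infty}\mathbb E_N\bigl(h(t\,x_N(t))\bigr)=\mathbb E(h(Z)).$$ Moreover, for almost every landscape $\underline E$, $$\lim_{t\to\infty}\lim_{N\to\infty}\mathbb P_N\Bigl(\frac{\tau_N(t)}{t}\ge u\Bigr)=\mathbb P\bigl(Z\le u^{-1}\bigr)\qquad\text{for all }u>0,$$ where the limit over $N$ exists for every $t>0$. -/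

import Mathlib

open MeasureTheory ProbabilityTheory Filter Topology

namespace TrapModel

noncomputable section

/-- The generator `𝕃_N` (with the sign convention that makes it nonnegative) of the random walk on
the complete graph with vertex set `Fin N` whose rate of jumping from `i` to `j ≠ i` is
`c i j = x i / N`. -/
def generator (N : ℕ) (x : ℕ → ℝ) : Matrix (Fin N) (Fin N) ℝ :=
  fun i j => if i = j then ((N : ℝ) - 1) * x i / N else -(x i / N)

/-- The transition probabilities `p_t(i,j) = (exp (-t 𝕃_N))_{i,j}`. -/
def transition (N : ℕ) (x : ℕ → ℝ) (t : ℝ) : Matrix (Fin N) (Fin N) ℝ :=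
  NormedSpace.exp (-t • generator N x)

/-- `Y` (of which only the times `t ≥ 0` matter) is, under the probability measure `P`, a
continuous-time random walk on the complete graph with `N` vertices, with rates `x i / N`, and
with uniform initial distribution: a right-continuous Markov chain with transition probabilities
`exp (-t 𝕃_N)`. -/
structure IsTrapWalk {Ω : Type*} [MeasurableSpace Ω] (N : ℕ) (x : ℕ → ℝ) (P : Measure Ω)
    (Y : ℝ → Ω → Fin N) : Prop where
  isProbabilityMeasure : IsProbabilityMeasure P
  measurable : ∀ t, 0 ≤ t → Measurable (Y t)
  rightContinuous : ∀ ω t, 0 ≤ t → ∀ᶠ s in 𝓝[≥] t, Y s ω = Y t ω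
  finiteDimensional : ∀ (n : ℕ) (t : Fin (n + 1) → ℝ) (i : Fin (n + 1) → Fin N),
    t 0 = 0 → Monotone t →
    P.real {ω | ∀ k, Y (t k) ω = i k} =
      (N : ℝ)⁻¹ * ∏ k : Fin n,
        transition N x (t k.succ - t k.castSucc) (i k.castSucc) (i k.succ)

/-- `ζ` is the law of a random variable `Z` with values in `(0,∞)` whose Laplace transform is
`θ ↦ (sin (π α) / π) ∫_{θ/(θ+1)}^1 u^{-α} (1-u)^{α-1} du`. -/
structure IsAgeingLaw (α : ℝ) (ζ : Measure ℝ) : Prop where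
  isProbabilityMeasure : IsProbabilityMeasure ζ
  positive : ∀ᵐ z ∂ζ, 0 < z
  laplace : ∀ θ : ℝ, 0 ≤ θ →
    ∫ z, Real.exp (-θ * z) ∂ζ =
      Real.sin (Real.pi * α) / Real.pi *
        ∫ u in (θ / (θ + 1))..1, u ^ (-α) * (1 - u) ^ (α - 1)

/-- `h`, regarded as a function on `(0,∞)`, is bounded. -/
def IsBoundedOnPos (h : ℝ → ℝ) : Prop :=
  ∃ C : ℝ, ∀ z, 0 < z → |h z| ≤ C

/-- `h`, regarded as a function on `(0,∞)`, is piecewise continuous: it has only finitely many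
discontinuities in each compact subinterval of `(0,∞)`. (One-sided limits at the discontinuities
are not required, and the discontinuities may accumulate at `0` and at `∞`.) -/
def IsPiecewiseContinuousOnPos (h : ℝ → ℝ) : Prop :=
  ∀ a b : ℝ, 0 < a → {z ∈ Set.Icc a b | ¬ ContinuousAt h z}.Finite

/-- `lim_{t → ∞} lim_{N → ∞} a N t = l`, where the inner limit exists for every `t > 0`. -/
def HasIteratedLimit (a : ℕ → ℝ → ℝ) (l : ℝ) : Prop :=
  ∃ A : ℝ → ℝ, (∀ t, 0 < t → Tendsto (fun N => a N t) atTop (𝓝 (A t))) ∧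
    Tendsto A atTop (𝓝 l)

/-- The contour integral `∫_γ f(z) dz` along the curve `γ`, parametrised by `[0,1]`. -/
def contourIntegral (γ : ℝ → ℂ) (f : ℂ → ℂ) : ℂ :=
  ∫ s in (0 : ℝ)..1, deriv γ s * f (γ s)

/-- `γ`, restricted to `[0,1]`, is a rectifiable (parametrised in a Lipschitz way, e.g. piecewise
`C¹`) closed curve in `ℂ ∖ [0,1]` that winds once, in the positive sense, around the segment
`[0,1]`. -/
structure IsLoopAroundUnitInterval (γ : ℝ → ℂ) : Prop where
  lipschitz : ∃ K, LipschitzOnWith K γ (Set.Icc 0 1)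
  closed : γ 0 = γ 1
  avoids : ∀ s ∈ Set.Icc (0 : ℝ) 1, ∀ p ∈ Set.Icc (0 : ℝ) 1, γ s ≠ (p : ℂ)
  winding : ∀ p ∈ Set.Icc (0 : ℝ) 1,
    (2 * Real.pi * Complex.I)⁻¹ * contourIntegral γ (fun z => (z - (p : ℂ))⁻¹) = 1

/-- `(2πi)⁻¹ ∫_γ (e^{-tz}/z) (∫_0^1 h(xt)/(z-x) x^{α-1} dx / ∫_0^1 1/(z-x) x^{α-1} dx) dz`. -/
def contourFormula (α : ℝ) (h : ℝ → ℝ) (γ : ℝ → ℂ) (t : ℝ) : ℂ :=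
  (2 * Real.pi * Complex.I)⁻¹ * contourIntegral γ (fun z =>
    Complex.exp (-t * z) / z *
      ((∫ x in (0 : ℝ)..1, (h (x * t) : ℂ) / (z - x) * ((x ^ (α - 1) : ℝ) : ℂ)) /
        ∫ x in (0 : ℝ)..1, 1 / (z - x) * ((x ^ (α - 1) : ℝ) : ℂ)))

end

end TrapModel

/-!
The walk is of mean field type: from a vertex `i` it jumps at rate `x i`, and then (up to the
convention that it may stay put) it sits at a uniformly chosen vertex. This has two consequences,
one algebraic and one probabilistic, and the theorem follows from combining them.

*The contour formula.* The generator is a rank one perturbation of a diagonal matrix, so its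
resolvent is explicit (`sum_div_sub_eigenvalue`), and it is symmetrised by the weights `√(x i)`, so it
is diagonalisable with spectrum in `[0,1]` (`exists_diagonalization`). Cauchy's formula for entire
functions along a Lipschitz loop (`IsLoopAroundUnitInterval.contourIntegral_div_sub`) therefore
represents the expectation at time `t`, for finitely many vertices, as a contour integral of
a quotient of empirical Stieltjes transforms (`walkMean_eq_contourIntegral`). By the strong law of
large numbers, almost surely all moments of the empirical measures of the `x i` converge to those of
`α x^(α-1) dx` on `(0,1)` (`ae_isTypical`); by Weierstrass' theorem the empirical measures converge
weakly, also against test functions with a null set of discontinuities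
(`tendsto_integral_of_moments`). The denominators stay away from `0` along the loop, because
`z - [0,1]` is contained in a half plane away from `0` (`exists_halfplane`). Bounded convergence along the loop
gives the limit as the number of vertices tends to infinity (`tendsto_walkMean`).

*The limit of large times.* Conditioning on the last jump before `t` expresses the law at time `t`
through the mean jump intensity up to time `t` (`walkProb_eq_integral`). The contour formula shows
that the intensities converge to some `m` as the number of vertices tends to infinity, so that
the limiting law of the jump rate has the density
`y ↦ exp (-y t) + ∫ s in 0..t, exp (-y (t - s)) m s` with respect to `α y^(α-1) dy`
(`tendsto_walkMean_rateDensity`). That its mass is `1` is the renewal equation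
`L t + ∫ s in 0..t, L (t - s) m s = 1`, where `L` is the Laplace transform of `α y^(α-1) dy`; hence `m`
is the density of the renewal measure of a renewal process whose waiting times have the regularly
varying tail `L t ~ α Γ(α) t^(-α)`. The law of `t * x_N t` is governed by the Dynkin–Lamperti
theorem on the age of such a process, which is proved via Laplace transforms: the renewal equation
determines the asymptotics of the Laplace transform of `m` (`tendsto_laplace_intensity`), this gives
the weak convergence of the rescaled renewal measures (`tendsto_integral_renewalMeasure`), hence the
convergence of the Laplace transforms of `t * x_N t` (`tendsto_laplace_rateDensity`), hence its
weak convergence (`tendsto_integral_mul_rateDensity`). The limit is the law of `G / B` with `G` and `B`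
independent of laws `Gamma(α, 1)` and `Beta(1 - α, α)` (`ageingLaw`), whose Laplace transform is the
integral in the theorem (`laplace_ageingLaw`) and which has no atoms. Laplace transforms at the natural
numbers determine it (`measure_eq_of_laplace`), by Weierstrass' theorem again.
-/

namespace TrapModel

open scoped Matrix

/-! ### Weak convergence from moments and from Laplace transforms -/

lemma tendsto_integral_polynomial_of_moments {ι : Type*} {l : Filter ι} {ρ : ι → Measure ℝ}
    {ν : Measure ℝ} [IsFiniteMeasure ν]
    (hfin : ∀ᶠ i in l, IsFiniteMeasure (ρ i))
    (hsupp : ∀ᶠ i in l, ∀ᵐ x ∂ρ i, x ∈ Set.Icc (0 : ℝ) 1)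
    (hν : ∀ᵐ x ∂ν, x ∈ Set.Icc (0 : ℝ) 1)
    (hmom : ∀ k : ℕ, Tendsto (fun i => ∫ x, x ^ k ∂ρ i) l (𝓝 (∫ x, x ^ k ∂ν)))
    (p : Polynomial ℝ) :
    Tendsto (fun i => ∫ x, p.eval x ∂ρ i) l (𝓝 (∫ x, p.eval x ∂ν)) := by
  have key : ∀ σ : Measure ℝ, IsFiniteMeasure σ → (∀ᵐ x ∂σ, x ∈ Set.Icc (0 : ℝ) 1) →
      ∫ x, p.eval x ∂σ = ∑ k ∈ p.support, p.coeff k * ∫ x, x ^ k ∂σ := by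
    intro σ _ hσ
    simp_rw [Polynomial.eval_eq_sum, Polynomial.sum]
    rw [integral_finsetSum]
    · simp_rw [integral_const_mul]
    · intro k _
      refine Integrable.const_mul ?_ _
      refine Integrable.mono' (integrable_const (1 : ℝ)) (by fun_prop) ?_
      filter_upwards [hσ] with x hx
      rw [Real.norm_eq_abs, abs_pow, abs_of_nonneg hx.1]
      exact pow_le_one₀ hx.1 hx.2
  rw [key ν inferInstance hν]
  refine Tendsto.congr' ?_ (tendsto_finsetSum _ fun k _ => (hmom k).const_mul (p.coeff k))
  filter_upwards [hfin, hsupp] with i h1 h2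
  exact (key _ h1 h2).symm

/-- Convergence of all moments on `[0,1]` implies weak convergence, by the Weierstrass
approximation theorem. -/
lemma tendsto_integral_continuous_of_moments {ι : Type*} {l : Filter ι} {ρ : ι → Measure ℝ}
    {ν : Measure ℝ} [IsFiniteMeasure ν]
    (hfin : ∀ᶠ i in l, IsFiniteMeasure (ρ i))
    (hsupp : ∀ᶠ i in l, ∀ᵐ x ∂ρ i, x ∈ Set.Icc (0 : ℝ) 1)
    (hν : ∀ᵐ x ∂ν, x ∈ Set.Icc (0 : ℝ) 1)
    (hmom : ∀ k : ℕ, Tendsto (fun i => ∫ x, x ^ k ∂ρ i) l (𝓝 (∫ x, x ^ k ∂ν)))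
    {f : ℝ → ℝ} (hf : Continuous f) :
    Tendsto (fun i => ∫ x, f x ∂ρ i) l (𝓝 (∫ x, f x ∂ν)) := by
  have hmass : Tendsto (fun i => (ρ i).real Set.univ) l (𝓝 (ν.real Set.univ)) := by
    simpa using hmom 0
  have approx : ∀ σ : Measure ℝ, IsFiniteMeasure σ → (∀ᵐ x ∂σ, x ∈ Set.Icc (0 : ℝ) 1) →
      ∀ (p : Polynomial ℝ) (δ : ℝ), (∀ x ∈ Set.Icc (0 : ℝ) 1, |p.eval x - f x| < δ) →
      |∫ x, f x ∂σ - ∫ x, p.eval x ∂σ| ≤ δ * σ.real Set.univ := by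
    intro σ _ hσ p δ hp
    have hint : ∀ g : ℝ → ℝ, Continuous g → Integrable g σ := by
      intro g hg
      obtain ⟨C, hC⟩ := (isCompact_Icc (a := (0 : ℝ)) (b := 1)).exists_bound_of_continuousOn
        hg.continuousOn
      refine Integrable.mono' (integrable_const C) hg.aestronglyMeasurable ?_
      filter_upwards [hσ] with x hx using hC x hx
    rw [← integral_sub (hint f hf) (hint _ p.continuous), ← Real.norm_eq_abs]
    refine norm_integral_le_of_norm_le_const ?_
    filter_upwards [hσ] with x hx
    rw [Real.norm_eq_abs, abs_sub_comm]
    exact (hp x hx).le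
  rw [Metric.tendsto_nhds]
  intro ε hε
  set M := ν.real Set.univ + 1 with hM
  have hMpos : 0 < M := by positivity
  obtain ⟨p, hp⟩ := exists_polynomial_near_of_continuousOn 0 1 f hf.continuousOn
    (ε / (4 * M)) (by positivity)
  have hpoly := tendsto_integral_polynomial_of_moments hfin hsupp hν hmom p
  rw [Metric.tendsto_nhds] at hpoly
  filter_upwards [hfin, hsupp, hpoly (ε / 4) (by positivity),
    hmass.eventually_lt_const (show ν.real Set.univ < M by linarith)] with i h1 h2 h3 h4
  have e1 := approx _ h1 h2 p _ hp
  have e2 := approx ν inferInstance hν p _ hp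
  have b1 : ε / (4 * M) * (ρ i).real Set.univ ≤ ε / 4 := by
    calc ε / (4 * M) * (ρ i).real Set.univ ≤ ε / (4 * M) * M := by gcongr
      _ = ε / 4 := by field_simp
  have b2 : ε / (4 * M) * ν.real Set.univ ≤ ε / 4 := by
    calc ε / (4 * M) * ν.real Set.univ ≤ ε / (4 * M) * M := by gcongr; linarith
      _ = ε / 4 := by field_simp
  rw [Real.dist_eq] at h3 ⊢
  rw [abs_le] at e1 e2
  rw [abs_lt] at h3 ⊢
  constructor <;> linarith [e1.1, e1.2, e2.1, e2.2, h3.1, h3.2]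

/-- Convergence of all moments on `[0,1]` implies convergence of the integrals of bounded functions
that are continuous outside a closed null set `D` of the limit. Multiplication by the cutoff
`min 1 (n * dist x D)` makes such a function continuous, and the error is controlled by the
integral of the cutoff, which is itself continuous. -/
lemma tendsto_integral_of_moments {ι : Type*} {l : Filter ι} {ρ : ι → Measure ℝ}
    {ν : Measure ℝ} [IsFiniteMeasure ν]
    (hfin : ∀ᶠ i in l, IsFiniteMeasure (ρ i))
    (hsupp : ∀ᶠ i in l, ∀ᵐ x ∂ρ i, x ∈ Set.Icc (0 : ℝ) 1)
    (hν : ∀ᵐ x ∂ν, x ∈ Set.Icc (0 : ℝ) 1)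
    (hmom : ∀ k : ℕ, Tendsto (fun i => ∫ x, x ^ k ∂ρ i) l (𝓝 (∫ x, x ^ k ∂ν)))
    {h : ℝ → ℝ} (hh : Measurable h) {C : ℝ} (hC : ∀ x, |h x| ≤ C) {D : Set ℝ} (hD : IsClosed D)
    (hDν : ν D = 0) (hcont : ∀ x ∉ D, ContinuousAt h x) :
    Tendsto (fun i => ∫ x, h x ∂ρ i) l (𝓝 (∫ x, h x ∂ν)) := by
  rcases D.eq_empty_or_nonempty with rfl | hne
  · exact tendsto_integral_continuous_of_moments hfin hsupp hν hmom
      (continuous_iff_continuousAt.2 fun x => hcont x (by simp))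
  have hC0 : 0 ≤ C := (abs_nonneg _).trans (hC 0)
  let χ : ℕ → ℝ → ℝ := fun n x => min 1 (n * Metric.infDist x D)
  have χc : ∀ n, Continuous (χ n) := fun n =>
    continuous_const.min (continuous_const.mul (Metric.continuous_infDist_pt D))
  have χ0 : ∀ n x, 0 ≤ χ n x := fun n x =>
    le_min zero_le_one (mul_nonneg n.cast_nonneg Metric.infDist_nonneg)
  have χ1 : ∀ n x, χ n x ≤ 1 := fun n x => min_le_left _ _
  have χhc : ∀ n, Continuous fun x => χ n x * h x := by
    intro n
    refine continuous_iff_continuousAt.2 fun x => ?_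
    by_cases hx : x ∈ D
    · have hχx : χ n x = 0 := by simp [χ, Metric.infDist_zero_of_mem hx]
      have : Tendsto (fun y => χ n y * C) (𝓝 x) (𝓝 0) := by
        simpa [hχx] using ((χc n).tendsto x).mul_const C
      rw [ContinuousAt, hχx, zero_mul]
      refine squeeze_zero_norm (fun y => ?_) this
      rw [norm_mul, Real.norm_eq_abs, Real.norm_eq_abs, abs_of_nonneg (χ0 n y)]
      exact mul_le_mul_of_nonneg_left (hC y) (χ0 n y)
    · exact (χc n).continuousAt.mul (hcont x hx)
  have err : ∀ (n : ℕ) (σ : Measure ℝ), IsFiniteMeasure σ →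
      |∫ x, h x ∂σ - ∫ x, χ n x * h x ∂σ| ≤ C * (σ.real Set.univ - ∫ x, χ n x ∂σ) := by
    intro n σ _
    have i1 : Integrable h σ := Integrable.mono' (integrable_const C) hh.aestronglyMeasurable
      (ae_of_all _ fun x => hC x)
    have i2 : Integrable (χ n) σ := Integrable.mono' (integrable_const 1)
      (χc n).aestronglyMeasurable
      (ae_of_all _ fun x => by rw [Real.norm_eq_abs, abs_of_nonneg (χ0 n x)]; exact χ1 n x)
    have i3 : Integrable (fun x => χ n x * h x) σ := Integrable.mono' (integrable_const C)
      (χhc n).aestronglyMeasurable (ae_of_all _ fun x => by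
        rw [norm_mul, Real.norm_eq_abs, Real.norm_eq_abs, abs_of_nonneg (χ0 n x)]
        calc χ n x * |h x| ≤ 1 * C := mul_le_mul (χ1 n x) (hC x) (abs_nonneg _) zero_le_one
          _ = C := one_mul C)
    rw [← integral_sub i1 i3, ← Real.norm_eq_abs]
    have : C * (σ.real Set.univ - ∫ x, χ n x ∂σ) = ∫ x, C * (1 - χ n x) ∂σ := by
      rw [integral_const_mul, integral_sub (integrable_const _) i2]
      simp
    rw [this]
    refine norm_integral_le_of_norm_le (((integrable_const _).sub i2).const_mul C)
      (ae_of_all _ fun x => ?_)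
    have : h x - χ n x * h x = h x * (1 - χ n x) := by ring
    rw [this, norm_mul, Real.norm_eq_abs, Real.norm_eq_abs,
      abs_of_nonneg (sub_nonneg.2 (χ1 n x))]
    exact mul_le_mul_of_nonneg_right (hC x) (sub_nonneg.2 (χ1 n x))
  have χlim : Tendsto (fun n => ∫ x, χ n x ∂ν) atTop (𝓝 (ν.real Set.univ)) := by
    have : ν.real Set.univ = ∫ _, (1 : ℝ) ∂ν := by simp
    rw [this]
    refine tendsto_integral_of_dominated_convergence (fun _ => 1)
      (fun n => (χc n).aestronglyMeasurable) (integrable_const _)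
      (fun n => ae_of_all _ fun x => by
        rw [Real.norm_eq_abs, abs_of_nonneg (χ0 n x)]; exact χ1 n x) ?_
    filter_upwards [measure_eq_zero_iff_ae_notMem.1 hDν] with x hx
    have hpos : 0 < Metric.infDist x D := (hD.notMem_iff_infDist_pos hne).1 hx
    refine tendsto_const_nhds.congr' ?_
    obtain ⟨n₀, hn₀⟩ := exists_nat_gt (1 / Metric.infDist x D)
    filter_upwards [eventually_ge_atTop n₀] with n hn
    have : 1 ≤ (n : ℝ) * Metric.infDist x D := by
      rw [div_lt_iff₀ hpos] at hn₀
      exact hn₀.le.trans (mul_le_mul_of_nonneg_right (by exact_mod_cast hn) hpos.le)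
    simp [χ, min_eq_left this]
  have hmass : Tendsto (fun i => (ρ i).real Set.univ) l (𝓝 (ν.real Set.univ)) := by
    simpa using hmom 0
  rw [Metric.tendsto_nhds]
  intro ε hε
  have hsmall : ∀ᶠ n in atTop, C * (ν.real Set.univ - ∫ x, χ n x ∂ν) < ε / 4 := by
    have : Tendsto (fun n => C * (ν.real Set.univ - ∫ x, χ n x ∂ν)) atTop (𝓝 0) := by
      simpa using (χlim.const_sub (ν.real Set.univ)).const_mul C
    exact this.eventually_lt_const (by positivity)
  obtain ⟨n, hn⟩ := hsmall.exists
  have hχ := tendsto_integral_continuous_of_moments hfin hsupp hν hmom (χc n)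
  have hχh := tendsto_integral_continuous_of_moments hfin hsupp hν hmom (χhc n)
  rw [Metric.tendsto_nhds] at hχh
  filter_upwards [hfin, hχh (ε / 4) (by positivity),
    ((hmass.sub hχ).const_mul C).eventually_lt_const hn] with i h1 h3 h4
  have e1 := err n _ h1
  have e2 := err n ν inferInstance
  rw [Real.dist_eq] at h3 ⊢
  rw [abs_le] at e1 e2
  rw [abs_lt] at h3 ⊢
  constructor <;> linarith [e1.1, e1.2, e2.1, e2.2, h3.1, h3.2]

/-- The version of `tendsto_integral_of_moments` for measures on `(0,∞)` whose Laplace transforms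
converge at the natural numbers; the map `s ↦ exp (-s)` turns Laplace transforms into moments. -/
lemma tendsto_integral_of_laplace {ι : Type*} {l : Filter ι} {ρ : ι → Measure ℝ}
    {ν : Measure ℝ} [IsFiniteMeasure ν]
    (hfin : ∀ᶠ i in l, IsFiniteMeasure (ρ i))
    (hsupp : ∀ᶠ i in l, ∀ᵐ x ∂ρ i, 0 < x) (hν : ∀ᵐ x ∂ν, 0 < x)
    (hlap : ∀ k : ℕ, Tendsto (fun i => ∫ x, Real.exp (-(k * x)) ∂ρ i) l
      (𝓝 (∫ x, Real.exp (-(k * x)) ∂ν)))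
    {h : ℝ → ℝ} (hh : Measurable h) {C : ℝ} (hC : ∀ x, |h x| ≤ C) {D : Set ℝ} (hD : IsClosed D)
    (hDν : ν D = 0) (hcont : ∀ x ∉ D, ContinuousAt h x) :
    Tendsto (fun i => ∫ x, h x ∂ρ i) l (𝓝 (∫ x, h x ∂ν)) := by
  have hm : Measurable fun x : ℝ => Real.exp (-x) := by fun_prop
  have hsupp' : ∀ σ : Measure ℝ, (∀ᵐ x ∂σ, 0 < x) →
      ∀ᵐ y ∂(σ.map fun x => Real.exp (-x)), y ∈ Set.Icc (0 : ℝ) 1 := by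
    intro σ hσ
    refine (ae_map_iff hm.aemeasurable measurableSet_Icc).2 ?_
    filter_upwards [hσ] with x hx
    exact ⟨(Real.exp_pos _).le, Real.exp_le_one_iff.2 (by linarith)⟩
  have hmap : ∀ (σ : Measure ℝ) (g : ℝ → ℝ), Measurable g →
      ∫ y, g y ∂(σ.map fun x => Real.exp (-x)) = ∫ x, g (Real.exp (-x)) ∂σ := fun σ g hg =>
    integral_map hm.aemeasurable hg.aestronglyMeasurable
  have hmom : ∀ σ : Measure ℝ, ∀ k : ℕ, ∫ y, y ^ k ∂(σ.map fun x => Real.exp (-x)) =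
      ∫ x, Real.exp (-(k * x)) ∂σ := by
    intro σ k
    rw [hmap σ (fun y => y ^ k) (by fun_prop)]
    congr 1 with x
    rw [← Real.exp_nat_mul]
    congr 1
    ring
  have hh' : Measurable fun y => h (-Real.log y) := hh.comp Real.measurable_log.neg
  have hlog : ContinuousOn (fun y => -Real.log y) (Set.Ioi 0) :=
    (Real.continuousOn_log.mono fun y hy => (ne_of_gt hy : y ≠ 0)).neg
  have hopen : IsOpen (Set.Ioi (0 : ℝ) ∩ (fun y => -Real.log y) ⁻¹' Dᶜ) :=
    hlog.isOpen_inter_preimage isOpen_Ioi hD.isOpen_compl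
  have hnull : (ν.map fun x => Real.exp (-x))
      (Set.Ioi (0 : ℝ) ∩ (fun y => -Real.log y) ⁻¹' Dᶜ)ᶜ = 0 := by
    rw [Measure.map_apply hm hopen.measurableSet.compl]
    convert hDν using 2
    ext x
    simp [Real.exp_pos]
  have := tendsto_integral_of_moments (ρ := fun i => (ρ i).map fun x => Real.exp (-x))
    (ν := ν.map fun x => Real.exp (-x)) (l := l) (h := fun y => h (-Real.log y)) (C := C)
    (hfin.mono fun i hi => by infer_instance) (hsupp.mono fun i hi => hsupp' _ hi)
    (hsupp' _ hν) (fun k => by simpa only [hmom] using hlap k) hh' (fun y => hC _)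
    (isClosed_compl_iff.2 hopen) hnull (by
      intro y hy
      simp only [Set.mem_compl_iff, not_not] at hy
      refine ContinuousAt.comp (f := fun y => -Real.log y) (hcont _ hy.2) ?_
      exact hlog.continuousAt (Ioi_mem_nhds hy.1))
  simp only [hmap _ _ hh'] at this
  simpa using this

/-- A finite measure on `(0,∞)` is determined by its Laplace transform at the natural numbers. -/
lemma measure_eq_of_laplace {ρ ν : Measure ℝ} [IsFiniteMeasure ρ] [IsFiniteMeasure ν]
    (hρ : ∀ᵐ x ∂ρ, 0 < x) (hν : ∀ᵐ x ∂ν, 0 < x)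
    (hlap : ∀ k : ℕ, ∫ x, Real.exp (-(k * x)) ∂ρ = ∫ x, Real.exp (-(k * x)) ∂ν) : ρ = ν := by
  refine ext_of_forall_integral_eq_of_IsFiniteMeasure fun f => ?_
  have := tendsto_integral_of_laplace (ι := ℕ) (l := atTop) (ρ := fun _ => ρ) (ν := ν)
    (Eventually.of_forall fun _ => inferInstance) (Eventually.of_forall fun _ => hρ) hν
    (fun k => by rw [hlap k]; exact tendsto_const_nhds) (h := f) f.continuous.measurable
    (C := ‖f‖) (fun x => f.norm_coe_le_norm x) isClosed_empty measure_empty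
    (fun x _ => f.continuous.continuousAt)
  exact tendsto_nhds_unique tendsto_const_nhds this

/-! ### Contour integrals along Lipschitz loops -/

/-- The fundamental theorem of calculus for complex-valued Lipschitz functions. -/
lemma integral_deriv_eq_sub_of_lipschitzOnWith {f : ℝ → ℂ} {K : NNReal}
    (hf : LipschitzOnWith K f (Set.Icc 0 1)) :
    ∫ s in (0 : ℝ)..1, deriv f s = f 1 - f 0 := by
  have hre : LipschitzOnWith K (fun s => (f s).re) (Set.uIcc 0 1) := by
    rw [Set.uIcc_of_le zero_le_one]
    refine LipschitzOnWith.of_dist_le_mul fun x hx y hy => ?_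
    refine le_trans ?_ (hf.dist_le_mul x hx y hy)
    rw [Real.dist_eq, ← Complex.sub_re, dist_eq_norm]
    exact Complex.abs_re_le_norm _
  have him : LipschitzOnWith K (fun s => (f s).im) (Set.uIcc 0 1) := by
    rw [Set.uIcc_of_le zero_le_one]
    refine LipschitzOnWith.of_dist_le_mul fun x hx y hy => ?_
    refine le_trans ?_ (hf.dist_le_mul x hx y hy)
    rw [Real.dist_eq, ← Complex.sub_im, dist_eq_norm]
    exact Complex.abs_im_le_norm _
  have are := hre.absolutelyContinuousOnInterval
  have aim := him.absolutelyContinuousOnInterval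
  have hderiv : ∀ᵐ s : ℝ, s ∈ Set.uIoc (0 : ℝ) 1 → deriv f s =
      ((deriv (fun s => (f s).re) s : ℝ) : ℂ) + ((deriv (fun s => (f s).im) s : ℝ) : ℂ) * Complex.I
      := by
    filter_upwards [are.ae_differentiableAt, aim.ae_differentiableAt] with s h1 h2 hs
    have hs' := Set.uIoc_subset_uIcc hs
    have d1 := (h1 hs').hasDerivAt.ofReal_comp
    have d2 := (h2 hs').hasDerivAt.ofReal_comp
    have := d1.add (d2.mul_const Complex.I)
    refine HasDerivAt.deriv (this.congr_of_eventuallyEq (Eventually.of_forall fun u => ?_))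
    exact (Complex.re_add_im (f u)).symm
  rw [intervalIntegral.integral_congr_ae hderiv, intervalIntegral.integral_add,
    intervalIntegral.integral_mul_const, intervalIntegral.integral_ofReal,
    intervalIntegral.integral_ofReal, are.integral_deriv_eq_sub, aim.integral_deriv_eq_sub]
  · apply Complex.ext <;> simp
  · exact ⟨are.intervalIntegrable_deriv.1.ofReal, are.intervalIntegrable_deriv.2.ofReal⟩
  · exact IntervalIntegrable.mul_const
      ⟨aim.intervalIntegrable_deriv.1.ofReal, aim.intervalIntegrable_deriv.2.ofReal⟩ _

lemma aestronglyMeasurable_deriv_mul {γ : ℝ → ℂ} {f : ℂ → ℂ}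
    (hf : ContinuousOn (fun s => f (γ s)) (Set.Icc 0 1)) :
    AEStronglyMeasurable (fun s => deriv γ s * f (γ s)) (volume.restrict (Set.uIoc 0 1)) := by
  rw [Set.uIoc_of_le zero_le_one]
  exact (measurable_deriv γ).aestronglyMeasurable.mul
    ((hf.mono Set.Ioc_subset_Icc_self).aestronglyMeasurable measurableSet_Ioc)

namespace IsLoopAroundUnitInterval

variable {γ : ℝ → ℂ}

lemma continuousOn (hγ : IsLoopAroundUnitInterval γ) : ContinuousOn γ (Set.Icc 0 1) :=
  hγ.lipschitz.choose_spec.continuousOn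

/-- A loop around `[0,1]` is bounded and keeps a positive distance from `[0,1]`. -/
lemma exists_bounds (hγ : IsLoopAroundUnitInterval γ) :
    ∃ R δ : ℝ, 0 < R ∧ 0 < δ ∧ (∀ s ∈ Set.Icc (0 : ℝ) 1, ‖γ s‖ < R) ∧
      ∀ s ∈ Set.Icc (0 : ℝ) 1, ∀ p ∈ Set.Icc (0 : ℝ) 1, δ ≤ ‖γ s - p‖ := by
  obtain ⟨R, hR⟩ := isCompact_Icc.exists_bound_of_continuousOn hγ.continuousOn
  have hc : ContinuousOn (fun q : ℝ × ℝ => ‖γ q.1 - q.2‖)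
      (Set.Icc (0 : ℝ) 1 ×ˢ Set.Icc (0 : ℝ) 1) := by
    refine ContinuousOn.norm (ContinuousOn.sub ?_ (by fun_prop))
    exact hγ.continuousOn.comp continuousOn_fst fun q hq => hq.1
  obtain ⟨q, hq, hmin⟩ := (isCompact_Icc.prod isCompact_Icc).exists_isMinOn
    ⟨((0 : ℝ), (0 : ℝ)), by simp⟩ hc
  refine ⟨|R| + 1, ‖γ q.1 - q.2‖, by positivity, ?_, fun s hs => ?_, fun s hs p hp => ?_⟩
  · rw [norm_pos_iff, sub_ne_zero]
    exact hγ.avoids _ hq.1 _ hq.2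
  · linarith [hR s hs, le_abs_self R]
  · exact hmin (a := (s, p)) ⟨hs, hp⟩

lemma exists_norm_deriv_le (hγ : IsLoopAroundUnitInterval γ) :
    ∃ K : ℝ, ∀ᵐ s : ℝ, s ∈ Set.uIoc (0 : ℝ) 1 → ‖deriv γ s‖ ≤ K := by
  obtain ⟨K, hK⟩ := hγ.lipschitz
  refine ⟨K, ?_⟩
  have h1 : ∀ᵐ s : ℝ, s ≠ 1 := by simp [ae_iff]
  filter_upwards [h1] with s hs1 hs
  rw [Set.uIoc_of_le zero_le_one] at hs
  exact norm_deriv_le_of_lipschitzOn (Icc_mem_nhds hs.1 (lt_of_le_of_ne hs.2 hs1)) hK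

lemma intervalIntegrable (hγ : IsLoopAroundUnitInterval γ) {f : ℂ → ℂ}
    (hf : ContinuousOn (fun s => f (γ s)) (Set.Icc 0 1)) :
    IntervalIntegrable (fun s => deriv γ s * f (γ s)) volume 0 1 := by
  obtain ⟨K, hK⟩ := hγ.exists_norm_deriv_le
  obtain ⟨C, hC⟩ := isCompact_Icc.exists_bound_of_continuousOn hf
  rw [intervalIntegrable_iff]
  have : IsFiniteMeasure (volume.restrict (Set.uIoc (0 : ℝ) 1)) := by
    rw [Set.uIoc_of_le zero_le_one]; infer_instance
  refine Integrable.mono' (integrable_const (K * C)) (aestronglyMeasurable_deriv_mul hf) ?_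
  rw [ae_restrict_iff' measurableSet_uIoc]
  filter_upwards [hK] with s hs hs'
  have h1 := hs hs'
  rw [Set.uIoc_of_le zero_le_one] at hs'
  rw [norm_mul]
  exact mul_le_mul h1 (hC s (Set.Ioc_subset_Icc_self hs')) (norm_nonneg _)
    ((norm_nonneg _).trans h1)

/-- Bounded convergence along a loop. -/
lemma tendsto_contourIntegral (hγ : IsLoopAroundUnitInterval γ) {F : ℕ → ℂ → ℂ} {f : ℂ → ℂ} {C : ℝ}
    (hF : ∀ n, ContinuousOn (fun s => F n (γ s)) (Set.Icc 0 1))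
    (hC : ∀ n, ∀ s ∈ Set.Icc (0 : ℝ) 1, ‖F n (γ s)‖ ≤ C)
    (hlim : ∀ s ∈ Set.Icc (0 : ℝ) 1, Tendsto (fun n => F n (γ s)) atTop (𝓝 (f (γ s)))) :
    Tendsto (fun n => contourIntegral γ (F n)) atTop (𝓝 (contourIntegral γ f)) := by
  obtain ⟨K, hK⟩ := hγ.exists_norm_deriv_le
  refine intervalIntegral.tendsto_integral_filter_of_dominated_convergence (fun _ => K * C)
    (Eventually.of_forall fun n => aestronglyMeasurable_deriv_mul (hF n))
    (Eventually.of_forall fun n => ?_) intervalIntegrable_const ?_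
  · filter_upwards [hK] with s hs hs'
    have h1 := hs hs'
    rw [Set.uIoc_of_le zero_le_one] at hs'
    rw [norm_mul]
    exact mul_le_mul h1 (hC n s (Set.Ioc_subset_Icc_self hs')) (norm_nonneg _)
      ((norm_nonneg _).trans h1)
  · refine ae_of_all _ fun s hs => ?_
    rw [Set.uIoc_of_le zero_le_one] at hs
    exact (hlim s (Set.Ioc_subset_Icc_self hs)).const_mul _

/-- Cauchy's theorem for entire functions. -/
lemma contourIntegral_eq_zero (hγ : IsLoopAroundUnitInterval γ) {f : ℂ → ℂ}
    (hf : Differentiable ℂ f) : contourIntegral γ f = 0 := by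
  obtain ⟨R, δ, hR0, -, hR, -⟩ := hγ.exists_bounds
  obtain ⟨K, hK⟩ := hγ.lipschitz
  obtain ⟨g, hg⟩ := (hf.differentiableOn (s := Metric.ball 0 R)).isExactOn_ball
  have hmem : ∀ s ∈ Set.Icc (0 : ℝ) 1, γ s ∈ Metric.ball (0 : ℂ) R := fun s hs => by
    simpa using hR s hs
  -- `f` is bounded on the ball, so that its primitive `g` is Lipschitz there
  obtain ⟨M, hM⟩ := (isCompact_closedBall (0 : ℂ) R).exists_bound_of_continuousOn
    hf.continuous.continuousOn
  have hgL : LipschitzOnWith (Real.toNNReal M) g (Metric.ball 0 R) := by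
    refine Convex.lipschitzOnWith_of_nnnorm_hasDerivWithin_le (convex_ball 0 R)
      (fun z hz => (hg z hz).hasDerivWithinAt) fun z hz => ?_
    rw [← NNReal.coe_le_coe, coe_nnnorm]
    exact (hM z (Metric.ball_subset_closedBall hz)).trans (Real.le_coe_toNNReal M)
  have hcomp : LipschitzOnWith (Real.toNNReal M * K) (g ∘ γ) (Set.Icc 0 1) :=
    hgL.comp hK hmem
  have h1 : ∀ᵐ s : ℝ, s ≠ 1 := by simp [ae_iff]
  have hdiff : ∀ᵐ s : ℝ, s ∈ Set.Icc (0 : ℝ) 1 → DifferentiableWithinAt ℝ γ (Set.Icc 0 1) s :=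
    hK.ae_differentiableWithinAt_of_mem_real
  have : contourIntegral γ f = ∫ s in (0 : ℝ)..1, deriv (g ∘ γ) s := by
    refine intervalIntegral.integral_congr_ae ?_
    filter_upwards [h1, hdiff] with s hs1 hd hs
    rw [Set.uIoc_of_le zero_le_one] at hs
    have hs' := Set.Ioc_subset_Icc_self hs
    have hγs : DifferentiableAt ℝ γ s :=
      (hd hs').differentiableAt (Icc_mem_nhds hs.1 (lt_of_le_of_ne hs.2 hs1))
    rw [((hg _ (hmem s hs')).scomp s hγs.hasDerivAt).deriv, smul_eq_mul]
  rw [this, integral_deriv_eq_sub_of_lipschitzOnWith hcomp, Function.comp, Function.comp,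
    hγ.closed, sub_self]

/-- Cauchy's integral formula for entire functions, at a point of `[0,1]`. -/
lemma contourIntegral_div_sub (hγ : IsLoopAroundUnitInterval γ) {f : ℂ → ℂ}
    (hf : Differentiable ℂ f) {p : ℝ} (hp : p ∈ Set.Icc (0 : ℝ) 1) :
    (2 * Real.pi * Complex.I)⁻¹ * contourIntegral γ (fun z => f z / (z - p)) = f p := by
  have hne : ∀ s ∈ Set.Icc (0 : ℝ) 1, γ s - p ≠ 0 := fun s hs =>
    sub_ne_zero.2 (hγ.avoids s hs p hp)
  have hslope : Differentiable ℂ (dslope f p) := by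
    have := (Complex.differentiableOn_dslope (s := Set.univ) (c := (p : ℂ)) Filter.univ_mem).2
      hf.differentiableOn
    exact differentiableOn_univ.1 this
  have hinv : ContinuousOn (fun s => (γ s - (p : ℂ))⁻¹) (Set.Icc 0 1) :=
    (hγ.continuousOn.sub continuousOn_const).inv₀ hne
  have hsplit : contourIntegral γ (fun z => f z / (z - p)) =
      contourIntegral γ (dslope f p) + f p * contourIntegral γ (fun z => (z - (p : ℂ))⁻¹) := by
    have i1 := hγ.intervalIntegrable (f := dslope f p)
      (hslope.continuous.comp_continuousOn hγ.continuousOn)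
    have i2 := (hγ.intervalIntegrable (f := fun z => (z - (p : ℂ))⁻¹) hinv).const_mul (f p)
    rw [contourIntegral, contourIntegral, contourIntegral,
      ← intervalIntegral.integral_const_mul, ← intervalIntegral.integral_add i1 i2]
    refine intervalIntegral.integral_congr fun s hs => ?_
    rw [Set.uIcc_of_le zero_le_one] at hs
    have h := hne s hs
    have h2 : dslope f p (γ s) = (f (γ s) - f p) / (γ s - p) := by
      rw [dslope_of_ne _ (sub_ne_zero.1 h), slope_def_field]
    change deriv γ s * (f (γ s) / (γ s - p)) =
      deriv γ s * dslope f p (γ s) + f p * (deriv γ s * (γ s - p)⁻¹)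
    rw [h2]
    field_simp
    ring
  rw [hsplit, hγ.contourIntegral_eq_zero hslope, zero_add, mul_left_comm, hγ.winding p hp, mul_one]

end IsLoopAroundUnitInterval

/-- The circle of radius `1` around `1/2` is a loop around `[0,1]`. -/
lemma exists_isLoopAroundUnitInterval : ∃ γ, IsLoopAroundUnitInterval γ := by
  have hderiv : ∀ s : ℝ, HasDerivAt (fun s : ℝ => circleMap (1 / 2) 1 (2 * Real.pi * s))
      ((2 * Real.pi : ℝ) * (circleMap 0 1 (2 * Real.pi * s) * Complex.I)) s := by
    intro s
    have h1 : HasDerivAt (fun s : ℝ => 2 * Real.pi * s) (2 * Real.pi) s := by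
      simpa using (hasDerivAt_id s).const_mul (2 * Real.pi)
    have := (hasDerivAt_circleMap (1 / 2) 1 (2 * Real.pi * s)).scomp s h1
    simpa [Function.comp_def] using this
  have hdist : ∀ p ∈ Set.Icc (0 : ℝ) 1, (p : ℂ) ∈ Metric.ball (1 / 2 : ℂ) 1 := by
    intro p hp
    rw [Metric.mem_ball, dist_eq_norm]
    have : (p : ℂ) - 1 / 2 = ((p - 1 / 2 : ℝ) : ℂ) := by push_cast; ring
    rw [this, Complex.norm_real, Real.norm_eq_abs, abs_lt]
    constructor <;> linarith [hp.1, hp.2]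
  refine ⟨fun s => circleMap (1 / 2) 1 (2 * Real.pi * s), ⟨⟨Real.toNNReal (2 * Real.pi), ?_⟩,
    by simp [circleMap], ?_, ?_⟩⟩
  · refine Convex.lipschitzOnWith_of_nnnorm_hasDerivWithin_le (convex_Icc 0 1)
      (fun s _ => (hderiv s).hasDerivWithinAt) fun s _ => ?_
    rw [← NNReal.coe_le_coe, coe_nnnorm, norm_mul (((2 * Real.pi : ℝ) : ℂ)), Complex.norm_real,
      norm_mul (circleMap 0 1 _), norm_circleMap_zero, Real.coe_toNNReal _ (by positivity)]
    simp [abs_of_pos Real.pi_pos]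
  · intro s _ p hp h
    have h1 := hdist p hp
    rw [← h, Metric.mem_ball, dist_eq_norm, circleMap_sub_center, norm_circleMap_zero] at h1
    simp at h1
  · intro p hp
    have hcirc := circleIntegral.integral_sub_inv_of_mem_ball (hdist p hp)
    have : contourIntegral (fun s => circleMap (1 / 2) 1 (2 * Real.pi * s))
        (fun z => (z - (p : ℂ))⁻¹) = 2 * Real.pi * Complex.I := by
      rw [← hcirc, circleIntegral, contourIntegral]
      have hsub := intervalIntegral.smul_integral_comp_mul_left (a := 0) (b := 1)
        (fun θ => deriv (circleMap (1 / 2) 1) θ • (circleMap (1 / 2) 1 θ - (p : ℂ))⁻¹)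
        (2 * Real.pi)
      rw [mul_zero, mul_one] at hsub
      rw [← hsub, ← intervalIntegral.integral_smul]
      refine intervalIntegral.integral_congr fun s _ => ?_
      rw [(hderiv s).deriv, deriv_circleMap]
      simp only [smul_eq_mul, Complex.real_smul]
      ring
    rw [this]
    exact inv_mul_cancel₀ (by simp [Real.pi_ne_zero])

/-! ### The walk on finitely many vertices -/

/-- The generator is symmetrised by conjugation with the diagonal matrix of the `√(x i)`. Hence it
is diagonalisable with eigenvalues in `[0,1]`; moreover, the spectral coefficients of
`∑ i j, p_t(i,j) x_j` are nonnegative. -/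
lemma exists_diagonalization {N : ℕ} (hN : 0 < N) {x : ℕ → ℝ} (hx0 : ∀ i, 0 < x i)
    (hx1 : ∀ i, x i ≤ 1) :
    ∃ (V W : Matrix (Fin N) (Fin N) ℝ) (d : Fin N → ℝ), (∀ k, d k ∈ Set.Icc (0 : ℝ) 1) ∧
      V * W = 1 ∧ generator N x = V * Matrix.diagonal d * W ∧
      (∀ t, transition N x t = V * Matrix.diagonal (fun k => Real.exp (-t * d k)) * W) ∧
      ∀ k, 0 ≤ (∑ i, V i k) * ∑ j, W k j * x j := by
  have hN' : (N : ℝ) ≠ 0 := by positivity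
  let s : Fin N → ℝ := fun i => √(x i)
  have hs0 : ∀ i, 0 < s i := fun i => Real.sqrt_pos.2 (hx0 i)
  have hss : ∀ i, s i * s i = x i := fun i => Real.mul_self_sqrt (hx0 i).le
  let S : Matrix (Fin N) (Fin N) ℝ := fun i j => (if i = j then x i else 0) - s i * s j / N
  have hS : S.IsHermitian := by
    ext i j
    rw [Matrix.conjTranspose_apply, star_trivial]
    by_cases h : i = j
    · subst h; rfl
    · change (if j = i then x j else 0) - s j * s i / N = (if i = j then x i else 0) - s i * s j / N
      rw [if_neg h, if_neg (Ne.symm h), mul_comm (s i)]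
  let U : Matrix (Fin N) (Fin N) ℝ := hS.eigenvectorUnitary
  let d : Fin N → ℝ := hS.eigenvalues
  have hUU : U * star U = 1 := Unitary.coe_mul_star_self _
  have hSU : S = U * Matrix.diagonal d * star U := by
    have := hS.spectral_theorem
    rw [Unitary.conjStarAlgAut_apply] at this
    exact this
  let V : Matrix (Fin N) (Fin N) ℝ := Matrix.diagonal s * U
  let W : Matrix (Fin N) (Fin N) ℝ := star U * Matrix.diagonal (fun i => (s i)⁻¹)
  have hdd : Matrix.diagonal s * Matrix.diagonal (fun i => (s i)⁻¹) = 1 := by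
    rw [Matrix.diagonal_mul_diagonal, ← Matrix.diagonal_one]
    congr 1 with i
    exact mul_inv_cancel₀ (hs0 i).ne'
  have hVW : V * W = 1 := by
    calc V * W = Matrix.diagonal s * (U * star U) * Matrix.diagonal (fun i => (s i)⁻¹) := by
          simp only [V, W, Matrix.mul_assoc]
      _ = 1 := by rw [hUU, Matrix.mul_one, hdd]
  have hgen : generator N x = V * Matrix.diagonal d * W := by
    calc generator N x = Matrix.diagonal s * S * Matrix.diagonal (fun i => (s i)⁻¹) := by
          ext i j
          rw [Matrix.mul_diagonal, Matrix.diagonal_mul]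
          simp only [generator, S]
          have := (hs0 j).ne'
          split_ifs with h
          · subst h
            rw [hss]
            field_simp
          · rw [← hss]
            field_simp
            ring
      _ = V * Matrix.diagonal d * W := by
          rw [hSU]
          simp only [V, W, Matrix.mul_assoc]
  have hquad : ∀ v : Fin N → ℝ, v ⬝ᵥ (S *ᵥ v) =
      ∑ i : Fin N, x i * v i ^ 2 - (∑ i, s i * v i) ^ 2 / N := by
    intro v
    have : ∀ i, (S *ᵥ v) i = x i * v i - s i / N * ∑ j, s j * v j := by
      intro i
      simp only [Matrix.mulVec, dotProduct, S, sub_mul, Finset.sum_sub_distrib, ite_mul, zero_mul,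
        Finset.sum_ite_eq, Finset.mem_univ, if_true, Finset.mul_sum]
      congr 1
      refine Finset.sum_congr rfl fun j _ => ?_
      ring
    simp only [dotProduct, this, mul_sub, Finset.sum_sub_distrib]
    congr 1
    · exact Finset.sum_congr rfl fun i _ => by ring
    · rw [sq, mul_div_assoc, Finset.sum_mul]
      exact Finset.sum_congr rfl fun i _ => by ring
  have hd : ∀ k, d k ∈ Set.Icc (0 : ℝ) 1 := by
    intro k
    have hk := hS.eigenvalues_eq k
    set v : Fin N → ℝ := ⇑(hS.eigenvectorBasis k) with hv
    have hnorm : ∑ i, v i ^ 2 = 1 := by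
      have := hS.eigenvectorBasis.orthonormal.1 k
      rw [EuclideanSpace.norm_eq, Real.sqrt_eq_one] at this
      simpa [hv] using this
    have hdk : d k = ∑ i : Fin N, x i * v i ^ 2 - (∑ i, s i * v i) ^ 2 / N := by
      rw [← hquad]
      simpa using hk
    rw [hdk]
    constructor
    · have h1 := sq_sum_le_card_mul_sum_sq (s := (Finset.univ : Finset (Fin N)))
        (f := fun i => s i * v i)
      have h2 : ∑ i, (s i * v i) ^ 2 = ∑ i : Fin N, x i * v i ^ 2 :=
        Finset.sum_congr rfl fun i _ => by rw [mul_pow, sq (s i), hss]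
      rw [h2, Finset.card_univ, Fintype.card_fin] at h1
      rw [sub_nonneg, div_le_iff₀ (by positivity)]
      linarith
    · have h1 : ∑ i : Fin N, x i * v i ^ 2 ≤ ∑ i, v i ^ 2 := Finset.sum_le_sum fun i _ =>
        mul_le_of_le_one_left (sq_nonneg _) (hx1 i)
      have h2 : 0 ≤ (∑ i, s i * v i) ^ 2 / (N : ℝ) := by positivity
      linarith
  have hWV : W = V⁻¹ := (Matrix.inv_eq_right_inv hVW).symm
  have hVu : IsUnit V := IsUnit.of_mul_eq_one W hVW
  refine ⟨V, W, d, hd, hVW, hgen, fun t => ?_, fun k => ?_⟩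
  · have h1 : -t • generator N x = V * Matrix.diagonal (fun k => -t * d k) * V⁻¹ := by
      have : Matrix.diagonal (fun k => -t * d k) = -t • Matrix.diagonal d := by
        rw [← Matrix.diagonal_smul]
        rfl
      rw [hgen, this, ← hWV, Matrix.mul_smul, Matrix.smul_mul]
    rw [transition, h1, Matrix.exp_conj _ _ hVu, Matrix.exp_diagonal, ← hWV]
    congr 3
    ext k
    rw [Pi.coe_exp, Real.exp_eq_exp_ℝ]
  · have h1 : ∑ i, V i k = ∑ i, s i * U i k := by simp [V, Matrix.diagonal_mul]
    have h2 : ∑ j, W k j * x j = ∑ i, s i * U i k := by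
      refine Finset.sum_congr rfl fun j _ => ?_
      simp only [W, Matrix.mul_diagonal, Matrix.star_apply, star_trivial]
      rw [← hss j]
      have := (hs0 j).ne'
      field_simp
    rw [h1, h2]
    exact mul_self_nonneg _

/-- `walkProb N x t j` is the probability that the walk on `N` vertices started from the uniform
distribution is at `j` at time `t`. -/
noncomputable def walkProb (N : ℕ) (x : ℕ → ℝ) (t : ℝ) (j : Fin N) : ℝ :=
  (N : ℝ)⁻¹ * ∑ i, transition N x t i j

/-- The expectation of `f` under the law of the walk at time `t`. -/
noncomputable def walkMean (N : ℕ) (x : ℕ → ℝ) (f : Fin N → ℝ) (t : ℝ) : ℝ :=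
  ∑ j, walkProb N x t j * f j

/-- The mean jump intensity `∑ j, P(Y t = j) x j`; it is the rate at which the walk is
put at a new vertex chosen uniformly among all `N`. -/
noncomputable def walkIntensity (N : ℕ) (x : ℕ → ℝ) (t : ℝ) : ℝ :=
  walkMean N x (fun j => x j) t

lemma walkProb_eq_sum {N : ℕ} {x : ℕ → ℝ} {V W : Matrix (Fin N) (Fin N) ℝ} {d : Fin N → ℝ} {t : ℝ}
    (htr : transition N x t = V * Matrix.diagonal (fun k => Real.exp (-t * d k)) * W) (j : Fin N) :
    walkProb N x t j =
      ∑ k, (N : ℝ)⁻¹ * (∑ i, V i k) * W k j * Real.exp (-t * d k) := by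
  have : ∀ i, (V * Matrix.diagonal (fun k => Real.exp (-t * d k)) * W) i j =
      ∑ k, V i k * Real.exp (-t * d k) * W k j := by
    intro i
    rw [Matrix.mul_apply]
    simp only [Matrix.mul_diagonal]
  rw [walkProb, htr]
  simp only [this]
  rw [Finset.sum_comm, Finset.mul_sum]
  refine Finset.sum_congr rfl fun k _ => ?_
  rw [Finset.mul_sum, Finset.mul_sum, Finset.sum_mul, Finset.sum_mul]
  refine Finset.sum_congr rfl fun i _ => ?_
  ring

lemma walkMean_eq_sum {N : ℕ} {x : ℕ → ℝ} {V W : Matrix (Fin N) (Fin N) ℝ} {d : Fin N → ℝ} {t : ℝ}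
    (htr : transition N x t = V * Matrix.diagonal (fun k => Real.exp (-t * d k)) * W)
    (f : Fin N → ℝ) :
    walkMean N x f t =
      ∑ k, (N : ℝ)⁻¹ * ((∑ i, V i k) * ∑ j, W k j * f j) * Real.exp (-t * d k) := by
  simp only [walkMean, walkProb_eq_sum htr, Finset.sum_mul]
  rw [Finset.sum_comm]
  refine Finset.sum_congr rfl fun k _ => ?_
  simp only [Finset.mul_sum, Finset.sum_mul]
  rw [Finset.sum_comm]
  refine Finset.sum_congr rfl fun i _ => Finset.sum_congr rfl fun j _ => ?_
  ring

lemma transition_zero (N : ℕ) (x : ℕ → ℝ) : transition N x 0 = 1 := by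
  simp [transition, NormedSpace.exp_zero]

lemma walkProb_zero (N : ℕ) (x : ℕ → ℝ) (j : Fin N) : walkProb N x 0 j = (N : ℝ)⁻¹ := by
  simp [walkProb, transition_zero, Matrix.one_apply]

section

variable {N : ℕ} {x : ℕ → ℝ}

lemma continuous_walkMean (hN : 0 < N) (hx0 : ∀ i, 0 < x i) (hx1 : ∀ i, x i ≤ 1)
    (f : Fin N → ℝ) : Continuous (walkMean N x f) := by
  obtain ⟨V, W, d, -, -, -, htr, -⟩ := exists_diagonalization hN hx0 hx1
  have : walkMean N x f = fun t =>
      ∑ k, (N : ℝ)⁻¹ * ((∑ i, V i k) * ∑ j, W k j * f j) * Real.exp (-t * d k) :=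
    funext fun t => walkMean_eq_sum (htr t) f
  rw [this]
  fun_prop

lemma walkIntensity_nonneg (hN : 0 < N) (hx0 : ∀ i, 0 < x i) (hx1 : ∀ i, x i ≤ 1) (t : ℝ) :
    0 ≤ walkIntensity N x t := by
  obtain ⟨V, W, d, -, -, -, htr, hc⟩ := exists_diagonalization hN hx0 hx1
  rw [walkIntensity, walkMean_eq_sum (htr t)]
  exact Finset.sum_nonneg fun k _ => mul_nonneg (mul_nonneg (by positivity) (hc k))
    (Real.exp_pos _).le

lemma walkIntensity_le_one (hN : 0 < N) (hx0 : ∀ i, 0 < x i) (hx1 : ∀ i, x i ≤ 1) {t : ℝ}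
    (ht : 0 ≤ t) : walkIntensity N x t ≤ 1 := by
  obtain ⟨V, W, d, hd, -, -, htr, hc⟩ := exists_diagonalization hN hx0 hx1
  calc walkIntensity N x t ≤ walkIntensity N x 0 := by
        rw [walkIntensity, walkIntensity, walkMean_eq_sum (htr t), walkMean_eq_sum (htr 0)]
        refine Finset.sum_le_sum fun k _ => mul_le_mul_of_nonneg_left ?_
          (mul_nonneg (by positivity) (hc k))
        refine Real.exp_le_exp.2 ?_
        nlinarith [mul_nonneg ht (hd k).1]
    _ ≤ 1 := by
        simp only [walkIntensity, walkMean, walkProb_zero, ← Finset.mul_sum]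
        rw [inv_mul_le_iff₀ (by positivity), mul_one]
        calc ∑ j : Fin N, x j ≤ ∑ _j : Fin N, (1 : ℝ) := Finset.sum_le_sum fun j _ => hx1 j
          _ = N := by simp

/-- The Kolmogorov forward equation. -/
lemma hasDerivAt_walkProb (hN : 0 < N) (hx0 : ∀ i, 0 < x i) (hx1 : ∀ i, x i ≤ 1) (j : Fin N)
    (t : ℝ) :
    HasDerivAt (fun t => walkProb N x t j)
      (-(x j) * walkProb N x t j + (N : ℝ)⁻¹ * walkIntensity N x t) t := by
  obtain ⟨V, W, d, -, hVW, hgen, htr, -⟩ := exists_diagonalization hN hx0 hx1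
  have hWV : W * V = 1 := mul_eq_one_comm.1 hVW
  have hWL : W * generator N x = Matrix.diagonal d * W := by
    rw [hgen, ← Matrix.mul_assoc, ← Matrix.mul_assoc, hWV, Matrix.one_mul]
  have hWLk : ∀ k, d k * W k j = W k j * x j - (N : ℝ)⁻¹ * ∑ i, W k i * x i := by
    intro k
    have := congrFun (congrFun hWL k) j
    rw [Matrix.diagonal_mul, Matrix.mul_apply] at this
    have hg : ∀ i, W k i * generator N x i j =
        (if i = j then W k i * x i else 0) - (N : ℝ)⁻¹ * (W k i * x i) := by
      intro i
      have : (N : ℝ) ≠ 0 := by positivity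
      simp only [generator]
      split_ifs
      · field_simp
      · field_simp
        ring
    simp only [hg, Finset.sum_sub_distrib, Finset.sum_ite_eq', Finset.mem_univ, if_true,
      ← Finset.mul_sum] at this
    exact this.symm
  have heq : (fun t => walkProb N x t j) = fun t =>
      ∑ k, (N : ℝ)⁻¹ * (∑ i, V i k) * W k j * Real.exp (-t * d k) :=
    funext fun t => walkProb_eq_sum (htr t) j
  have hder : HasDerivAt (fun t => ∑ k, (N : ℝ)⁻¹ * (∑ i, V i k) * W k j * Real.exp (-t * d k))
      (∑ k, (N : ℝ)⁻¹ * (∑ i, V i k) * W k j * (Real.exp (-t * d k) * (-1 * d k))) t := by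
    refine HasDerivAt.fun_sum fun k _ => HasDerivAt.const_mul _ ?_
    exact (((hasDerivAt_id t).neg.mul_const (d k))).exp
  rw [heq]
  convert hder using 1
  rw [walkProb_eq_sum (htr t), walkIntensity, walkMean_eq_sum (htr t), Finset.mul_sum,
    Finset.mul_sum, ← Finset.sum_add_distrib]
  refine Finset.sum_congr rfl fun k _ => ?_
  linear_combination ((N : ℝ)⁻¹ * (∑ i, V i k) * Real.exp (-t * d k)) * (hWLk k)

/-- Decomposition of the law at time `t` according to the last jump before `t`. -/
lemma walkProb_eq_integral (hN : 0 < N) (hx0 : ∀ i, 0 < x i) (hx1 : ∀ i, x i ≤ 1) (j : Fin N)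
    (t : ℝ) :
    walkProb N x t j = (N : ℝ)⁻¹ * (Real.exp (-(x j * t)) +
      ∫ s in (0 : ℝ)..t, Real.exp (-(x j * (t - s))) * walkIntensity N x s) := by
  have hcont : Continuous (walkIntensity N x) := continuous_walkMean hN hx0 hx1 _
  have hder : ∀ s, HasDerivAt (fun s => Real.exp (x j * s) * walkProb N x s j)
      ((N : ℝ)⁻¹ * (Real.exp (x j * s) * walkIntensity N x s)) s := by
    intro s
    have h1 : HasDerivAt (fun s => Real.exp (x j * s)) (Real.exp (x j * s) * (x j * 1)) s :=
      ((hasDerivAt_id s).const_mul (x j)).exp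
    exact (h1.fun_mul (hasDerivAt_walkProb hN hx0 hx1 j s)).congr_deriv (by ring)
  have hftc := intervalIntegral.integral_eq_sub_of_hasDerivAt (a := 0) (b := t)
    (fun s _ => hder s) (by
      refine Continuous.intervalIntegrable ?_ _ _
      fun_prop)
  rw [mul_zero, Real.exp_zero, one_mul, walkProb_zero,
    intervalIntegral.integral_const_mul] at hftc
  have hsplit : ∫ s in (0 : ℝ)..t, Real.exp (-(x j * (t - s))) * walkIntensity N x s =
      Real.exp (-(x j * t)) * ∫ s in (0 : ℝ)..t, Real.exp (x j * s) * walkIntensity N x s := by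
    rw [← intervalIntegral.integral_const_mul]
    refine intervalIntegral.integral_congr fun s _ => ?_
    rw [← mul_assoc, ← Real.exp_add]
    congr 2
    ring
  rw [hsplit]
  have hexp : Real.exp (-(x j * t)) * Real.exp (x j * t) = 1 := by
    rw [← Real.exp_add]
    simp
  linear_combination (-Real.exp (-(x j * t))) * hftc - walkProb N x t j * hexp

end

/-! ### The resolvent and the contour formula -/

/-- For `z` at distance at least `δ` from `[0,1]` all the numbers `(z - p)⁻¹`, `p ∈ [0,1]`, lie
in a half plane that stays away from `0`: the segment `z - [0,1]` is convex, so a half plane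
separates it from `0`. -/
lemma exists_halfplane {z : ℂ} {δ R : ℝ} (hδ : 0 < δ) (hR : ‖z‖ ≤ R)
    (hz : ∀ p ∈ Set.Icc (0 : ℝ) 1, δ ≤ ‖z - p‖) :
    ∃ w : ℂ, ‖w‖ = 1 ∧ ∀ p ∈ Set.Icc (0 : ℝ) 1, δ / (R + 1) ^ 2 ≤ (w * (z - p)⁻¹).re := by
  -- the point `q` of `[0,1]` closest to `z`
  obtain ⟨q, hq, hmin⟩ := (isCompact_Icc (a := (0 : ℝ)) (b := 1)).exists_isMinOn
    ⟨0, by simp⟩ (f := fun p : ℝ => ‖z - p‖) (by fun_prop)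
  have hq0 : 0 < ‖z - q‖ := hδ.trans_le (hz q hq)
  have hn0 : ∀ p ∈ Set.Icc (0 : ℝ) 1, 0 < ‖z - p‖ := fun p hp => hδ.trans_le (hz p hp)
  have hnle : ∀ p ∈ Set.Icc (0 : ℝ) 1, ‖z - p‖ ≤ R + 1 := by
    intro p hp
    calc ‖z - p‖ ≤ ‖z‖ + ‖(p : ℂ)‖ := norm_sub_le _ _
      _ ≤ R + 1 := by
        rw [Complex.norm_real, Real.norm_eq_abs, abs_of_nonneg hp.1]
        linarith [hp.2]
  -- the variational inequality for the closest point
  have hvar : ∀ p ∈ Set.Icc (0 : ℝ) 1, 0 ≤ (q - p) * (z.re - q) := by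
    intro p hp
    by_contra! hneg
    have hsq : ∀ r : ℝ, ‖z - r‖ ^ 2 = (z.re - r) ^ 2 + z.im ^ 2 := by
      intro r
      rw [← Complex.normSq_eq_norm_sq, Complex.normSq_apply]
      simp
      ring
    have hpq : p ≠ q := by
      rintro rfl
      simp at hneg
    have hpq2 : 0 < (p - q) ^ 2 := by
      have := sub_ne_zero.2 hpq
      positivity
    set a := (p - q) * (z.re - q) with ha
    have ha0 : 0 < a := by rw [ha]; linarith
    set r := min 1 (a / (p - q) ^ 2) with hr
    have hr0 : 0 < r := lt_min one_pos (div_pos ha0 hpq2)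
    have hr1 : r ≤ 1 := min_le_left _ _
    have hr2 : r * (p - q) ^ 2 ≤ a := by
      rw [← le_div_iff₀ hpq2]
      exact min_le_right _ _
    have hmem : q + r * (p - q) ∈ Set.Icc (0 : ℝ) 1 := by
      have := (convex_Icc (0 : ℝ) 1).add_smul_sub_mem hq hp ⟨hr0.le, hr1⟩
      simpa using this
    have h1 : ‖z - q‖ ≤ ‖z - ((q + r * (p - q) : ℝ) : ℂ)‖ := hmin hmem
    have h2 := pow_le_pow_left₀ (norm_nonneg _) h1 2
    rw [hsq, hsq] at h2
    nlinarith [mul_pos hr0 ha0, mul_le_mul_of_nonneg_left hr2 hr0.le]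
  refine ⟨(z - q) / ‖z - q‖, ?_, fun p hp => ?_⟩
  · rw [norm_div, Complex.norm_real, norm_norm, div_self hq0.ne']
  have hre : ((z - q) / ‖z - q‖ * (z - p)⁻¹).re =
      ((z.re - q) * (z.re - p) + z.im ^ 2) / (‖z - q‖ * ‖z - p‖ ^ 2) := by
    rw [Complex.inv_def, Complex.normSq_eq_norm_sq]
    have : (z - q) / ‖z - q‖ * ((starRingEnd ℂ) (z - p) * (((‖z - p‖ ^ 2)⁻¹ : ℝ) : ℂ)) =
        ((z - q) * (starRingEnd ℂ) (z - p)) * (((‖z - q‖ * ‖z - p‖ ^ 2)⁻¹ : ℝ) : ℂ) := by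
      push_cast
      rw [mul_inv]
      ring
    rw [this, Complex.re_mul_ofReal, div_eq_mul_inv]
    congr 1
    simp
    ring
  have hsq : (z.re - q) ^ 2 + z.im ^ 2 = ‖z - q‖ ^ 2 := by
    rw [← Complex.normSq_eq_norm_sq, Complex.normSq_apply]
    simp
    ring
  have hnum : ‖z - q‖ ^ 2 ≤ (z.re - q) * (z.re - p) + z.im ^ 2 := by
    nlinarith [hvar p hp]
  rw [hre]
  calc δ / (R + 1) ^ 2 ≤ ‖z - q‖ / ‖z - p‖ ^ 2 := by
        have := hnle p hp
        have := hn0 p hp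
        have := hz q hq
        gcongr
    _ = ‖z - q‖ ^ 2 / (‖z - q‖ * ‖z - p‖ ^ 2) := by
        have := (hn0 p hp).ne'
        field_simp
    _ ≤ _ := by
        have := hn0 p hp
        gcongr

/-- The empirical Stieltjes transform `N⁻¹ ∑ j, f_j / (z - x_j)`. -/
noncomputable def stieltjes (N : ℕ) (x : ℕ → ℝ) (f : Fin N → ℝ) (z : ℂ) : ℂ :=
  (N : ℂ)⁻¹ * ∑ j, (f j : ℂ) / (z - x j)

section

variable {N : ℕ} {x : ℕ → ℝ}

lemma le_norm_stieltjes_one (hN : 0 < N) (hx0 : ∀ i, 0 < x i) (hx1 : ∀ i, x i ≤ 1) {z : ℂ}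
    {δ R : ℝ} (hδ : 0 < δ) (hR : ‖z‖ ≤ R) (hz : ∀ p ∈ Set.Icc (0 : ℝ) 1, δ ≤ ‖z - p‖) :
    δ / (R + 1) ^ 2 ≤ ‖stieltjes N x 1 z‖ := by
  obtain ⟨w, hw, hre⟩ := exists_halfplane hδ hR hz
  have h1 : (w * stieltjes N x 1 z).re = (N : ℝ)⁻¹ * ∑ j : Fin N, (w * (z - x j)⁻¹).re := by
    have : w * stieltjes N x 1 z = (((N : ℝ)⁻¹ : ℝ) : ℂ) * ∑ j : Fin N, w * (z - x j)⁻¹ := by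
      rw [stieltjes, ← Finset.mul_sum]
      simp
      ring
    rw [this, Complex.re_ofReal_mul, Complex.re_sum]
  calc δ / (R + 1) ^ 2 = (N : ℝ)⁻¹ * ∑ j : Fin N, δ / (R + 1) ^ 2 := by
        have : (N : ℝ) ≠ 0 := by positivity
        simp only [Finset.sum_const, Finset.card_univ, Fintype.card_fin, nsmul_eq_mul]
        field_simp
    _ ≤ (w * stieltjes N x 1 z).re := by
        rw [h1]
        gcongr with j
        exact hre (x j) ⟨(hx0 j).le, hx1 j⟩
    _ ≤ ‖w * stieltjes N x 1 z‖ := Complex.re_le_norm _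
    _ = ‖stieltjes N x 1 z‖ := by rw [norm_mul, hw, one_mul]

lemma norm_stieltjes_le (hN : 0 < N) (hx0 : ∀ i, 0 < x i) (hx1 : ∀ i, x i ≤ 1) {f : Fin N → ℝ}
    {C : ℝ} (hf : ∀ j, |f j| ≤ C) {z : ℂ} {δ : ℝ} (hδ : 0 < δ)
    (hz : ∀ p ∈ Set.Icc (0 : ℝ) 1, δ ≤ ‖z - p‖) :
    ‖stieltjes N x f z‖ ≤ C / δ := by
  rw [stieltjes, norm_mul, norm_inv, Complex.norm_natCast]
  calc (N : ℝ)⁻¹ * ‖∑ j, (f j : ℂ) / (z - x j)‖ ≤ (N : ℝ)⁻¹ * ∑ j : Fin N, C / δ := by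
        gcongr
        refine norm_sum_le_of_le _ fun j _ => ?_
        rw [norm_div, Complex.norm_real]
        exact div_le_div₀ ((abs_nonneg _).trans (hf j)) (hf j) hδ
          (hz (x j) ⟨(hx0 j).le, hx1 j⟩)
    _ = C / δ := by
        have : (N : ℝ) ≠ 0 := by positivity
        simp only [Finset.sum_const, Finset.card_univ, Fintype.card_fin, nsmul_eq_mul]
        field_simp

/-- The mean of the resolvent of the generator; the generator is a rank one perturbation of
a diagonal matrix, so that its resolvent is explicit. -/
lemma sum_div_sub_eigenvalue (hN : 0 < N) {V W : Matrix (Fin N) (Fin N) ℝ} {d : Fin N → ℝ}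
    (hVW : V * W = 1) (hgen : generator N x = V * Matrix.diagonal d * W) (f : Fin N → ℝ)
    {z : ℂ} (hz0 : z ≠ 0) (hzx : ∀ j : Fin N, z - x j ≠ 0) (hzd : ∀ k, z - d k ≠ 0)
    (h1 : stieltjes N x 1 z ≠ 0) :
    ∑ k, (((N : ℝ)⁻¹ * ((∑ i, V i k) * ∑ j, W k j * f j) : ℝ) : ℂ) / (z - d k) =
      stieltjes N x f z / (z * stieltjes N x 1 z) := by
  have hN' : (N : ℂ) ≠ 0 := by exact_mod_cast hN.ne'
  let w : Fin N → ℝ := fun k => ∑ j, W k j * f j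
  have hVw : ∀ i, ∑ k, V i k * w k = f i := by
    intro i
    have := congrFun (Matrix.mulVec_mulVec f V W) i
    rw [hVW, Matrix.one_mulVec] at this
    exact this
  have hLV : generator N x * V = V * Matrix.diagonal d := by
    rw [hgen, Matrix.mul_assoc, mul_eq_one_comm.1 hVW, Matrix.mul_one]
  have hLVk : ∀ i k, V i k * d k = x i * V i k - (N : ℝ)⁻¹ * x i * ∑ j, V j k := by
    intro i k
    have := congrFun (congrFun hLV i) k
    rw [Matrix.mul_diagonal, Matrix.mul_apply] at this
    have hg : ∀ j, generator N x i j * V j k =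
        (if i = j then x i * V j k else 0) - (N : ℝ)⁻¹ * x i * V j k := by
      intro j
      have : (N : ℝ) ≠ 0 := by exact_mod_cast hN.ne'
      simp only [generator]
      split_ifs
      · field_simp
      · field_simp
        ring
    simp only [hg, Finset.sum_sub_distrib, Finset.sum_ite_eq, Finset.mem_univ, if_true,
      ← Finset.mul_sum] at this
    exact this.symm
  -- `g` solves `(z - 𝕃) g = f`, and `M` is its mean
  let g : Fin N → ℂ := fun i => ∑ k, (V i k : ℂ) * w k / (z - d k)
  let M : ℂ := (N : ℂ)⁻¹ * ∑ i, g i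
  have hM : ∑ k, (((N : ℝ)⁻¹ * ((∑ i, V i k) * w k) : ℝ) : ℂ) / (z - d k) = M := by
    simp only [M, g]
    rw [Finset.sum_comm, Finset.mul_sum]
    refine Finset.sum_congr rfl fun k _ => ?_
    push_cast
    rw [← Finset.sum_div, ← Finset.sum_mul]
    ring
  have hgi : ∀ i : Fin N, (z - x i) * g i + x i * M = f i := by
    intro i
    have hMk : (x i : ℂ) * M = ∑ k, (((N : ℝ)⁻¹ * x i * ∑ j, V j k : ℝ) : ℂ) * w k / (z - d k) := by
      rw [← hM, Finset.mul_sum]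
      refine Finset.sum_congr rfl fun k _ => ?_
      push_cast
      ring
    rw [hMk, Finset.mul_sum, ← Finset.sum_add_distrib, ← hVw i]
    push_cast
    refine Finset.sum_congr rfl fun k _ => ?_
    have hk := congrArg (fun r : ℝ => (r : ℂ)) (hLVk i k)
    push_cast at hk
    have hzk := hzd k
    field_simp
    field_simp at hk
    linear_combination (w k : ℂ) * hk
  have hgi' : ∀ i, g i = (f i : ℂ) / (z - x i) - M * (z / (z - x i) - 1) := by
    intro i
    have := hgi i
    have hz := hzx i
    field_simp
    linear_combination this
  have hone : stieltjes N x 1 z = (N : ℂ)⁻¹ * ∑ j : Fin N, 1 / (z - x j) := by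
    simp [stieltjes]
  have hmean : M = stieltjes N x f z - M * (z * stieltjes N x 1 z - 1) := by
    have : ∑ i, g i = ∑ i : Fin N, (f i : ℂ) / (z - x i) -
        M * (z * (∑ i : Fin N, 1 / (z - x i)) - N) := by
      simp only [hgi', Finset.sum_sub_distrib, ← Finset.mul_sum]
      congr 2
      rw [Finset.mul_sum]
      simp [div_eq_mul_inv]
    calc M = (N : ℂ)⁻¹ * ∑ i, g i := rfl
      _ = _ := by
        rw [this, hone, stieltjes]
        field_simp
  change ∑ k, (((N : ℝ)⁻¹ * ((∑ i, V i k) * w k) : ℝ) : ℂ) / (z - d k) = _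
  rw [hM, eq_div_iff (mul_ne_zero hz0 h1)]
  linear_combination hmean

lemma continuousOn_stieltjes {γ : ℝ → ℂ} (hγ : IsLoopAroundUnitInterval γ) (hx0 : ∀ i, 0 < x i)
    (hx1 : ∀ i, x i ≤ 1) (f : Fin N → ℝ) :
    ContinuousOn (fun s => stieltjes N x f (γ s)) (Set.Icc 0 1) := by
  refine continuousOn_const.mul (continuousOn_finsetSum _ fun j _ => ?_)
  refine ContinuousOn.div continuousOn_const (hγ.continuousOn.sub continuousOn_const)
    fun s hs => sub_ne_zero.2 (hγ.avoids s hs (x j) ⟨(hx0 j).le, hx1 j⟩)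

lemma stieltjes_one_ne_zero {γ : ℝ → ℂ} (hγ : IsLoopAroundUnitInterval γ) (hN : 0 < N)
    (hx0 : ∀ i, 0 < x i) (hx1 : ∀ i, x i ≤ 1) {s : ℝ} (hs : s ∈ Set.Icc (0 : ℝ) 1) :
    stieltjes N x 1 (γ s) ≠ 0 := by
  obtain ⟨R, δ, hR0, hδ, hR, hd⟩ := hγ.exists_bounds
  have := le_norm_stieltjes_one hN hx0 hx1 hδ (hR s hs).le (hd s hs)
  rw [← norm_pos_iff]
  exact lt_of_lt_of_le (by positivity) this

lemma continuousOn_contour_integrand {γ : ℝ → ℂ} (hγ : IsLoopAroundUnitInterval γ) (hN : 0 < N)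
    (hx0 : ∀ i, 0 < x i) (hx1 : ∀ i, x i ≤ 1) (f : Fin N → ℝ) (t : ℝ) :
    ContinuousOn (fun s => Complex.exp (-t * γ s) / γ s *
      (stieltjes N x f (γ s) / stieltjes N x 1 (γ s))) (Set.Icc 0 1) := by
  have hγc := hγ.continuousOn
  refine ContinuousOn.mul (ContinuousOn.div (by fun_prop) hγc fun s hs => ?_)
    ((continuousOn_stieltjes hγ hx0 hx1 f).div (continuousOn_stieltjes hγ hx0 hx1 1)
      fun s hs => stieltjes_one_ne_zero hγ hN hx0 hx1 hs)
  simpa using hγ.avoids s hs 0 (by simp)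

/-- The contour formula for the walk on finitely many vertices. -/
lemma walkMean_eq_contourIntegral {γ : ℝ → ℂ} (hγ : IsLoopAroundUnitInterval γ) (hN : 0 < N)
    (hx0 : ∀ i, 0 < x i) (hx1 : ∀ i, x i ≤ 1) (f : Fin N → ℝ) (t : ℝ) :
    (walkMean N x f t : ℂ) = (2 * Real.pi * Complex.I)⁻¹ * contourIntegral γ (fun z =>
      Complex.exp (-t * z) / z * (stieltjes N x f z / stieltjes N x 1 z)) := by
  obtain ⟨V, W, d, hd, hVW, hgen, htr, -⟩ := exists_diagonalization hN hx0 hx1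
  set c : Fin N → ℝ := fun k => (N : ℝ)⁻¹ * ((∑ i, V i k) * ∑ j, W k j * f j) with hc
  have hexp : Differentiable ℂ fun z : ℂ => Complex.exp (-t * z) := by fun_prop
  have hint : ∀ k, IntervalIntegrable
      (fun s => deriv γ s * (Complex.exp (-t * γ s) / (γ s - d k))) volume 0 1 := by
    intro k
    refine hγ.intervalIntegrable (f := fun z => Complex.exp (-t * z) / (z - d k)) ?_
    have hγc := hγ.continuousOn
    exact ContinuousOn.div (by fun_prop) (by fun_prop)
      fun s hs => sub_ne_zero.2 (hγ.avoids s hs (d k) (hd k))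
  have hsum : contourIntegral γ (fun z =>
      Complex.exp (-t * z) / z * (stieltjes N x f z / stieltjes N x 1 z)) =
      ∑ k, (c k : ℂ) * contourIntegral γ (fun z => Complex.exp (-t * z) / (z - d k)) := by
    unfold contourIntegral
    simp only [← intervalIntegral.integral_const_mul]
    rw [← intervalIntegral.integral_finsetSum fun k _ => (hint k).const_mul _]
    refine intervalIntegral.integral_congr fun s hs => ?_
    rw [Set.uIcc_of_le zero_le_one] at hs
    have h0 : γ s ≠ 0 := by simpa using hγ.avoids s hs 0 (by simp)
    have h1 := stieltjes_one_ne_zero hγ hN hx0 hx1 hs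
    have hres := sum_div_sub_eigenvalue hN hVW hgen f h0
      (fun j => sub_ne_zero.2 (hγ.avoids s hs (x j) ⟨(hx0 j).le, hx1 j⟩))
      (fun k => sub_ne_zero.2 (hγ.avoids s hs (d k) (hd k))) h1
    have : Complex.exp (-t * γ s) / γ s * (stieltjes N x f (γ s) / stieltjes N x 1 (γ s)) =
        Complex.exp (-t * γ s) * (stieltjes N x f (γ s) / (γ s * stieltjes N x 1 (γ s))) := by
      field_simp
    rw [this, ← hres, Finset.mul_sum, Finset.mul_sum]
    refine Finset.sum_congr rfl fun k _ => ?_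
    ring
  have hmean : walkMean N x f t = ∑ k, c k * Real.exp (-t * d k) := walkMean_eq_sum (htr t) f
  rw [hsum, Finset.mul_sum, hmean, Complex.ofReal_sum]
  refine Finset.sum_congr rfl fun k _ => ?_
  rw [mul_left_comm, hγ.contourIntegral_div_sub hexp (hd k)]
  push_cast
  rfl

end

/-! ### Gamma laws and the law of `exp (-E i)` -/

lemma integral_gammaMeasure {a r : ℝ} (ha : 0 < a) (hr : 0 < r) (f : ℝ → ℝ) :
    ∫ x, f x ∂(gammaMeasure a r) =
      ∫ x in Set.Ioi 0, r ^ a / Real.Gamma a * x ^ (a - 1) * Real.exp (-(r * x)) * f x := by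
  have h1 : Measurable (gammaPDF a r) := (measurable_gammaPDFReal a r).ennreal_ofReal
  rw [gammaMeasure, integral_withDensity_eq_integral_toReal_smul h1
    (ae_of_all _ fun x => ENNReal.ofReal_lt_top), ← integral_Ici_eq_integral_Ioi,
    ← integral_indicator measurableSet_Ici]
  refine integral_congr_ae (ae_of_all _ fun x => ?_)
  by_cases hx : 0 ≤ x
  · have hG := Real.Gamma_pos_of_pos ha
    simp only [smul_eq_mul]
    rw [Set.indicator_of_mem (show x ∈ Set.Ici 0 from hx), gammaPDF_of_nonneg hx,
      ENNReal.toReal_ofReal (by positivity)]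
  · simp only [smul_eq_mul]
    rw [Set.indicator_of_notMem (show x ∉ Set.Ici 0 from hx), gammaPDF_of_neg (not_le.1 hx)]
    simp

lemma integral_exp_neg_gammaMeasure {a r θ : ℝ} (ha : 0 < a) (hr : 0 < r) (hθ : 0 ≤ θ) :
    ∫ x, Real.exp (-(θ * x)) ∂(gammaMeasure a r) = (r / (r + θ)) ^ a := by
  have hG := Real.Gamma_pos_of_pos ha
  have hrθ : 0 < r + θ := by positivity
  rw [integral_gammaMeasure ha hr]
  have : ∀ x, r ^ a / Real.Gamma a * x ^ (a - 1) * Real.exp (-(r * x)) * Real.exp (-(θ * x)) =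
      r ^ a / Real.Gamma a * (x ^ (a - 1) * Real.exp (-((r + θ) * x))) := by
    intro x
    rw [mul_assoc, mul_assoc, ← Real.exp_add]
    congr 3
    ring
  simp only [this]
  rw [integral_const_mul, Real.integral_rpow_mul_exp_neg_mul_Ioi ha hrθ,
    Real.div_rpow zero_le_one hrθ.le, Real.div_rpow hr.le hrθ.le, Real.one_rpow]
  field_simp

lemma ae_pos_gammaMeasure (a r : ℝ) : ∀ᵐ x ∂(gammaMeasure a r), 0 < x := by
  have h1 : Measurable (gammaPDF a r) := (measurable_gammaPDFReal a r).ennreal_ofReal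
  rw [gammaMeasure, ae_withDensity_iff h1]
  have h0 : ∀ᵐ x : ℝ, x ≠ 0 := by simp [ae_iff]
  filter_upwards [h0] with x hx hpdf
  by_contra hneg
  exact hpdf (gammaPDF_of_neg (lt_of_le_of_ne (not_lt.1 hneg) hx))

/-- The law `α x^(α-1) dx` on `(0,1)` of `exp (-E i)`. -/
noncomputable def rateLaw (α : ℝ) : Measure ℝ :=
  (volume.restrict (Set.Ioc 0 1)).withDensity fun x => ENNReal.ofReal (α * x ^ (α - 1))

section

variable {α : ℝ}

lemma integral_rateLaw (hα : 0 < α) {F : Type*} [NormedAddCommGroup F] [NormedSpace ℝ F]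
    (f : ℝ → F) : ∫ x, f x ∂(rateLaw α) = ∫ x in (0 : ℝ)..1, (α * x ^ (α - 1)) • f x := by
  have h1 : Measurable fun x : ℝ => ENNReal.ofReal (α * x ^ (α - 1)) := by fun_prop
  rw [rateLaw, integral_withDensity_eq_integral_toReal_smul h1
    (ae_of_all _ fun x => ENNReal.ofReal_lt_top), intervalIntegral.integral_of_le zero_le_one]
  refine setIntegral_congr_fun measurableSet_Ioc fun x hx => ?_
  have := hx.1
  rw [ENNReal.toReal_ofReal (by positivity)]

lemma integral_pow_rateLaw (hα : 0 < α) (k : ℕ) : ∫ x, x ^ k ∂(rateLaw α) = α / (α + k) := by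
  rw [integral_rateLaw hα]
  have h : ∀ x ∈ Set.uIoc (0 : ℝ) 1, (α * x ^ (α - 1)) • x ^ k = α * x ^ (α - 1 + k) := by
    intro x hx
    rw [Set.uIoc_of_le zero_le_one] at hx
    rw [smul_eq_mul, Real.rpow_add hx.1, Real.rpow_natCast, mul_assoc]
  rw [intervalIntegral.integral_congr_ae (ae_of_all _ h), intervalIntegral.integral_const_mul,
    integral_rpow (Or.inl (by have : (0 : ℝ) ≤ k := k.cast_nonneg
                              linarith))]
  have : α - 1 + k + 1 = α + k := by ring
  have hpos : 0 < α + k := by positivity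
  rw [this, Real.one_rpow, Real.zero_rpow hpos.ne']
  ring

lemma ae_mem_rateLaw : ∀ᵐ x ∂(rateLaw α), x ∈ Set.Ioc (0 : ℝ) 1 :=
  (withDensity_absolutelyContinuous _ _).ae_le (ae_restrict_mem measurableSet_Ioc)

lemma isProbabilityMeasure_rateLaw (hα : 0 < α) : IsProbabilityMeasure (rateLaw α) := by
  constructor
  have h : ∫⁻ x in Set.Ioc (0 : ℝ) 1, ENNReal.ofReal (α * x ^ (α - 1)) =
      ENNReal.ofReal (∫ x in Set.Ioc (0 : ℝ) 1, α * x ^ (α - 1)) := by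
    rw [← ofReal_integral_eq_lintegral_ofReal]
    · have := (intervalIntegral.intervalIntegrable_rpow' (a := 0) (b := 1)
        (r := α - 1) (by linarith)).const_mul α
      rwa [intervalIntegrable_iff_integrableOn_Ioc_of_le zero_le_one] at this
    · filter_upwards [ae_restrict_mem measurableSet_Ioc] with x hx
      have := hx.1
      simp only [Pi.zero_apply]
      positivity
  rw [rateLaw, withDensity_apply _ MeasurableSet.univ, Measure.restrict_univ, h,
    ← intervalIntegral.integral_of_le zero_le_one]
  have := integral_pow_rateLaw hα 0
  rw [integral_rateLaw hα] at this
  simp only [pow_zero, smul_eq_mul, mul_one, Nat.cast_zero, add_zero, div_self hα.ne'] at this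
  rw [this, ENNReal.ofReal_one]

instance : NullSingletonClass (rateLaw α) := by
  unfold rateLaw
  infer_instance

end

/-- A realisation `x` of the jump rates is typical if it takes values in `(0,1]` and the moments of
its empirical measures converge to those of `rateLaw α`. -/
structure IsTypical (α : ℝ) (x : ℕ → ℝ) : Prop where
  pos : ∀ i, 0 < x i
  le_one : ∀ i, x i ≤ 1
  tendsto_moment : ∀ k : ℕ,
    Tendsto (fun n : ℕ => (n : ℝ)⁻¹ * ∑ j : Fin n, x j ^ k) atTop (𝓝 (α / (α + k)))

/-- Almost every landscape is typical, by the strong law of large numbers. -/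
lemma ae_isTypical {Ω : Type*} [MeasurableSpace Ω] {μ : Measure Ω} [IsProbabilityMeasure μ]
    {α : ℝ} (hα : 0 < α) {E : ℕ → Ω → ℝ} (hE_law : ∀ i, HasLaw (E i) (expMeasure α) μ)
    (hE_indep : iIndepFun E μ) : ∀ᵐ ω ∂μ, IsTypical α (fun i => Real.exp (-E i ω)) := by
  have hpos : ∀ᵐ ω ∂μ, ∀ i, 0 < E i ω := by
    rw [ae_all_iff]
    intro i
    rw [(hE_law i).ae_iff (p := fun x => 0 < x) (measurableSet_setOfPred.1 measurableSet_Ioi)]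
    exact ae_pos_gammaMeasure 1 α
  have hmom : ∀ᵐ ω ∂μ, ∀ k : ℕ, Tendsto (fun n : ℕ =>
      (∑ i ∈ Finset.range n, Real.exp (-(k * E i ω))) / n) atTop (𝓝 (α / (α + k))) := by
    rw [ae_all_iff]
    intro k
    have hg : Measurable fun e : ℝ => Real.exp (-(k * e)) := by fun_prop
    have hmean : ∫ ω, Real.exp (-(k * E 0 ω)) ∂μ = α / (α + k) := by
      have h1 : ∫ ω, Real.exp (-(k * E 0 ω)) ∂μ = ∫ e, Real.exp (-(k * e)) ∂(expMeasure α) :=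
        (hE_law 0).integral_comp hg.aestronglyMeasurable
      rw [h1, expMeasure, integral_exp_neg_gammaMeasure one_pos hα k.cast_nonneg, Real.rpow_one]
    have := strong_law_ae_real (fun i ω => Real.exp (-(k * E i ω))) (μ := μ) ?_ ?_ ?_
    · rwa [hmean] at this
    · refine Integrable.mono' (integrable_const 1)
        (hg.comp_aemeasurable (hE_law 0).aemeasurable).aestronglyMeasurable ?_
      filter_upwards [hpos] with ω hω
      rw [Real.norm_eq_abs, Real.abs_exp]
      exact Real.exp_le_one_iff.2 (neg_nonpos.2 (mul_nonneg k.cast_nonneg (hω 0).le))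
    · intro i j hij
      exact (hE_indep.indepFun hij).comp hg hg
    · intro i
      have : IdentDistrib (E i) (E 0) μ μ :=
        ⟨(hE_law i).aemeasurable, (hE_law 0).aemeasurable,
          (hE_law i).map_eq.trans (hE_law 0).map_eq.symm⟩
      exact this.comp hg
  filter_upwards [hpos, hmom] with ω h1 h2
  refine ⟨fun i => Real.exp_pos _, fun i => Real.exp_le_one_iff.2 (neg_nonpos.2 (h1 i).le),
    fun k => ?_⟩
  refine (h2 k).congr fun n => ?_
  rw [div_eq_inv_mul, Fin.sum_univ_eq_sum_range fun i => Real.exp (-E i ω) ^ k]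
  congr 1
  refine Finset.sum_congr rfl fun i _ => ?_
  rw [← Real.exp_nat_mul]
  congr 1
  ring

/-! ### Piecewise continuous test functions -/

/-- The complement in `ℝ` of the set of continuity points of `h` in `(0,∞)`. -/
def irregularSet (h : ℝ → ℝ) : Set ℝ := {z | z ≤ 0 ∨ ¬ ContinuousAt h z}

section

variable {h : ℝ → ℝ}

lemma isClosed_irregularSet (hp : IsPiecewiseContinuousOnPos h) : IsClosed (irregularSet h) := by
  rw [← isOpen_compl_iff, isOpen_iff_mem_nhds]
  intro z hz
  simp only [irregularSet, Set.mem_compl_iff, Set.mem_ofPred_eq, not_or, not_le, not_not] at hz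
  have hfin := hp (z / 2) (2 * z) (by linarith [hz.1])
  have hnhds : {y ∈ Set.Icc (z / 2) (2 * z) | ¬ ContinuousAt h y}ᶜ ∈ 𝓝 z :=
    hfin.isClosed.isOpen_compl.mem_nhds fun hmem => hmem.2 hz.2
  filter_upwards [hnhds, Icc_mem_nhds (show z / 2 < z by linarith [hz.1])
    (show z < 2 * z by linarith [hz.1])] with y h1 h2
  simp only [irregularSet, Set.mem_compl_iff, Set.mem_ofPred_eq, not_or, not_le, not_not]
  exact ⟨by linarith [h2.1, hz.1], not_not.1 fun hcon => h1 ⟨h2, hcon⟩⟩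

lemma countable_irregularSet_inter (hp : IsPiecewiseContinuousOnPos h) :
    (irregularSet h ∩ Set.Ioi 0).Countable := by
  refine Set.Countable.mono (s₂ := ⋃ n : ℕ,
    {z ∈ Set.Icc (1 / ((n : ℝ) + 1)) n | ¬ ContinuousAt h z}) ?_
    (Set.countable_iUnion fun n => (hp _ _ (by positivity)).countable)
  rintro z ⟨hz, hz0 : 0 < z⟩
  obtain ⟨n, hn⟩ := exists_nat_gt (max z (1 / z))
  refine Set.mem_iUnion.2 ⟨n, ⟨?_, ((le_max_left _ _).trans_lt hn).le⟩,
    hz.resolve_left (not_le.2 hz0)⟩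
  have h1 : 1 / z < (n : ℝ) + 1 := by linarith [(le_max_right _ _).trans_lt hn]
  rw [div_lt_iff₀ hz0] at h1
  rw [div_le_iff₀ (by positivity)]
  linarith

lemma continuousAt_indicator_pos {z : ℝ} (hz : z ∉ irregularSet h) :
    ContinuousAt (Set.indicator (Set.Ioi 0) h) z := by
  simp only [irregularSet, Set.mem_ofPred_eq, not_or, not_le, not_not] at hz
  refine hz.2.congr ?_
  filter_upwards [Ioi_mem_nhds hz.1] with y hy
  exact (Set.indicator_of_mem hy h).symm

lemma abs_indicator_pos_le {C : ℝ} (hC : ∀ z, 0 < z → |h z| ≤ C) (z : ℝ) :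
    |Set.indicator (Set.Ioi 0) h z| ≤ C := by
  by_cases hz : 0 < z
  · rw [Set.indicator_of_mem (show z ∈ Set.Ioi 0 from hz)]
    exact hC z hz
  · rw [Set.indicator_of_notMem (show z ∉ Set.Ioi 0 from hz), abs_zero]
    exact (abs_nonneg _).trans (hC 1 one_pos)

lemma measurable_indicator_pos (hp : IsPiecewiseContinuousOnPos h) :
    Measurable (Set.indicator (Set.Ioi 0) h) := by
  refine measurable_of_isOpen fun U hU => ?_
  have hD := isClosed_irregularSet hp
  have hcont : ContinuousOn (Set.indicator (Set.Ioi 0) h) (irregularSet h)ᶜ := fun z hz =>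
    (continuousAt_indicator_pos hz).continuousWithinAt
  set g := Set.indicator (Set.Ioi 0) h with hg
  have hsplit : g ⁻¹' U = ((irregularSet h)ᶜ ∩ g ⁻¹' U) ∪
      ((irregularSet h ∩ Set.Ioi 0) ∩ g ⁻¹' U) ∪ (Set.Iic 0 ∩ g ⁻¹' U) := by
    ext z
    by_cases h1 : z ∈ irregularSet h <;> by_cases h2 : 0 < z <;>
      simp [h1, h2, not_lt.1]
  rw [hsplit]
  refine ((hcont.isOpen_inter_preimage hD.isOpen_compl hU).measurableSet.union
    ((countable_irregularSet_inter hp).mono Set.inter_subset_left).measurableSet).union ?_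
  have hzero : ∀ z ∈ Set.Iic (0 : ℝ), g z = 0 := fun z hz =>
    Set.indicator_of_notMem (not_lt.2 hz) h
  by_cases h0 : (0 : ℝ) ∈ U
  · have : Set.Iic 0 ∩ g ⁻¹' U = Set.Iic 0 := by
      refine Set.inter_eq_left.2 fun z hz => ?_
      rwa [Set.mem_preimage, hzero z hz]
    rw [this]
    exact measurableSet_Iic
  · have : Set.Iic 0 ∩ g ⁻¹' U = ∅ := by
      refine Set.eq_empty_of_forall_notMem fun z hz => h0 ?_
      rw [← hzero z hz.1]
      exact hz.2
    rw [this]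
    exact MeasurableSet.empty

lemma measure_irregularSet {σ : Measure ℝ} [NullSingletonClass σ] (hσ : ∀ᵐ z ∂σ, 0 < z)
    (hp : IsPiecewiseContinuousOnPos h) : σ (irregularSet h) = 0 := by
  have : irregularSet h ⊆ (irregularSet h ∩ Set.Ioi 0) ∪ Set.Iic 0 := fun z hz => by
    by_cases h2 : 0 < z
    · exact Or.inl ⟨hz, h2⟩
    · exact Or.inr (not_lt.1 h2)
  refine measure_mono_null this (measure_union_null
    ((countable_irregularSet_inter hp).measure_zero σ) ?_)
  rw [measure_eq_zero_iff_ae_notMem]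
  filter_upwards [hσ] with z hz
  exact not_le.2 hz

lemma IsBoundedOnPos.comp_mul_left (hb : IsBoundedOnPos h) {t : ℝ} (ht : 0 < t) :
    IsBoundedOnPos fun x => h (t * x) := by
  obtain ⟨C, hC⟩ := hb
  exact ⟨C, fun z hz => hC _ (mul_pos ht hz)⟩

lemma IsPiecewiseContinuousOnPos.comp_mul_left (hp : IsPiecewiseContinuousOnPos h) {t : ℝ}
    (ht : 0 < t) : IsPiecewiseContinuousOnPos fun x => h (t * x) := by
  intro a b ha
  refine ((hp (t * a) (t * b) (mul_pos ht ha)).preimage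
    (f := fun x => t * x) (mul_right_injective₀ ht.ne').injOn).subset ?_
  rintro z ⟨hz, hcont⟩
  refine ⟨⟨mul_le_mul_of_nonneg_left hz.1 ht.le, mul_le_mul_of_nonneg_left hz.2 ht.le⟩,
    fun hc => hcont ?_⟩
  exact ContinuousAt.comp (f := fun x => t * x) hc (by fun_prop)

lemma _root_.Continuous.isPiecewiseContinuousOnPos (hh : Continuous h) :
    IsPiecewiseContinuousOnPos h := by
  intro a b _
  have : {z ∈ Set.Icc a b | ¬ ContinuousAt h z} = ∅ :=
    Set.eq_empty_of_forall_notMem fun z hz => hz.2 hh.continuousAt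
  rw [this]
  exact Set.finite_empty

/-- Bounded piecewise continuous functions are integrable. -/
lemma integrable_of_isPiecewiseContinuousOnPos {σ : Measure ℝ} [IsFiniteMeasure σ]
    (hσ : ∀ᵐ z ∂σ, 0 < z) (hb : IsBoundedOnPos h) (hp : IsPiecewiseContinuousOnPos h) :
    Integrable h σ := by
  obtain ⟨C, hC⟩ := hb
  have : Integrable (Set.indicator (Set.Ioi 0) h) σ := Integrable.mono' (integrable_const C)
    (measurable_indicator_pos hp).aestronglyMeasurable (ae_of_all _ (abs_indicator_pos_le hC))
  refine this.congr ?_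
  filter_upwards [hσ] with z hz
  exact Set.indicator_of_mem hz h

end

/-! ### Convergence of the empirical measures -/

/-- The empirical measure of `x 0, …, x (N - 1)`. -/
noncomputable def empirical (N : ℕ) (x : ℕ → ℝ) : Measure ℝ :=
  ENNReal.ofReal ((N : ℝ)⁻¹) • ∑ j : Fin N, Measure.dirac (x j)

instance (N : ℕ) (x : ℕ → ℝ) : IsFiniteMeasure (empirical N x) := by
  unfold empirical
  exact Measure.smul_finite _ ENNReal.ofReal_ne_top

lemma integral_empirical (N : ℕ) (x : ℕ → ℝ) (g : ℝ → ℝ) :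
    ∫ y, g y ∂(empirical N x) = (N : ℝ)⁻¹ * ∑ j : Fin N, g (x j) := by
  rw [empirical, integral_smul_measure, integral_finsetSum_measure, ENNReal.toReal_ofReal
    (by positivity), smul_eq_mul]
  · simp
  · intro j _
    exact integrable_dirac (by simp)

section

variable {α : ℝ} {x : ℕ → ℝ}

lemma ae_empirical_mem (hx : IsTypical α x) (N : ℕ) :
    ∀ᵐ y ∂(empirical N x), y ∈ Set.Icc (0 : ℝ) 1 := by
  refine Measure.ae_smul_measure ?_ _
  rw [ae_iff, Measure.finsetSum_apply]
  refine Finset.sum_eq_zero fun j _ => ?_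
  rw [← ae_iff, ae_dirac_eq]
  exact ⟨(hx.pos j).le, hx.le_one j⟩

lemma tendsto_empirical (hα : 0 < α) (hx : IsTypical α x) {g : ℝ → ℝ} (hg : Measurable g) {C : ℝ}
    (hC : ∀ y, |g y| ≤ C) {D : Set ℝ} (hD : IsClosed D) (hDν : rateLaw α D = 0)
    (hcont : ∀ y ∉ D, ContinuousAt g y) :
    Tendsto (fun n : ℕ => ((n + 1 : ℕ) : ℝ)⁻¹ * ∑ j : Fin (n + 1), g (x j)) atTop
      (𝓝 (∫ y, g y ∂(rateLaw α))) := by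
  have := isProbabilityMeasure_rateLaw hα
  simp only [← integral_empirical]
  refine tendsto_integral_of_moments (ρ := fun n => empirical (n + 1) x)
    (Eventually.of_forall fun n => inferInstance)
    (Eventually.of_forall fun n => ae_empirical_mem hx _)
    (ae_mem_rateLaw.mono fun y hy => Set.Ioc_subset_Icc_self hy) (fun k => ?_) hg hC hD hDν hcont
  simp only [integral_empirical, integral_pow_rateLaw hα]
  exact (hx.tendsto_moment k).comp (tendsto_add_atTop_nat 1)

/-- Empirical means of a test function times a bounded continuous function. -/
lemma tendsto_empirical_mul (hα : 0 < α) (hx : IsTypical α x) {φ : ℝ → ℝ} (hb : IsBoundedOnPos φ)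
    (hp : IsPiecewiseContinuousOnPos φ) {g : ℝ → ℝ} (hg : Continuous g) {C : ℝ}
    (hC : ∀ y, |g y| ≤ C) :
    Tendsto (fun n : ℕ => ((n + 1 : ℕ) : ℝ)⁻¹ * ∑ j : Fin (n + 1), φ (x j) * g (x j)) atTop
      (𝓝 (∫ y, φ y * g y ∂(rateLaw α))) := by
  obtain ⟨B, hB⟩ := hb
  have hpos : ∀ᵐ y ∂(rateLaw α), 0 < y := ae_mem_rateLaw.mono fun y hy => hy.1
  have := tendsto_empirical hα hx (g := fun y => Set.indicator (Set.Ioi 0) φ y * g y)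
    (C := B * C) ((measurable_indicator_pos hp).mul hg.measurable) (fun y => by
      rw [abs_mul]
      exact mul_le_mul (abs_indicator_pos_le hB y) (hC y) (abs_nonneg _)
        ((abs_nonneg _).trans (hB 1 one_pos)))
    (isClosed_irregularSet hp) (measure_irregularSet hpos hp)
    (fun y hy => (continuousAt_indicator_pos hy).mul hg.continuousAt)
  have hint : ∫ y, Set.indicator (Set.Ioi 0) φ y * g y ∂(rateLaw α) =
      ∫ y, φ y * g y ∂(rateLaw α) := by
    refine integral_congr_ae ?_
    filter_upwards [hpos] with y hy
    rw [Set.indicator_of_mem (show y ∈ Set.Ioi 0 from hy)]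
  rw [hint] at this
  refine this.congr fun n => ?_
  congr 1
  refine Finset.sum_congr rfl fun j _ => ?_
  rw [Set.indicator_of_mem (show x j ∈ Set.Ioi 0 from hx.pos j)]

lemma sub_ofReal_ne_zero {z : ℂ} {δ : ℝ} (hδ : 0 < δ)
    (hz : ∀ p ∈ Set.Icc (0 : ℝ) 1, δ ≤ ‖z - p‖) {p : ℝ} (hp : p ∈ Set.Icc (0 : ℝ) 1) :
    z - p ≠ 0 :=
  norm_pos_iff.1 (hδ.trans_le (hz p hp))

/-- The empirical Stieltjes transforms converge. -/
lemma tendsto_stieltjes (hα : 0 < α) (hx : IsTypical α x) {φ : ℝ → ℝ} (hb : IsBoundedOnPos φ)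
    (hp : IsPiecewiseContinuousOnPos φ) {z : ℂ} {δ : ℝ} (hδ : 0 < δ)
    (hz : ∀ p ∈ Set.Icc (0 : ℝ) 1, δ ≤ ‖z - p‖) :
    Tendsto (fun n : ℕ => stieltjes (n + 1) x (fun j => φ (x j)) z) atTop
      (𝓝 (∫ y, (φ y : ℂ) / (z - y) ∂(rateLaw α))) := by
  have := isProbabilityMeasure_rateLaw hα
  -- outside `[0,1]` the kernel is replaced by its value at the nearest point of `[0,1]`
  let k : ℝ → ℂ := fun y => (z - (max 0 (min 1 y) : ℝ))⁻¹
  have hclamp : ∀ y : ℝ, max 0 (min 1 y) ∈ Set.Icc (0 : ℝ) 1 := fun y =>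
    ⟨le_max_left _ _, max_le zero_le_one (min_le_left _ _)⟩
  have hkc : Continuous k := by
    refine Continuous.inv₀ (by fun_prop) fun y => sub_ofReal_ne_zero hδ hz (hclamp y)
  have hkb : ∀ y, ‖k y‖ ≤ δ⁻¹ := by
    intro y
    rw [norm_inv]
    exact inv_anti₀ hδ (hz _ (hclamp y))
  have hkeq : ∀ y ∈ Set.Icc (0 : ℝ) 1, k y = (z - y)⁻¹ := by
    intro y hy
    simp only [k]
    rw [min_eq_right hy.2, max_eq_right hy.1]
  have hpos : ∀ᵐ y ∂(rateLaw α), 0 < y := ae_mem_rateLaw.mono fun y hy => hy.1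
  have hre := tendsto_empirical_mul hα hx hb hp (g := fun y => (k y).re) (by fun_prop)
    (fun y => (Complex.abs_re_le_norm _).trans (hkb y))
  have him := tendsto_empirical_mul hα hx hb hp (g := fun y => (k y).im) (by fun_prop)
    (fun y => (Complex.abs_im_le_norm _).trans (hkb y))
  have hint : Integrable (fun y => (φ y : ℂ) * k y) (rateLaw α) := by
    refine Integrable.mul_bdd (c := δ⁻¹)
      (integrable_of_isPiecewiseContinuousOnPos hpos hb hp).ofReal hkc.aestronglyMeasurable
      (ae_of_all _ hkb)
  have hlim : ∫ y, (φ y : ℂ) / (z - y) ∂(rateLaw α) =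
      ((∫ y, φ y * (k y).re ∂(rateLaw α) : ℝ) : ℂ) +
        ((∫ y, φ y * (k y).im ∂(rateLaw α) : ℝ) : ℂ) * Complex.I := by
    have : ∫ y, (φ y : ℂ) / (z - y) ∂(rateLaw α) = ∫ y, (φ y : ℂ) * k y ∂(rateLaw α) := by
      refine integral_congr_ae ?_
      filter_upwards [ae_mem_rateLaw] with y hy
      rw [hkeq y (Set.Ioc_subset_Icc_self hy), div_eq_mul_inv]
    rw [this, ← integral_re_add_im hint]
    simp
  rw [hlim]
  have hsum := ((Complex.continuous_ofReal.tendsto _).comp hre).add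
    (((Complex.continuous_ofReal.tendsto _).comp him).mul_const Complex.I)
  refine hsum.congr fun n => ?_
  simp only [Function.comp, stieltjes]
  push_cast
  rw [mul_assoc, ← mul_add, Finset.sum_mul, ← Finset.sum_add_distrib]
  congr 1
  refine Finset.sum_congr rfl fun j _ => ?_
  rw [div_eq_mul_inv, ← hkeq (x j) ⟨(hx.pos j).le, hx.le_one j⟩, mul_assoc, ← mul_add,
    Complex.re_add_im]

/-- The contour integral that gives the limit, as the number of vertices tends to infinity, of the
expectation of `φ (x_N t)`. -/
noncomputable def contourLimit (α : ℝ) (φ : ℝ → ℝ) (γ : ℝ → ℂ) (t : ℝ) : ℂ :=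
  (2 * Real.pi * Complex.I)⁻¹ * contourIntegral γ (fun z => Complex.exp (-t * z) / z *
    ((∫ y, (φ y : ℂ) / (z - y) ∂(rateLaw α)) / ∫ y, 1 / (z - (y : ℂ)) ∂(rateLaw α)))

lemma contourFormula_eq_contourLimit (hα : 0 < α) (h : ℝ → ℝ) (γ : ℝ → ℂ) (t : ℝ) :
    contourFormula α h γ t = contourLimit α (fun y => h (t * y)) γ t := by
  have key : ∀ g : ℝ → ℂ, ∫ y, g y ∂(rateLaw α) =
      α * ∫ y in (0 : ℝ)..1, g y * ((y ^ (α - 1) : ℝ) : ℂ) := by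
    intro g
    rw [integral_rateLaw hα, ← intervalIntegral.integral_const_mul]
    refine intervalIntegral.integral_congr fun y _ => ?_
    simp only [Complex.real_smul]
    push_cast
    ring
  unfold contourFormula contourLimit
  simp only [key]
  congr 3
  ext z
  rw [mul_div_mul_left _ _ (by exact_mod_cast hα.ne')]
  simp only [mul_comm t]

/-- Convergence of expectations as the number of vertices tends to infinity. -/
lemma tendsto_walkMean (hα : 0 < α) (hx : IsTypical α x) {φ : ℝ → ℝ} (hb : IsBoundedOnPos φ)
    (hp : IsPiecewiseContinuousOnPos φ) {γ : ℝ → ℂ} (hγ : IsLoopAroundUnitInterval γ) (t : ℝ) :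
    Tendsto (fun n : ℕ => ((walkMean (n + 1) x (fun j => φ (x j)) t : ℝ) : ℂ)) atTop
      (𝓝 (contourLimit α φ γ t)) := by
  obtain ⟨R, δ, hR0, hδ, hR, hd⟩ := hγ.exists_bounds
  simp only [fun n : ℕ => walkMean_eq_contourIntegral hγ n.succ_pos hx.pos hx.le_one]
  refine Tendsto.const_mul _ ?_
  obtain ⟨B, hB⟩ := id hb
  have h0 : ∀ s ∈ Set.Icc (0 : ℝ) 1, γ s ≠ 0 := fun s hs => by
    simpa using hγ.avoids s hs 0 (by simp)
  have hγc := hγ.continuousOn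
  obtain ⟨A, hA⟩ := isCompact_Icc.exists_bound_of_continuousOn
    (ContinuousOn.div (f := fun s => Complex.exp (-t * γ s)) (by fun_prop) hγc h0)
  have hden : ∀ n : ℕ, ∀ s ∈ Set.Icc (0 : ℝ) 1,
      δ / (R + 1) ^ 2 ≤ ‖stieltjes (n + 1) x 1 (γ s)‖ := fun n s hs =>
    le_norm_stieltjes_one n.succ_pos hx.pos hx.le_one hδ (hR s hs).le (hd s hs)
  have hB0 : 0 ≤ B := (abs_nonneg _).trans (hB 1 one_pos)
  refine hγ.tendsto_contourIntegral (C := A * (B / δ / (δ / (R + 1) ^ 2)))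
    (fun n => continuousOn_contour_integrand hγ n.succ_pos hx.pos hx.le_one _ t)
    (fun n s hs => ?_) fun s hs => ?_
  · rw [norm_mul, norm_div (stieltjes _ _ _ _)]
    refine mul_le_mul (hA s hs) (div_le_div₀ (by positivity) ?_ (by positivity) (hden n s hs))
      (by positivity) ((norm_nonneg _).trans (hA s hs))
    exact norm_stieltjes_le n.succ_pos hx.pos hx.le_one (fun j => hB _ (hx.pos j)) hδ (hd s hs)
  · have hone : Tendsto (fun n : ℕ => stieltjes (n + 1) x 1 (γ s)) atTop
        (𝓝 (∫ y, 1 / (γ s - (y : ℂ)) ∂(rateLaw α))) := by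
      have := tendsto_stieltjes hα hx (φ := fun _ => 1) ⟨1, fun z _ => by simp⟩
        continuous_const.isPiecewiseContinuousOnPos hδ (hd s hs)
      simpa only [Complex.ofReal_one] using! this
    have hne : ∫ y, 1 / (γ s - (y : ℂ)) ∂(rateLaw α) ≠ 0 := by
      rw [← norm_pos_iff]
      have : 0 < δ / (R + 1) ^ 2 := by positivity
      exact this.trans_le (ge_of_tendsto' hone.norm fun n => hden n s hs)
    exact ((tendsto_stieltjes hα hx hb hp hδ (hd s hs)).div hone hne).const_mul _

end

/-! ### The renewal structure of the limit -/

/-- The Laplace transform of `rateLaw α`. -/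
noncomputable def rateLaplace (α t : ℝ) : ℝ := ∫ y, Real.exp (-(t * y)) ∂(rateLaw α)

/-- The density with respect to `rateLaw α` of the limiting law of the jump rate `x_N t`, if the
mean jump intensity converges to `m`: either the walk has not jumped before time `t`, or it sits
since its last jump, at time `s`, at a vertex chosen uniformly at random. -/
noncomputable def rateDensity (m : ℝ → ℝ) (t y : ℝ) : ℝ :=
  Real.exp (-(y * t)) + ∫ s in (0 : ℝ)..t, Real.exp (-(y * (t - s))) * m s

section

variable {m : ℝ → ℝ}

lemma intervalIntegrable_exp_mul (hm : Measurable m) (hm0 : ∀ t, 0 ≤ m t)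
    (hm1 : ∀ t, 0 ≤ t → m t ≤ 1) {y t : ℝ} (hy : 0 ≤ y) (ht : 0 ≤ t) :
    IntervalIntegrable (fun s => Real.exp (-(y * (t - s))) * m s) volume 0 t := by
  rw [intervalIntegrable_iff_integrableOn_Ioc_of_le ht]
  refine Integrable.mono' (integrable_const (1 : ℝ)) (by fun_prop) ?_
  filter_upwards [ae_restrict_mem measurableSet_Ioc] with s hs
  rw [norm_mul, Real.norm_eq_abs, Real.norm_eq_abs, Real.abs_exp, abs_of_nonneg (hm0 s)]
  refine mul_le_one₀ (Real.exp_le_one_iff.2 (neg_nonpos.2 (mul_nonneg hy ?_))) (hm0 s)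
    (hm1 s hs.1.le)
  linarith [hs.2]

lemma rateDensity_nonneg (hm0 : ∀ t, 0 ≤ m t) {t : ℝ} (ht : 0 ≤ t) (y : ℝ) :
    0 ≤ rateDensity m t y :=
  add_nonneg (Real.exp_pos _).le (intervalIntegral.integral_nonneg ht fun s _ =>
    mul_nonneg (Real.exp_pos _).le (hm0 s))

lemma rateDensity_le (hm : Measurable m) (hm0 : ∀ t, 0 ≤ m t) (hm1 : ∀ t, 0 ≤ t → m t ≤ 1)
    {t y : ℝ} (ht : 0 ≤ t) (hy : 0 ≤ y) : rateDensity m t y ≤ 1 + t := by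
  refine add_le_add (Real.exp_le_one_iff.2 (neg_nonpos.2 (mul_nonneg hy ht))) ?_
  calc ∫ s in (0 : ℝ)..t, Real.exp (-(y * (t - s))) * m s ≤ ∫ _s in (0 : ℝ)..t, (1 : ℝ) := by
        refine intervalIntegral.integral_mono_on ht
          (intervalIntegrable_exp_mul hm hm0 hm1 hy ht) intervalIntegrable_const fun s hs => ?_
        refine mul_le_one₀ (Real.exp_le_one_iff.2 (neg_nonpos.2 (mul_nonneg hy ?_))) (hm0 s)
          (hm1 s hs.1)
        linarith [hs.2]
    _ = t := by simp

lemma continuous_rateDensity_max (hm : Measurable m) (hm0 : ∀ t, 0 ≤ m t)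
    (hm1 : ∀ t, 0 ≤ t → m t ≤ 1) {t : ℝ} (ht : 0 ≤ t) :
    Continuous fun y => rateDensity m t (max y 0) := by
  refine Continuous.add (by fun_prop) ?_
  refine intervalIntegral.continuous_of_dominated_interval (bound := fun _ => 1)
    (fun y => by fun_prop) (fun y => ae_of_all _ fun s hs => ?_) intervalIntegrable_const
    (ae_of_all _ fun s _ => by fun_prop)
  rw [Set.uIoc_of_le ht] at hs
  rw [norm_mul, Real.norm_eq_abs, Real.norm_eq_abs, Real.abs_exp, abs_of_nonneg (hm0 s)]
  refine mul_le_one₀ (Real.exp_le_one_iff.2 (neg_nonpos.2 (mul_nonneg (le_max_right _ _) ?_)))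
    (hm0 s) (hm1 s hs.1.le)
  linarith [hs.2]

lemma measurable_rateDensity (hm : Measurable m) (t : ℝ) : Measurable (rateDensity m t) := by
  refine Measurable.add (by fun_prop) ?_
  have : Measurable fun p : ℝ × ℝ => Real.exp (-(p.1 * (t - p.2))) * m p.2 := by fun_prop
  simp only [intervalIntegral]
  refine Measurable.sub ?_ ?_
  · exact this.stronglyMeasurable.integral_prod_right.measurable
  · exact this.stronglyMeasurable.integral_prod_right.measurable

end

section

variable {α : ℝ} {x : ℕ → ℝ}

/-- The mean jump intensities of the finite walks converge. -/
lemma exists_limit_walkIntensity (hα : 0 < α) (hx : IsTypical α x) :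
    ∃ m : ℝ → ℝ, Measurable m ∧ (∀ t, 0 ≤ m t) ∧ (∀ t, 0 ≤ t → m t ≤ 1) ∧
      ∀ t, Tendsto (fun n : ℕ => walkIntensity (n + 1) x t) atTop (𝓝 (m t)) := by
  obtain ⟨γ, hγ⟩ := exists_isLoopAroundUnitInterval
  -- the rates do not exceed `1`, so that the identity may be truncated
  have hb : IsBoundedOnPos fun y => min y 1 := ⟨1, fun z hz => by
    rw [abs_of_nonneg (le_min hz.le zero_le_one)]
    exact min_le_right _ _⟩
  have hp : IsPiecewiseContinuousOnPos fun y => min y 1 :=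
    (continuous_id.min continuous_const).isPiecewiseContinuousOnPos
  have hlim : ∀ t, Tendsto (fun n : ℕ => walkIntensity (n + 1) x t) atTop
      (𝓝 (contourLimit α (fun y => min y 1) γ t).re) := by
    intro t
    have := (Complex.continuous_re.tendsto _).comp (tendsto_walkMean hα hx hb hp hγ t)
    refine this.congr fun n => ?_
    simp only [Function.comp, Complex.ofReal_re, walkIntensity]
    congr 1
    ext j
    exact min_eq_left (hx.le_one j)
  refine ⟨fun t => (contourLimit α (fun y => min y 1) γ t).re, ?_, fun t => ?_, fun t ht => ?_,
    hlim⟩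
  · exact measurable_of_tendsto_metrizable
      (fun n => (continuous_walkMean n.succ_pos hx.pos hx.le_one _).measurable)
      (tendsto_pi_nhds.2 hlim)
  · exact ge_of_tendsto' (hlim t) fun n =>
      walkIntensity_nonneg n.succ_pos hx.pos hx.le_one t
  · exact le_of_tendsto' (hlim t) fun n =>
      walkIntensity_le_one n.succ_pos hx.pos hx.le_one ht

/-- The expectations of the finite walks converge to integrals against `rateDensity`. -/
lemma tendsto_walkMean_rateDensity (hα : 0 < α) (hx : IsTypical α x) {m : ℝ → ℝ}
    (hm : Measurable m) (hm0 : ∀ t, 0 ≤ m t) (hm1 : ∀ t, 0 ≤ t → m t ≤ 1)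
    (hlim : ∀ t, Tendsto (fun n : ℕ => walkIntensity (n + 1) x t) atTop (𝓝 (m t)))
    {φ : ℝ → ℝ} (hb : IsBoundedOnPos φ) (hp : IsPiecewiseContinuousOnPos φ) {t : ℝ} (ht : 0 ≤ t) :
    Tendsto (fun n : ℕ => walkMean (n + 1) x (fun j => φ (x j)) t) atTop
      (𝓝 (∫ y, φ y * rateDensity m t y ∂(rateLaw α))) := by
  have hmain := tendsto_empirical_mul hα hx hb hp (g := fun y => rateDensity m t (max y 0))
    (continuous_rateDensity_max hm hm0 hm1 ht) (C := 1 + t) (fun y => by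
      rw [abs_of_nonneg (rateDensity_nonneg hm0 ht _)]
      exact rateDensity_le hm hm0 hm1 ht (le_max_right _ _))
  have hint : ∫ y, φ y * rateDensity m t (max y 0) ∂(rateLaw α) =
      ∫ y, φ y * rateDensity m t y ∂(rateLaw α) := by
    refine integral_congr_ae ?_
    filter_upwards [ae_mem_rateLaw] with y hy
    rw [max_eq_left hy.1.le]
  rw [hint] at hmain
  obtain ⟨B, hB⟩ := hb
  have hB0 : 0 ≤ B := (abs_nonneg _).trans (hB 1 one_pos)
  have hmc : ∀ n : ℕ, Continuous (walkIntensity (n + 1) x) := fun n =>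
    continuous_walkMean n.succ_pos hx.pos hx.le_one _
  have herr : Tendsto (fun n : ℕ => B * ∫ s in (0 : ℝ)..t, |walkIntensity (n + 1) x s - m s|)
      atTop (𝓝 0) := by
    suffices hI : Tendsto (fun n : ℕ => ∫ s in (0 : ℝ)..t, |walkIntensity (n + 1) x s - m s|) atTop
        (𝓝 (∫ _s in (0 : ℝ)..t, (0 : ℝ))) by
      simpa using hI.const_mul B
    refine intervalIntegral.tendsto_integral_filter_of_dominated_convergence (μ := volume)
      (fun _ => 1) (Eventually.of_forall fun n => ?_)
      (Eventually.of_forall fun n => ae_of_all _ fun s hs => ?_)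
      intervalIntegrable_const (ae_of_all _ fun s _ => ?_)
    · exact (((hmc n).measurable.sub hm).abs).aestronglyMeasurable
    · rw [Set.uIoc_of_le ht] at hs
      rw [Real.norm_eq_abs, abs_abs, abs_le]
      have h1 := walkIntensity_nonneg n.succ_pos hx.pos hx.le_one s
      have h2 := walkIntensity_le_one n.succ_pos hx.pos hx.le_one hs.1.le
      constructor <;> linarith [hm0 s, hm1 s hs.1.le]
    · have := ((hlim s).sub_const (m s)).abs
      simpa using this
  have hdiff : Tendsto (fun n : ℕ => walkMean (n + 1) x (fun j => φ (x j)) t -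
      ((n + 1 : ℕ) : ℝ)⁻¹ * ∑ j : Fin (n + 1), φ (x j) * rateDensity m t (max (x j) 0)) atTop
      (𝓝 0) := by
    refine squeeze_zero_norm (fun n => ?_) herr
    have hN : (0 : ℝ) < ((n + 1 : ℕ) : ℝ) := by positivity
    have hterm : ∀ j : Fin (n + 1), walkProb (n + 1) x t j * φ (x j) -
        ((n + 1 : ℕ) : ℝ)⁻¹ * (φ (x j) * rateDensity m t (max (x j) 0)) =
        ((n + 1 : ℕ) : ℝ)⁻¹ * (φ (x j) * ∫ s in (0 : ℝ)..t,
          Real.exp (-(x j * (t - s))) * (walkIntensity (n + 1) x s - m s)) := by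
      intro j
      have hxj := (hx.pos j).le
      have i1 : IntervalIntegrable
          (fun s => Real.exp (-(x j * (t - s))) * walkIntensity (n + 1) x s) volume 0 t :=
        Continuous.intervalIntegrable ((by fun_prop : Continuous fun s : ℝ =>
          Real.exp (-(x j * (t - s)))).mul (hmc n)) _ _
      simp only [mul_sub (Real.exp _)]
      rw [intervalIntegral.integral_sub i1 (intervalIntegrable_exp_mul hm hm0 hm1 hxj ht),
        walkProb_eq_integral n.succ_pos hx.pos hx.le_one, rateDensity, max_eq_left hxj]
      ring
    rw [walkMean, Finset.mul_sum, ← Finset.sum_sub_distrib]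
    simp only [hterm]
    rw [← Finset.mul_sum, norm_mul, norm_inv, Real.norm_natCast, inv_mul_le_iff₀ hN]
    have hbound : ∀ j : Fin (n + 1), ‖φ (x j) * ∫ s in (0 : ℝ)..t,
        Real.exp (-(x j * (t - s))) * (walkIntensity (n + 1) x s - m s)‖ ≤
        B * ∫ s in (0 : ℝ)..t, |walkIntensity (n + 1) x s - m s| := by
      intro j
      rw [norm_mul]
      refine mul_le_mul (hB _ (hx.pos j)) ?_ (norm_nonneg _) hB0
      refine intervalIntegral.norm_integral_le_of_norm_le ht (ae_of_all _ fun s hs => ?_) ?_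
      · rw [norm_mul, Real.norm_eq_abs, Real.norm_eq_abs, Real.abs_exp]
        refine mul_le_of_le_one_left (abs_nonneg _) (Real.exp_le_one_iff.2 (neg_nonpos.2
          (mul_nonneg (hx.pos j).le ?_)))
        linarith [hs.2]
      · have i2 : IntervalIntegrable m volume 0 t := by
          have := intervalIntegrable_exp_mul hm hm0 hm1 le_rfl ht
          simpa using this
        exact (((hmc n).intervalIntegrable 0 t).sub i2).abs
    calc ‖∑ j : Fin (n + 1), φ (x j) * ∫ s in (0 : ℝ)..t,
        Real.exp (-(x j * (t - s))) * (walkIntensity (n + 1) x s - m s)‖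
        ≤ ∑ j : Fin (n + 1), B * ∫ s in (0 : ℝ)..t, |walkIntensity (n + 1) x s - m s| :=
          norm_sum_le_of_le _ fun j _ => hbound j
      _ = _ := by simp
  simpa using hdiff.add hmain

lemma walkMean_one {n : ℕ} (hx : IsTypical α x) (t : ℝ) :
    walkMean (n + 1) x (fun _ => 1) t = 1 := by
  obtain ⟨γ, hγ⟩ := exists_isLoopAroundUnitInterval
  have h1 := walkMean_eq_contourIntegral hγ n.succ_pos hx.pos hx.le_one (fun _ => 1) t
  have h2 := hγ.contourIntegral_div_sub (f := fun z => Complex.exp (-t * z)) (by fun_prop)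
    (p := 0) (by simp)
  simp only [Complex.ofReal_zero, sub_zero, mul_zero, Complex.exp_zero] at h2
  have h3 : contourIntegral γ (fun z => Complex.exp (-t * z) / z *
      (stieltjes (n + 1) x (fun _ => 1) z / stieltjes (n + 1) x 1 z)) =
      contourIntegral γ (fun z => Complex.exp (-t * z) / z) := by
    refine intervalIntegral.integral_congr fun s hs => ?_
    rw [Set.uIcc_of_le zero_le_one] at hs
    have hne := stieltjes_one_ne_zero hγ n.succ_pos hx.pos hx.le_one hs
    have : stieltjes (n + 1) x (fun _ => 1) (γ s) = stieltjes (n + 1) x 1 (γ s) := rfl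
    simp only [this]
    rw [div_self hne, mul_one]
  rw [h3, h2] at h1
  exact_mod_cast h1

lemma integral_exp_mul_rateDensity (hα : 0 < α) {m : ℝ → ℝ} (hm : Measurable m)
    (hm0 : ∀ t, 0 ≤ m t) (hm1 : ∀ t, 0 ≤ t → m t ≤ 1) {r t : ℝ} (hr : 0 ≤ r) (ht : 0 ≤ t) :
    ∫ y, Real.exp (-(r * y)) * rateDensity m t y ∂(rateLaw α) =
      rateLaplace α (r + t) + ∫ s in (0 : ℝ)..t, rateLaplace α (r + t - s) * m s := by
  have := isProbabilityMeasure_rateLaw hα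
  have hpos : ∀ᵐ y ∂(rateLaw α), 0 < y := ae_mem_rateLaw.mono fun y hy => hy.1
  have hF : Measurable fun p : ℝ × ℝ => Real.exp (-(r * p.1)) *
      (Real.exp (-(p.1 * (t - p.2))) * m p.2) := by fun_prop
  have hFint : Integrable (fun p : ℝ × ℝ => Real.exp (-(r * p.1)) *
      (Real.exp (-(p.1 * (t - p.2))) * m p.2))
      ((rateLaw α).prod (volume.restrict (Set.Ioc 0 t))) := by
    refine Integrable.mono' (integrable_const (1 : ℝ)) hF.aestronglyMeasurable ?_
    have h1 : ∀ᵐ p ∂((rateLaw α).prod (volume.restrict (Set.Ioc 0 t))), 0 < p.1 :=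
      Measure.quasiMeasurePreserving_fst.ae hpos
    have h2 : ∀ᵐ p ∂((rateLaw α).prod (volume.restrict (Set.Ioc 0 t))), p.2 ∈ Set.Ioc 0 t :=
      Measure.quasiMeasurePreserving_snd.ae (ae_restrict_mem measurableSet_Ioc)
    filter_upwards [h1, h2] with p h1 h2
    rw [norm_mul, norm_mul, Real.norm_eq_abs, Real.norm_eq_abs, Real.norm_eq_abs, Real.abs_exp,
      Real.abs_exp, abs_of_nonneg (hm0 _)]
    refine mul_le_one₀ (Real.exp_le_one_iff.2 (neg_nonpos.2 (mul_nonneg hr h1.le)))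
      (mul_nonneg (Real.exp_pos _).le (hm0 _)) (mul_le_one₀
      (Real.exp_le_one_iff.2 (neg_nonpos.2 (mul_nonneg h1.le ?_))) (hm0 _) (hm1 _ h2.1.le))
    linarith [h2.2]
  have hsplit : ∀ y, Real.exp (-(r * y)) * rateDensity m t y = Real.exp (-((r + t) * y)) +
      ∫ s in Set.Ioc 0 t, Real.exp (-(r * y)) * (Real.exp (-(y * (t - s))) * m s) := by
    intro y
    rw [rateDensity, mul_add, ← Real.exp_add, integral_const_mul,
      intervalIntegral.integral_of_le ht]
    congr 2
    ring
  simp only [hsplit]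
  rw [integral_add, integral_integral_swap hFint, intervalIntegral.integral_of_le ht]
  · congr 1
    refine integral_congr_ae (ae_of_all _ fun s => ?_)
    simp only
    rw [rateLaplace, ← integral_mul_const]
    congr 1 with y
    rw [← mul_assoc, ← Real.exp_add]
    congr 2
    ring
  · refine Integrable.mono' (integrable_const (1 : ℝ)) (by fun_prop) ?_
    filter_upwards [hpos] with y hy
    rw [Real.norm_eq_abs, Real.abs_exp]
    exact Real.exp_le_one_iff.2 (neg_nonpos.2 (mul_nonneg (add_nonneg hr ht) hy.le))
  · exact hFint.integral_prod_left

/-- Conservation of mass gives the renewal equation for the limiting jump intensity. -/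
lemma integral_rateDensity (hα : 0 < α) (hx : IsTypical α x) {m : ℝ → ℝ}
    (hm : Measurable m) (hm0 : ∀ t, 0 ≤ m t) (hm1 : ∀ t, 0 ≤ t → m t ≤ 1)
    (hlim : ∀ t, Tendsto (fun n : ℕ => walkIntensity (n + 1) x t) atTop (𝓝 (m t)))
    {t : ℝ} (ht : 0 ≤ t) : ∫ y, rateDensity m t y ∂(rateLaw α) = 1 := by
  have := tendsto_walkMean_rateDensity hα hx hm hm0 hm1 hlim (φ := fun _ => 1)
    ⟨1, fun z _ => by simp⟩ continuous_const.isPiecewiseContinuousOnPos ht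
  simp only [walkMean_one hx, one_mul] at this
  exact (tendsto_nhds_unique this tendsto_const_nhds)

end

/-! ### Asymptotics of the renewal equation -/

section

variable {α : ℝ}

lemma measurable_rateLaplace : Measurable (rateLaplace α) := by
  have : SFinite (rateLaw α) := by unfold rateLaw; infer_instance
  have : Measurable fun p : ℝ × ℝ => Real.exp (-(p.1 * p.2)) := by fun_prop
  exact this.stronglyMeasurable.integral_prod_right.measurable

lemma rateLaplace_nonneg (t : ℝ) : 0 ≤ rateLaplace α t :=
  integral_nonneg fun _ => (Real.exp_pos _).le

lemma rateLaplace_le_one (hα : 0 < α) {t : ℝ} (ht : 0 ≤ t) : rateLaplace α t ≤ 1 := by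
  have := isProbabilityMeasure_rateLaw hα
  have h : ∀ᵐ y ∂(rateLaw α), ‖Real.exp (-(t * y))‖ ≤ 1 := by
    filter_upwards [ae_mem_rateLaw] with y hy
    rw [Real.norm_eq_abs, Real.abs_exp]
    exact Real.exp_le_one_iff.2 (neg_nonpos.2 (mul_nonneg ht hy.1.le))
  have := norm_integral_le_of_norm_le_const h
  simp only [probReal_univ, mul_one] at this
  exact (le_abs_self _).trans this

/-- Scaling: `t ^ α * rateLaplace α t` is an incomplete Gamma integral. -/
lemma rpow_mul_rateLaplace (hα : 0 < α) {t : ℝ} (ht : 0 < t) :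
    t ^ α * rateLaplace α t = α * ∫ y in (0 : ℝ)..t, Real.exp (-y) * y ^ (α - 1) := by
  have h := intervalIntegral.smul_integral_comp_mul_left (a := 0) (b := 1)
    (fun y => Real.exp (-y) * y ^ (α - 1)) t
  rw [mul_zero, mul_one] at h
  rw [← h, rateLaplace, integral_rateLaw hα, smul_eq_mul, ← mul_assoc,
    ← intervalIntegral.integral_const_mul, ← intervalIntegral.integral_const_mul]
  refine intervalIntegral.integral_congr fun y hy => ?_
  rw [Set.uIcc_of_le zero_le_one] at hy
  have h1 : t ^ α = t * t ^ (α - 1) := by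
    rw [mul_comm, ← Real.rpow_add_one ht.ne', sub_add_cancel]
  simp only [smul_eq_mul]
  rw [h1, Real.mul_rpow ht.le hy.1]
  ring

lemma tendsto_rpow_mul_rateLaplace (hα : 0 < α) :
    Tendsto (fun t => t ^ α * rateLaplace α t) atTop (𝓝 (α * Real.Gamma α)) := by
  have h := (intervalIntegral_tendsto_integral_Ioi 0 (Real.GammaIntegral_convergent hα)
    tendsto_id).const_mul α
  rw [← Real.Gamma_eq_integral hα] at h
  refine h.congr' ?_
  filter_upwards [eventually_gt_atTop 0] with t ht
  exact (rpow_mul_rateLaplace hα ht).symm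

lemma rpow_mul_rateLaplace_mono (hα : 0 < α) {s t : ℝ} (hs : 0 < s) (hst : s ≤ t) :
    s ^ α * rateLaplace α s ≤ t ^ α * rateLaplace α t := by
  rw [rpow_mul_rateLaplace hα hs, rpow_mul_rateLaplace hα (hs.trans_le hst)]
  refine mul_le_mul_of_nonneg_left ?_ hα.le
  refine intervalIntegral.integral_mono_interval le_rfl hs.le hst ?_ ?_
  · filter_upwards [ae_restrict_mem measurableSet_Ioc] with y hy
    have := hy.1
    simp only [Pi.zero_apply]
    positivity
  · rw [intervalIntegrable_iff_integrableOn_Ioc_of_le (hs.le.trans hst)]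
    exact (Real.GammaIntegral_convergent hα).mono_set fun y hy => hy.1

lemma rpow_mul_rateLaplace_le (hα : 0 < α) {t : ℝ} (ht : 0 < t) :
    t ^ α * rateLaplace α t ≤ α * Real.Gamma α :=
  ge_of_tendsto (tendsto_rpow_mul_rateLaplace hα) ((eventually_ge_atTop t).mono fun _ hu =>
    rpow_mul_rateLaplace_mono hα ht hu)

lemma integrableOn_exp_mul_of_bounded {f : ℝ → ℝ} (hf : Measurable f) {C : ℝ}
    (hC : ∀ t, 0 < t → |f t| ≤ C) {p : ℝ} (hp : 0 < p) :
    IntegrableOn (fun t => Real.exp (-(p * t)) * f t) (Set.Ioi 0) := by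
  have h1 : IntegrableOn (fun t => Real.exp (-p * t)) (Set.Ioi 0) :=
    integrableOn_exp_mul_Ioi (neg_lt_zero.2 hp) 0
  refine Integrable.mono' (h1.mul_const C) (by fun_prop) ?_
  filter_upwards [ae_restrict_mem measurableSet_Ioi] with t ht
  rw [norm_mul, Real.norm_eq_abs, Real.norm_eq_abs, Real.abs_exp, neg_mul]
  exact mul_le_mul_of_nonneg_left (hC t ht) (Real.exp_pos _).le

/-- An Abelian theorem for `rateLaplace α`. -/
lemma tendsto_laplace_rateLaplace (hα0 : 0 < α) (hα1 : α < 1) :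
    Tendsto (fun p => p ^ (1 - α) * ∫ t in Set.Ioi 0, Real.exp (-(p * t)) * rateLaplace α t)
      (𝓝[>] 0) (𝓝 (α * Real.Gamma α * Real.Gamma (1 - α))) := by
  have hscale : ∀ p : ℝ, 0 < p →
      p ^ (1 - α) * ∫ t in Set.Ioi 0, Real.exp (-(p * t)) * rateLaplace α t =
      ∫ s in Set.Ioi 0, Real.exp (-s) * s ^ (1 - α - 1) *
        ((s / p) ^ α * rateLaplace α (s / p)) := by
    intro p hp
    have h := integral_comp_mul_left_Ioi (fun s => Real.exp (-s) * rateLaplace α (s / p)) 0 hp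
    rw [mul_zero] at h
    simp only [mul_div_cancel_left₀ _ hp.ne'] at h
    rw [h, smul_eq_mul, ← mul_assoc, ← integral_const_mul]
    refine setIntegral_congr_fun measurableSet_Ioi fun s (hs : 0 < s) => ?_
    have h1 : p ^ (1 - α) * p⁻¹ = (p ^ α)⁻¹ := by
      rw [← Real.rpow_neg_one, ← Real.rpow_add hp, ← Real.rpow_neg hp.le]
      congr 1
      ring
    have h2 : s ^ (1 - α - 1) = (s ^ α)⁻¹ := by
      rw [← Real.rpow_neg hs.le]
      congr 1
      ring
    have h3 : s ^ α ≠ 0 := (Real.rpow_pos_of_pos hs α).ne'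
    have h4 : p ^ α ≠ 0 := (Real.rpow_pos_of_pos hp α).ne'
    rw [h1, h2, Real.div_rpow hs.le hp.le]
    field_simp
  have hG : α * Real.Gamma α * Real.Gamma (1 - α) =
      ∫ s in Set.Ioi 0, Real.exp (-s) * s ^ (1 - α - 1) * (α * Real.Gamma α) := by
    rw [integral_mul_const, ← Real.Gamma_eq_integral (by linarith)]
    ring
  rw [hG]
  have hlim : Tendsto (fun p => ∫ s in Set.Ioi 0, Real.exp (-s) * s ^ (1 - α - 1) *
        ((s / p) ^ α * rateLaplace α (s / p))) (𝓝[>] 0)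
      (𝓝 (∫ s in Set.Ioi 0, Real.exp (-s) * s ^ (1 - α - 1) * (α * Real.Gamma α))) := by
    refine tendsto_integral_filter_of_dominated_convergence
      (fun s => Real.exp (-s) * s ^ (1 - α - 1) * (α * Real.Gamma α)) ?_ ?_ ?_ ?_
    · have hmeas := measurable_rateLaplace (α := α)
      exact Eventually.of_forall fun p => Measurable.aestronglyMeasurable (by fun_prop)
    · filter_upwards [self_mem_nhdsWithin] with p (hp : 0 < p)
      filter_upwards [ae_restrict_mem measurableSet_Ioi] with s (hs : 0 < s)
      have h1 : 0 ≤ (s / p) ^ α * rateLaplace α (s / p) :=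
        mul_nonneg (by positivity) (rateLaplace_nonneg _)
      rw [Real.norm_eq_abs, abs_of_nonneg (mul_nonneg (by positivity) h1)]
      exact mul_le_mul_of_nonneg_left (rpow_mul_rateLaplace_le hα0 (div_pos hs hp))
        (by positivity)
    · exact (Real.GammaIntegral_convergent (by linarith)).mul_const _
    · filter_upwards [ae_restrict_mem measurableSet_Ioi] with s (hs : 0 < s)
      refine Tendsto.const_mul _ ((tendsto_rpow_mul_rateLaplace hα0).comp ?_)
      exact (tendsto_inv_nhdsGT_zero.const_mul_atTop hs).congr fun p => (div_eq_mul_inv s p).symm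
  refine hlim.congr' ?_
  filter_upwards [self_mem_nhdsWithin] with p hp
  exact (hscale p hp).symm

variable {m : ℝ → ℝ}

/-- The renewal equation turns into an asymptotic equivalent of the Laplace transform of the jump
intensity. -/
lemma tendsto_laplace_intensity (hα0 : 0 < α) (hα1 : α < 1) (hm : Measurable m)
    (hm0 : ∀ t, 0 ≤ m t) (hm1 : ∀ t, 0 ≤ t → m t ≤ 1)
    (hren : ∀ t, 0 ≤ t → rateLaplace α t + ∫ s in (0 : ℝ)..t, rateLaplace α (t - s) * m s = 1) :
    Tendsto (fun p => p ^ α * ∫ t in Set.Ioi 0, Real.exp (-(p * t)) * m t) (𝓝[>] 0)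
      (𝓝 (α * Real.Gamma α * Real.Gamma (1 - α))⁻¹) := by
  have hG1 := Real.Gamma_pos_of_pos hα0
  have hG2 := Real.Gamma_pos_of_pos (show 0 < 1 - α by linarith)
  have hlapl : ∀ p : ℝ, 0 < p → p ^ α * ∫ t in Set.Ioi 0, Real.exp (-(p * t)) * m t =
      (p ^ (1 - α) * ∫ t in Set.Ioi 0, Real.exp (-(p * t)) * rateLaplace α t)⁻¹ - p ^ α := by
    intro p hp
    set A := ∫ t in Set.Ioi 0, Real.exp (-(p * t)) * rateLaplace α t with hA
    set B := ∫ t in Set.Ioi 0, Real.exp (-(p * t)) * m t with hB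
    have iA : IntegrableOn (fun t => Real.exp (-(p * t)) * rateLaplace α t) (Set.Ioi 0) :=
      integrableOn_exp_mul_of_bounded measurable_rateLaplace (fun t ht => by
        rw [abs_of_nonneg (rateLaplace_nonneg t)]
        exact rateLaplace_le_one hα0 ht.le) hp
    have iB : IntegrableOn (fun t => Real.exp (-(p * t)) * m t) (Set.Ioi 0) :=
      integrableOn_exp_mul_of_bounded hm (fun t ht => by
        rw [abs_of_nonneg (hm0 t)]
        exact hm1 t ht.le) hp
    have hconv := integral_posConvolution iB iA (ContinuousLinearMap.mul ℝ ℝ)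
    have iconv := integrable_posConvolution iB iA (ContinuousLinearMap.mul ℝ ℝ)
    simp only [ContinuousLinearMap.mul_apply'] at hconv
    rw [← hA, ← hB] at hconv
    have hone : ∫ t in Set.Ioi 0, Real.exp (-(p * t)) = p⁻¹ := by
      have := integral_exp_mul_Ioi (neg_lt_zero.2 hp) 0
      simp only [neg_mul, mul_zero, Real.exp_zero] at this
      rw [this]
      simp
    have hsum : p⁻¹ = A + B * A := by
      rw [← hone, ← hconv, hA, ← integral_add iA]
      · refine setIntegral_congr_fun measurableSet_Ioi fun t (ht : 0 < t) => ?_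
        have hI : ∫ s in (0 : ℝ)..t, Real.exp (-(p * s)) * m s *
            (Real.exp (-(p * (t - s))) * rateLaplace α (t - s)) =
            Real.exp (-(p * t)) * ∫ s in (0 : ℝ)..t, rateLaplace α (t - s) * m s := by
          rw [← intervalIntegral.integral_const_mul]
          refine intervalIntegral.integral_congr fun s _ => ?_
          have : Real.exp (-(p * t)) = Real.exp (-(p * s)) * Real.exp (-(p * (t - s))) := by
            rw [← Real.exp_add]
            congr 1
            ring
          simp only [this]
          ring
        simp only [hI]
        rw [← mul_add, hren t ht.le, mul_one]
      · refine (iconv.integrableOn (s := Set.Ioi 0)).congr ?_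
        filter_upwards [ae_restrict_mem measurableSet_Ioi] with t ht
        rw [posConvolution, Set.indicator_of_mem ht]
        simp only [ContinuousLinearMap.mul_apply']
    have hA0 : A ≠ 0 := by
      intro h
      rw [h, mul_zero, add_zero] at hsum
      exact (inv_pos.2 hp).ne' hsum
    have h1 : p ^ (1 - α) = p / p ^ α := by rw [Real.rpow_sub hp, Real.rpow_one]
    have h2 : p ^ α ≠ 0 := (Real.rpow_pos_of_pos hp α).ne'
    have h3 : B = p⁻¹ / A - 1 := by
      rw [hsum]
      field_simp
      ring
    rw [h1, h3]
    have hp' := hp.ne'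
    field_simp
  have hlim := ((tendsto_laplace_rateLaplace hα0 hα1).inv₀ (by positivity)).sub
    (((Real.continuousAt_rpow_const 0 α (Or.inr hα0.le)).tendsto.mono_left
      nhdsWithin_le_nhds : Tendsto (fun p : ℝ => p ^ α) (𝓝[>] 0) _))
  rw [Real.zero_rpow hα0.ne', sub_zero] at hlim
  refine hlim.congr' ?_
  filter_upwards [self_mem_nhdsWithin] with p hp
  exact (hlapl p hp).symm

/-- The rescaled renewal measure `t ^ (1 - α) m (t s) ds`, tilted by `exp (-s)` to make it
finite. -/
noncomputable def renewalMeasure (α : ℝ) (m : ℝ → ℝ) (t : ℝ) : Measure ℝ :=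
  (volume.restrict (Set.Ioi 0)).withDensity fun s =>
    ENNReal.ofReal (Real.exp (-s) * (t ^ (1 - α) * m (t * s)))

lemma integral_renewalMeasure (hm : Measurable m) (hm0 : ∀ t, 0 ≤ m t) {t : ℝ} (ht : 0 < t)
    (f : ℝ → ℝ) : ∫ s, f s ∂(renewalMeasure α m t) =
      ∫ s in Set.Ioi 0, Real.exp (-s) * (t ^ (1 - α) * m (t * s)) * f s := by
  have h1 : Measurable fun s : ℝ => ENNReal.ofReal (Real.exp (-s) * (t ^ (1 - α) * m (t * s))) := by
    fun_prop
  rw [renewalMeasure, integral_withDensity_eq_integral_toReal_smul h1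
    (ae_of_all _ fun x => ENNReal.ofReal_lt_top)]
  refine integral_congr_ae (ae_of_all _ fun s => ?_)
  have := hm0 (t * s)
  simp only [smul_eq_mul]
  rw [ENNReal.toReal_ofReal (by positivity)]

lemma isFiniteMeasure_renewalMeasure (hm : Measurable m) (hm0 : ∀ t, 0 ≤ m t)
    (hm1 : ∀ t, 0 ≤ t → m t ≤ 1) {t : ℝ} (ht : 0 < t) :
    IsFiniteMeasure (renewalMeasure α m t) := by
  refine isFiniteMeasure_withDensity_ofReal (Integrable.hasFiniteIntegral ?_)
  have := integrableOn_exp_mul_of_bounded (f := fun s => t ^ (1 - α) * m (t * s)) (by fun_prop)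
    (C := t ^ (1 - α)) (fun s hs => ?_) one_pos
  · simpa only [one_mul] using! this
  · have h0 := hm0 (t * s)
    rw [abs_of_nonneg (by positivity)]
    exact mul_le_of_le_one_right (by positivity) (hm1 _ (by positivity))

lemma ae_pos_renewalMeasure (t : ℝ) : ∀ᵐ s ∂(renewalMeasure α m t), 0 < s :=
  (withDensity_absolutelyContinuous _ _).ae_le (ae_restrict_mem measurableSet_Ioi)

/-- The rescaled renewal measures converge weakly to a multiple of a Gamma law. -/
lemma tendsto_integral_renewalMeasure (hα0 : 0 < α) (hα1 : α < 1) (hm : Measurable m)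
    (hm0 : ∀ t, 0 ≤ m t) (hm1 : ∀ t, 0 ≤ t → m t ≤ 1)
    (hren : ∀ t, 0 ≤ t → rateLaplace α t + ∫ s in (0 : ℝ)..t, rateLaplace α (t - s) * m s = 1)
    {g : ℝ → ℝ} (hg : Measurable g) {C : ℝ} (hC : ∀ s, |g s| ≤ C) {D : Set ℝ} (hD : IsClosed D)
    (hDν : gammaMeasure α 1 D = 0) (hcont : ∀ s ∉ D, ContinuousAt g s) :
    Tendsto (fun t => ∫ s, g s ∂(renewalMeasure α m t)) atTop
      (𝓝 ((α * Real.Gamma α * Real.Gamma (1 - α))⁻¹ * ∫ s, g s ∂(gammaMeasure α 1))) := by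
  have hG1 := Real.Gamma_pos_of_pos hα0
  have hG2 := Real.Gamma_pos_of_pos (show 0 < 1 - α by linarith)
  set c := (α * Real.Gamma α * Real.Gamma (1 - α))⁻¹ with hc
  have hc0 : 0 < c := by positivity
  have := isProbabilityMeasure_gammaMeasure hα0 one_pos
  have hfin : IsFiniteMeasure (ENNReal.ofReal c • gammaMeasure α 1) :=
    Measure.smul_finite _ ENNReal.ofReal_ne_top
  have hint : ∀ f : ℝ → ℝ, ∫ s, f s ∂(ENNReal.ofReal c • gammaMeasure α 1) =
      c * ∫ s, f s ∂(gammaMeasure α 1) := by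
    intro f
    rw [integral_smul_measure, ENNReal.toReal_ofReal hc0.le, smul_eq_mul]
  rw [← hint]
  refine tendsto_integral_of_laplace
    ((eventually_gt_atTop 0).mono fun t ht => isFiniteMeasure_renewalMeasure hm hm0 hm1 ht)
    (Eventually.of_forall fun t => ae_pos_renewalMeasure t)
    (Measure.ae_smul_measure (ae_pos_gammaMeasure α 1) _) (fun k => ?_) hg hC hD
    (by rw [Measure.smul_apply, hDν, smul_zero]) hcont
  rw [hint, integral_exp_neg_gammaMeasure hα0 one_pos k.cast_nonneg]
  have hk : (0 : ℝ) < 1 + k := by positivity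
  have hp : Tendsto (fun t : ℝ => (1 + k) / t) atTop (𝓝[>] 0) := by
    refine tendsto_nhdsWithin_iff.2 ⟨tendsto_const_nhds.div_atTop tendsto_id, ?_⟩
    filter_upwards [eventually_gt_atTop 0] with t ht
    exact div_pos hk ht
  have hlim := ((tendsto_laplace_intensity hα0 hα1 hm hm0 hm1 hren).comp hp).mul_const
    ((1 / (1 + k : ℝ)) ^ α)
  refine hlim.congr' ?_
  filter_upwards [eventually_gt_atTop 0] with t ht
  have hsub := integral_comp_mul_left_Ioi
    (fun u => Real.exp (-((1 + k) / t * u)) * m u) 0 ht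
  rw [mul_zero, smul_eq_mul] at hsub
  have hlhs : ∫ s, Real.exp (-(k * s)) ∂(renewalMeasure α m t) = t ^ (1 - α) *
      ∫ s in Set.Ioi 0, Real.exp (-((1 + k) / t * (t * s))) * m (t * s) := by
    rw [integral_renewalMeasure hm hm0 ht, ← integral_const_mul]
    refine integral_congr_ae (ae_of_all _ fun s => ?_)
    have : Real.exp (-((1 + k) / t * (t * s))) = Real.exp (-s) * Real.exp (-(k * s)) := by
      rw [← Real.exp_add]
      congr 1
      field_simp
      ring
    simp only [this]
    ring
  rw [hlhs, hsub, Function.comp, Real.div_rpow hk.le ht.le, Real.div_rpow zero_le_one hk.le,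
    Real.one_rpow, Real.rpow_sub ht, Real.rpow_one]
  have h1 := (Real.rpow_pos_of_pos ht α).ne'
  have h2 := (Real.rpow_pos_of_pos hk α).ne'
  field_simp

end

/-! ### The ageing law and the Dynkin–Lamperti asymptotics -/

section

variable {α : ℝ}

/-- The substitution `u = 1 - s / (θ + 1)`. -/
lemma integral_ageing_eq {θ : ℝ} (hθ : 0 ≤ θ) :
    ∫ u in (θ / (θ + 1))..1, u ^ (-α) * (1 - u) ^ (α - 1) =
      ∫ s in (0 : ℝ)..1, s ^ (α - 1) * (θ + 1 - s) ^ (-α) := by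
  have hc : 0 < θ + 1 := by positivity
  have h := intervalIntegral.integral_comp_sub_div (a := 0) (b := 1)
    (fun u : ℝ => u ^ (-α) * (1 - u) ^ (α - 1)) hc.ne' 1
  have h1 : 1 - 1 / (θ + 1) = θ / (θ + 1) := by
    field_simp
    ring
  rw [zero_div, sub_zero, h1, smul_eq_mul] at h
  rw [← mul_right_inj' hc.ne', ← h, ← intervalIntegral.integral_const_mul]
  refine intervalIntegral.integral_congr fun s hs => ?_
  rw [Set.uIcc_of_le zero_le_one] at hs
  have h2 : 1 - s / (θ + 1) = (θ + 1 - s) / (θ + 1) := by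
    field_simp
  have h3 : 1 - (1 - s / (θ + 1)) = s / (θ + 1) := by ring
  have h4 : (θ + 1) ^ (-α) * (θ + 1) ^ (α - 1) * (θ + 1) = 1 := by
    rw [← Real.rpow_add hc, ← Real.rpow_add_one hc.ne', show -α + (α - 1) + 1 = 0 by ring,
      Real.rpow_zero]
  have h5 := (Real.rpow_pos_of_pos hc (-α)).ne'
  have h6 := (Real.rpow_pos_of_pos hc (α - 1)).ne'
  rw [h3, h2, Real.div_rpow (by linarith [hs.2]) hc.le, Real.div_rpow hs.1 hc.le]
  field_simp
  linear_combination (-(s ^ (α - 1) * (θ + 1 - s) ^ (-α))) * h4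

/-- The law of `Z`: it is the law of `G / B`, where `G` and `B` are independent, `G` has the
`Gamma(α, 1)` law and `B` the `Beta(1 - α, α)` law (the generalised arcsine law). -/
noncomputable def ageingLaw (α : ℝ) : Measure ℝ :=
  ((gammaMeasure α 1).prod (betaMeasure (1 - α) α)).map fun p => p.1 / p.2

lemma ae_mem_betaMeasure (a b : ℝ) : ∀ᵐ x ∂(betaMeasure a b), x ∈ Set.Ioo (0 : ℝ) 1 := by
  have h1 : Measurable (betaPDF a b) := (measurable_betaPDFReal a b).ennreal_ofReal
  rw [betaMeasure, ae_withDensity_iff h1]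
  refine ae_of_all _ fun x hx => ⟨?_, ?_⟩
  · by_contra h
    exact hx (betaPDF_eq_zero_of_nonpos (not_lt.1 h))
  · by_contra h
    exact hx (betaPDF_eq_zero_of_one_le (not_lt.1 h))

lemma integral_betaMeasure {a b : ℝ} (ha : 0 < a) (hb : 0 < b) (f : ℝ → ℝ) :
    ∫ x, f x ∂(betaMeasure a b) =
      ∫ x in Set.Ioo 0 1, 1 / beta a b * x ^ (a - 1) * (1 - x) ^ (b - 1) * f x := by
  have h1 : Measurable (betaPDF a b) := (measurable_betaPDFReal a b).ennreal_ofReal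
  rw [betaMeasure, integral_withDensity_eq_integral_toReal_smul h1
    (ae_of_all _ fun x => ENNReal.ofReal_lt_top), ← integral_indicator measurableSet_Ioo]
  refine integral_congr_ae (ae_of_all _ fun x => ?_)
  by_cases hx : x ∈ Set.Ioo (0 : ℝ) 1
  · have h2 := (betaPDFReal_pos hx.1 hx.2 ha hb).le
    simp only [smul_eq_mul]
    rw [Set.indicator_of_mem hx, betaPDF, ENNReal.toReal_ofReal h2, betaPDFReal,
      if_pos (show 0 < x ∧ x < 1 from hx)]
  · have h2 : ¬ (0 < x ∧ x < 1) := hx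
    simp only [smul_eq_mul]
    rw [Set.indicator_of_notMem hx, betaPDF, betaPDFReal, if_neg h2]
    simp

lemma isProbabilityMeasure_ageingLaw (hα0 : 0 < α) (hα1 : α < 1) :
    IsProbabilityMeasure (ageingLaw α) := by
  have := isProbabilityMeasure_gammaMeasure hα0 one_pos
  have := isProbabilityMeasureBeta (show 0 < 1 - α by linarith) hα0
  exact Measure.isProbabilityMeasure_map (by fun_prop)

lemma ae_pos_ageingLaw (hα0 : 0 < α) (hα1 : α < 1) : ∀ᵐ z ∂(ageingLaw α), 0 < z := by
  have := isProbabilityMeasure_gammaMeasure hα0 one_pos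
  have := isProbabilityMeasureBeta (show 0 < 1 - α by linarith) hα0
  refine (ae_map_iff (by fun_prop) measurableSet_Ioi).2 ?_
  filter_upwards [Measure.quasiMeasurePreserving_fst.ae (ae_pos_gammaMeasure α 1),
    Measure.quasiMeasurePreserving_snd.ae (ae_mem_betaMeasure (1 - α) α)] with p h1 h2
  exact div_pos h1 h2.1

lemma laplace_ageingLaw (hα0 : 0 < α) (hα1 : α < 1) {θ : ℝ} (hθ : 0 ≤ θ) :
    ∫ z, Real.exp (-(θ * z)) ∂(ageingLaw α) = Real.sin (Real.pi * α) / Real.pi *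
      ∫ s in (0 : ℝ)..1, s ^ (α - 1) * (θ + 1 - s) ^ (-α) := by
  have := isProbabilityMeasure_gammaMeasure hα0 one_pos
  have := isProbabilityMeasureBeta (show 0 < 1 - α by linarith) hα0
  have hint : Integrable (fun p : ℝ × ℝ => Real.exp (-(θ * (p.1 / p.2))))
      ((gammaMeasure α 1).prod (betaMeasure (1 - α) α)) := by
    refine Integrable.mono' (integrable_const (1 : ℝ))
      (Measurable.aestronglyMeasurable (by fun_prop)) ?_
    filter_upwards [Measure.quasiMeasurePreserving_fst.ae (ae_pos_gammaMeasure α 1),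
      Measure.quasiMeasurePreserving_snd.ae (ae_mem_betaMeasure (1 - α) α)] with p h1 h2
    rw [Real.norm_eq_abs, Real.abs_exp]
    exact Real.exp_le_one_iff.2 (neg_nonpos.2 (mul_nonneg hθ (div_pos h1 h2.1).le))
  rw [ageingLaw, integral_map (by fun_prop) (by fun_prop), integral_prod_symm _ hint,
    integral_betaMeasure (by linarith) hα0]
  have hconst : 1 / beta (1 - α) α = Real.sin (Real.pi * α) / Real.pi := by
    rw [beta, sub_add_cancel, Real.Gamma_one, div_one, mul_comm, Real.Gamma_mul_Gamma_one_sub,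
      one_div_div]
  have hstep : ∀ b ∈ Set.Ioo (0 : ℝ) 1, 1 / beta (1 - α) α * b ^ (1 - α - 1) * (1 - b) ^ (α - 1) *
      ∫ g, Real.exp (-(θ * (g / b))) ∂(gammaMeasure α 1) =
      Real.sin (Real.pi * α) / Real.pi * ((1 - b) ^ (α - 1) * (θ + b) ^ (-α)) := by
    intro b hb
    have hb0 := hb.1
    have h1 : ∀ g, θ * (g / b) = θ / b * g := fun g => by ring
    simp only [h1]
    rw [integral_exp_neg_gammaMeasure hα0 one_pos (by positivity), hconst]
    have h2 : 1 / (1 + θ / b) = b / (θ + b) := by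
      field_simp
      ring
    have h3 : b ^ (1 - α - 1) * b ^ α = 1 := by
      rw [← Real.rpow_add hb0]
      simp
    rw [h2, Real.div_rpow hb0.le (by positivity), Real.rpow_neg (by positivity), div_eq_mul_inv]
    linear_combination (Real.sin (Real.pi * α) / Real.pi * (1 - b) ^ (α - 1) *
      ((θ + b) ^ α)⁻¹) * h3
  rw [setIntegral_congr_fun measurableSet_Ioo hstep, integral_const_mul,
    ← integral_Ioc_eq_integral_Ioo, ← intervalIntegral.integral_of_le zero_le_one]
  have hsub := intervalIntegral.integral_comp_sub_left (a := 0) (b := 1)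
    (fun s : ℝ => s ^ (α - 1) * (θ + 1 - s) ^ (-α)) 1
  rw [sub_self, sub_zero] at hsub
  rw [← hsub]
  congr 1
  refine intervalIntegral.integral_congr fun b _ => ?_
  have : θ + 1 - (1 - b) = θ + b := by ring
  simp only [this]

lemma isAgeingLaw_ageingLaw (hα0 : 0 < α) (hα1 : α < 1) : IsAgeingLaw α (ageingLaw α) where
  isProbabilityMeasure := isProbabilityMeasure_ageingLaw hα0 hα1
  positive := ae_pos_ageingLaw hα0 hα1
  laplace θ hθ := by
    rw [integral_ageing_eq hθ, ← laplace_ageingLaw hα0 hα1 hθ]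
    simp only [neg_mul]

lemma IsAgeingLaw.eq {ζ ζ' : Measure ℝ} (h : IsAgeingLaw α ζ) (h' : IsAgeingLaw α ζ') :
    ζ = ζ' := by
  have := h.isProbabilityMeasure
  have := h'.isProbabilityMeasure
  refine measure_eq_of_laplace h.positive h'.positive fun k => ?_
  have h1 := h.laplace k k.cast_nonneg
  rw [← h'.laplace k k.cast_nonneg] at h1
  simpa only [neg_mul] using h1

lemma nullSingletonClass_gammaMeasure (a r : ℝ) : NullSingletonClass (gammaMeasure a r) := by
  unfold gammaMeasure
  infer_instance

lemma nullSingletonClass_ageingLaw (hα0 : 0 < α) (hα1 : α < 1) :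
    NullSingletonClass (ageingLaw α) := by
  have := isProbabilityMeasure_gammaMeasure hα0 one_pos
  have := isProbabilityMeasureBeta (show 0 < 1 - α by linarith) hα0
  have := nullSingletonClass_gammaMeasure α 1
  have hm : Measurable fun p : ℝ × ℝ => p.1 / p.2 := by fun_prop
  refine ⟨fun z => ?_⟩
  rw [ageingLaw, Measure.map_apply hm (measurableSet_singleton z),
    Measure.prod_apply_symm (hm (measurableSet_singleton z)), lintegral_eq_zero_iff'
    (measurable_measure_prodMk_right (hm (measurableSet_singleton z))).aemeasurable]
  filter_upwards [ae_mem_betaMeasure (1 - α) α] with b hb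
  refine measure_mono_null (t := {z * b}) (fun g hg => ?_) (measure_singleton _)
  have hg' : g / b = z := hg
  rw [Set.mem_singleton_iff, ← hg', div_mul_cancel₀ _ hb.1.ne']

lemma continuous_measureReal_Iic {ζ : Measure ℝ} [IsFiniteMeasure ζ] [NullSingletonClass ζ] :
    Continuous fun z : ℝ => ζ.real (Set.Iic z) := by
  have h : ∀ z : ℝ, ζ.real (Set.Iic z) = ∫ y, Set.indicator (Set.Iic z) 1 y ∂ζ := fun z => by
    rw [integral_indicator_one measurableSet_Iic]
  simp only [h]
  refine continuous_iff_continuousAt.2 fun z => ?_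
  refine continuousAt_of_dominated (bound := fun _ => 1) (Eventually.of_forall fun w =>
    (measurable_one.indicator measurableSet_Iic).aestronglyMeasurable)
    (Eventually.of_forall fun w => ae_of_all _ fun y => ?_) (integrable_const _) ?_
  · refine (norm_indicator_le_norm_self _ _).trans ?_
    simp
  · have hz : ∀ᵐ y ∂ζ, y ≠ z := by simp [ae_iff]
    filter_upwards [hz] with y hy
    rcases lt_or_gt_of_ne hy with hlt | hgt
    · refine (continuousAt_const (y := (1 : ℝ))).congr ?_
      filter_upwards [Ioi_mem_nhds hlt] with w hw
      rw [Set.indicator_of_mem (Set.mem_Iic.2 (Set.mem_Ioi.1 hw).le), Pi.one_apply]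
    · refine (continuousAt_const (y := (0 : ℝ))).congr ?_
      filter_upwards [Iio_mem_nhds hgt] with w hw
      rw [Set.indicator_of_notMem (fun h => not_le.2 (Set.mem_Iio.1 hw) (Set.mem_Iic.1 h))]

end

section

variable {α : ℝ} {m : ℝ → ℝ}

/-- The Dynkin–Lamperti asymptotics: the Laplace transform at `θ / t` of the limiting jump rate
at time `t` converges to the Laplace transform of `ageingLaw α`. -/
lemma tendsto_laplace_rateDensity (hα0 : 0 < α) (hα1 : α < 1) (hm : Measurable m)
    (hm0 : ∀ t, 0 ≤ m t) (hm1 : ∀ t, 0 ≤ t → m t ≤ 1)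
    (hren : ∀ t, 0 ≤ t → rateLaplace α t + ∫ s in (0 : ℝ)..t, rateLaplace α (t - s) * m s = 1)
    {θ : ℝ} (hθ : 0 < θ) :
    Tendsto (fun t => rateLaplace α (θ * t + t) +
        ∫ s in (0 : ℝ)..t, rateLaplace α (θ * t + t - s) * m s) atTop
      (𝓝 (∫ z, Real.exp (-(θ * z)) ∂(ageingLaw α))) := by
  have hG1 := Real.Gamma_pos_of_pos hα0
  have hG2 := Real.Gamma_pos_of_pos (show 0 < 1 - α by linarith)
  set κ : ℝ → ℝ := fun t => t ^ α * rateLaplace α t with hκ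
  set K := α * Real.Gamma α with hK
  have hκlim : Tendsto κ atTop (𝓝 K) := tendsto_rpow_mul_rateLaplace hα0
  -- the first summand is negligible
  have hfirst : Tendsto (fun t => rateLaplace α (θ * t + t)) atTop (𝓝 0) := by
    have h1 : Tendsto (fun t : ℝ => θ * t + t) atTop atTop :=
      (tendsto_id.const_mul_atTop hθ).atTop_add_atTop tendsto_id
    have h2 : Tendsto (rateLaplace α) atTop (𝓝 0) := by
      have := hκlim.mul (tendsto_rpow_neg_atTop hα0)
      rw [mul_zero] at this
      refine this.congr' ?_
      filter_upwards [eventually_gt_atTop 0] with t ht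
      have := (Real.rpow_pos_of_pos ht α).ne'
      simp only [hκ]
      rw [Real.rpow_neg ht.le]
      field_simp
    exact h2.comp h1
  -- the second one is an integral with respect to the renewal measure
  let F : ℝ → ℝ → ℝ := fun t s => Set.indicator (Set.Ioc 0 1)
    (fun s => Real.exp s * (t ^ α * rateLaplace α (t * (θ + 1 - s)))) s
  let f : ℝ → ℝ := fun s => Set.indicator (Set.Ioc 0 1)
    (fun s => Real.exp s * (K * (θ + 1 - s) ^ (-α))) s
  have hF : ∀ t, 0 < t → ∫ s in (0 : ℝ)..t, rateLaplace α (θ * t + t - s) * m s =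
      ∫ s, F t s ∂(renewalMeasure α m t) := by
    intro t ht
    have hsub := intervalIntegral.smul_integral_comp_mul_left (a := 0) (b := 1)
      (fun s => rateLaplace α (θ * t + t - s) * m s) t
    rw [mul_zero, mul_one] at hsub
    rw [← hsub, integral_renewalMeasure hm hm0 ht, intervalIntegral.integral_of_le zero_le_one,
      smul_eq_mul, ← integral_const_mul, ← integral_indicator measurableSet_Ioc,
      ← integral_indicator measurableSet_Ioi]
    congr 1 with s
    by_cases hs : s ∈ Set.Ioc (0 : ℝ) 1
    · simp only [F]
      rw [Set.indicator_of_mem hs, Set.indicator_of_mem (show s ∈ Set.Ioi 0 from hs.1),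
        Set.indicator_of_mem hs]
      have h1 : θ * t + t - t * s = t * (θ + 1 - s) := by ring
      have h2 : t ^ (1 - α) * t ^ α = t := by
        rw [← Real.rpow_add ht]
        simp
      have h3 : Real.exp (-s) * Real.exp s = 1 := by
        rw [← Real.exp_add]
        simp
      rw [h1]
      linear_combination (-(rateLaplace α (t * (θ + 1 - s)) * m (t * s))) * h2 -
        (t ^ (1 - α) * t ^ α * rateLaplace α (t * (θ + 1 - s)) * m (t * s)) * h3
    · simp only [F]
      rw [Set.indicator_of_notMem hs]
      by_cases hs0 : s ∈ Set.Ioi (0 : ℝ)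
      · rw [Set.indicator_of_mem hs0, Set.indicator_of_notMem hs, mul_zero]
      · rw [Set.indicator_of_notMem hs0]
  have hfbound : ∀ s, |f s| ≤ Real.exp 1 * (K * θ ^ (-α)) := by
    intro s
    have hpos : 0 ≤ Real.exp 1 * (K * θ ^ (-α)) := by positivity
    by_cases hs : s ∈ Set.Ioc (0 : ℝ) 1
    · have h1 : θ ≤ θ + 1 - s := by linarith [hs.2]
      have h2 : 0 < θ + 1 - s := by linarith
      simp only [f]
      rw [Set.indicator_of_mem hs, abs_of_nonneg (by positivity)]
      have h3 := Real.rpow_le_rpow_of_nonpos hθ h1 (neg_nonpos.2 hα0.le)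
      exact mul_le_mul (Real.exp_le_exp.2 hs.2) (mul_le_mul_of_nonneg_left h3 (by positivity))
        (by positivity) (by positivity)
    · simp only [f]
      rw [Set.indicator_of_notMem hs, abs_zero]
      exact hpos
  have hfmeas : Measurable f := Measurable.indicator (by fun_prop) measurableSet_Ioc
  have := nullSingletonClass_gammaMeasure α 1
  have hlim : Tendsto (fun t => ∫ s, f s ∂(renewalMeasure α m t)) atTop
      (𝓝 ((α * Real.Gamma α * Real.Gamma (1 - α))⁻¹ * ∫ s, f s ∂(gammaMeasure α 1))) := by
    refine tendsto_integral_renewalMeasure hα0 hα1 hm hm0 hm1 hren hfmeas hfbound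
      (D := {0, 1}) (Set.toFinite _).isClosed ((Set.toFinite _).countable.measure_zero _) ?_
    intro s hs
    simp only [Set.mem_insert_iff, Set.mem_singleton_iff, not_or] at hs
    by_cases hs01 : s ∈ Set.Ioo (0 : ℝ) 1
    · have hcont : ContinuousAt (fun s => Real.exp s * (K * (θ + 1 - s) ^ (-α))) s := by
        refine ContinuousAt.mul (by fun_prop) (ContinuousAt.mul (by fun_prop) ?_)
        exact ContinuousAt.rpow_const (by fun_prop) (Or.inl (by linarith [hs01.2] : _ ≠ _))
      refine hcont.congr ?_
      filter_upwards [Ioo_mem_nhds hs01.1 hs01.2] with u hu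
      exact (Set.indicator_of_mem (Set.Ioo_subset_Ioc_self hu)
        fun s => Real.exp s * (K * (θ + 1 - s) ^ (-α))).symm
    · refine (continuousAt_const (y := (0 : ℝ))).congr ?_
      have hmem : (Set.Icc (0 : ℝ) 1)ᶜ ∈ 𝓝 s := by
        refine isClosed_Icc.isOpen_compl.mem_nhds fun hmem => hs01 ?_
        exact ⟨lt_of_le_of_ne hmem.1 (Ne.symm hs.1), lt_of_le_of_ne hmem.2 hs.2⟩
      filter_upwards [hmem] with u hu
      exact (Set.indicator_of_notMem (fun h => hu (Set.Ioc_subset_Icc_self h))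
        fun s => Real.exp s * (K * (θ + 1 - s) ^ (-α))).symm
  have hmass : Tendsto (fun t => (renewalMeasure α m t).real Set.univ) atTop
      (𝓝 ((α * Real.Gamma α * Real.Gamma (1 - α))⁻¹ * (gammaMeasure α 1).real Set.univ)) := by
    have := tendsto_integral_renewalMeasure hα0 hα1 hm hm0 hm1 hren (g := fun _ => 1)
      measurable_const (C := 1) (fun s => by simp) isClosed_empty measure_empty
      (fun s _ => continuousAt_const)
    simpa using this
  -- `F t` converges uniformly to `f`, by monotonicity of `κ`
  have hdist : ∀ t, 0 < t → ∀ s, |F t s - f s| ≤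
      Real.exp 1 * θ ^ (-α) * (K - κ (t * θ)) := by
    intro t ht s
    have hle : κ (t * θ) ≤ K := rpow_mul_rateLaplace_le hα0 (by positivity)
    by_cases hs : s ∈ Set.Ioc (0 : ℝ) 1
    · have h1 : θ ≤ θ + 1 - s := by linarith [hs.2]
      have h2 : 0 < θ + 1 - s := by linarith
      have h3 : t ^ α * rateLaplace α (t * (θ + 1 - s)) =
          (θ + 1 - s) ^ (-α) * κ (t * (θ + 1 - s)) := by
        have := (Real.rpow_pos_of_pos h2 α).ne'
        simp only [hκ]
        rw [Real.mul_rpow ht.le h2.le, Real.rpow_neg h2.le]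
        field_simp
      have h4 : κ (t * (θ + 1 - s)) ≤ K := rpow_mul_rateLaplace_le hα0 (by positivity)
      have h5 : κ (t * θ) ≤ κ (t * (θ + 1 - s)) :=
        rpow_mul_rateLaplace_mono hα0 (by positivity) (by gcongr)
      have h6 : F t s - f s = -(Real.exp s * (θ + 1 - s) ^ (-α) * (K - κ (t * (θ + 1 - s)))) := by
        simp only [F, f]
        rw [Set.indicator_of_mem hs, Set.indicator_of_mem hs, h3]
        ring
      rw [h6, abs_neg, abs_of_nonneg (mul_nonneg (by positivity) (sub_nonneg.2 h4))]
      refine mul_le_mul (mul_le_mul (Real.exp_le_exp.2 hs.2)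
        (Real.rpow_le_rpow_of_nonpos hθ h1 (neg_nonpos.2 hα0.le)) (by positivity)
        (by positivity)) (by linarith) (sub_nonneg.2 h4) (by positivity)
    · simp only [F, f]
      rw [Set.indicator_of_notMem hs, Set.indicator_of_notMem hs, sub_zero, abs_zero]
      exact mul_nonneg (by positivity) (sub_nonneg.2 hle)
  have hFf : Tendsto (fun t => ∫ s, F t s ∂(renewalMeasure α m t) -
      ∫ s, f s ∂(renewalMeasure α m t)) atTop (𝓝 0) := by
    have hκθ : Tendsto (fun t => κ (t * θ)) atTop (𝓝 K) :=
      hκlim.comp (tendsto_id.atTop_mul_const hθ)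
    have hbound := ((hκθ.const_sub K).const_mul (Real.exp 1 * θ ^ (-α))).mul hmass
    rw [sub_self, mul_zero, zero_mul] at hbound
    refine squeeze_zero_norm' ?_ hbound
    filter_upwards [eventually_gt_atTop 0] with t ht
    have := isFiniteMeasure_renewalMeasure (α := α) hm hm0 hm1 ht
    have hL := measurable_rateLaplace (α := α)
    have hFmeas : Measurable (F t) := Measurable.indicator (by fun_prop) measurableSet_Ioc
    have if1 : Integrable f (renewalMeasure α m t) := Integrable.mono' (integrable_const _)
      hfmeas.aestronglyMeasurable (ae_of_all _ hfbound)
    have if2 : Integrable (fun s => F t s - f s) (renewalMeasure α m t) :=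
      Integrable.mono' (integrable_const _) (hFmeas.sub hfmeas).aestronglyMeasurable
        (ae_of_all _ (hdist t ht))
    have if3 : Integrable (F t) (renewalMeasure α m t) := by
      exact (if2.add if1).congr (ae_of_all _ fun s => sub_add_cancel _ _)
    rw [← integral_sub if3 if1]
    exact norm_integral_le_of_norm_le_const (ae_of_all _ (hdist t ht))
  have htarget : (α * Real.Gamma α * Real.Gamma (1 - α))⁻¹ * ∫ s, f s ∂(gammaMeasure α 1) =
      ∫ z, Real.exp (-(θ * z)) ∂(ageingLaw α) := by
    rw [laplace_ageingLaw hα0 hα1 hθ.le, integral_gammaMeasure hα0 one_pos]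
    have h1 : ∫ s in Set.Ioi 0, (1 : ℝ) ^ α / Real.Gamma α * s ^ (α - 1) * Real.exp (-(1 * s)) * f s
        = ∫ s in (0 : ℝ)..1, α * (s ^ (α - 1) * (θ + 1 - s) ^ (-α)) := by
      rw [intervalIntegral.integral_of_le zero_le_one, ← integral_indicator measurableSet_Ioi,
        ← integral_indicator measurableSet_Ioc]
      congr 1 with s
      by_cases hs : s ∈ Set.Ioc (0 : ℝ) 1
      · simp only [f]
        rw [Set.indicator_of_mem (show s ∈ Set.Ioi 0 from hs.1), Set.indicator_of_mem hs,
          Set.indicator_of_mem hs, Real.one_rpow, one_mul, hK]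
        have h3 : Real.exp (-s) * Real.exp s = 1 := by
          rw [← Real.exp_add]
          simp
        field_simp
        linear_combination (s ^ (α - 1) * (θ + 1 - s) ^ (-α)) * h3
      · simp only [f]
        rw [Set.indicator_of_notMem hs]
        by_cases hs0 : s ∈ Set.Ioi (0 : ℝ)
        · rw [Set.indicator_of_mem hs0, Set.indicator_of_notMem hs, mul_zero]
        · rw [Set.indicator_of_notMem hs0]
    rw [h1, intervalIntegral.integral_const_mul, ← mul_assoc]
    congr 1
    have h2 := Real.Gamma_mul_Gamma_one_sub α
    have h3 : (Real.Gamma α * Real.Gamma (1 - α))⁻¹ = Real.sin (Real.pi * α) / Real.pi := by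
      rw [h2, inv_div]
    rw [← h3]
    field_simp
  have hfinal := hfirst.add (hFf.add hlim)
  rw [htarget, zero_add, zero_add] at hfinal
  refine hfinal.congr' ?_
  filter_upwards [eventually_gt_atTop 0] with t ht
  rw [hF t ht]
  ring

end

/-! ### Weak convergence for large times -/

section

variable {α : ℝ} {m : ℝ → ℝ}

/-- The limiting law, as the number of vertices tends to infinity, of the rescaled jump rate
`t * x_N t`. -/
noncomputable def scaledRateLaw (α : ℝ) (m : ℝ → ℝ) (t : ℝ) : Measure ℝ :=
  ((rateLaw α).withDensity fun y => ENNReal.ofReal (rateDensity m t y)).map fun y => t * y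

lemma integral_scaledRateLaw (hm : Measurable m) (hm0 : ∀ t, 0 ≤ m t) {t : ℝ} (ht : 0 ≤ t)
    {g : ℝ → ℝ} (hg : Measurable g) :
    ∫ z, g z ∂(scaledRateLaw α m t) = ∫ y, g (t * y) * rateDensity m t y ∂(rateLaw α) := by
  have h1 : Measurable fun y => ENNReal.ofReal (rateDensity m t y) :=
    (measurable_rateDensity hm t).ennreal_ofReal
  rw [scaledRateLaw, integral_map (by fun_prop) hg.aestronglyMeasurable,
    integral_withDensity_eq_integral_toReal_smul h1 (ae_of_all _ fun y => ENNReal.ofReal_lt_top)]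
  refine integral_congr_ae (ae_of_all _ fun y => ?_)
  simp only [smul_eq_mul]
  rw [ENNReal.toReal_ofReal (rateDensity_nonneg hm0 ht y), mul_comm]

lemma isFiniteMeasure_scaledRateLaw (hα : 0 < α) (hm : Measurable m) (hm0 : ∀ t, 0 ≤ m t)
    (hm1 : ∀ t, 0 ≤ t → m t ≤ 1) {t : ℝ} (ht : 0 ≤ t) :
    IsFiniteMeasure (scaledRateLaw α m t) := by
  have := isProbabilityMeasure_rateLaw hα
  have : IsFiniteMeasure ((rateLaw α).withDensity fun y => ENNReal.ofReal (rateDensity m t y)) := by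
    refine isFiniteMeasure_withDensity_ofReal (Integrable.hasFiniteIntegral ?_)
    refine Integrable.mono' (integrable_const (1 + t))
      (measurable_rateDensity hm t).aestronglyMeasurable ?_
    filter_upwards [ae_mem_rateLaw] with y hy
    rw [Real.norm_eq_abs, abs_of_nonneg (rateDensity_nonneg hm0 ht y)]
    exact rateDensity_le hm hm0 hm1 ht hy.1.le
  unfold scaledRateLaw
  infer_instance

lemma ae_pos_scaledRateLaw {t : ℝ} (ht : 0 < t) : ∀ᵐ z ∂(scaledRateLaw α m t), 0 < z := by
  refine (ae_map_iff (by fun_prop) measurableSet_Ioi).2 ?_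
  refine (withDensity_absolutelyContinuous _ _).ae_le ?_
  filter_upwards [ae_mem_rateLaw] with y hy
  exact mul_pos ht hy.1

/-- Ageing in the limit of infinitely many vertices. -/
lemma tendsto_integral_mul_rateDensity (hα0 : 0 < α) (hα1 : α < 1) (hm : Measurable m)
    (hm0 : ∀ t, 0 ≤ m t) (hm1 : ∀ t, 0 ≤ t → m t ≤ 1)
    (hmass : ∀ t, 0 ≤ t → ∫ y, rateDensity m t y ∂(rateLaw α) = 1)
    {h : ℝ → ℝ} (hb : IsBoundedOnPos h) (hp : IsPiecewiseContinuousOnPos h) :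
    Tendsto (fun t => ∫ y, h (t * y) * rateDensity m t y ∂(rateLaw α)) atTop
      (𝓝 (∫ z, h z ∂(ageingLaw α))) := by
  have := isProbabilityMeasure_ageingLaw hα0 hα1
  have := nullSingletonClass_ageingLaw hα0 hα1
  have hpos := ae_pos_ageingLaw hα0 hα1
  have hren : ∀ t, 0 ≤ t →
      rateLaplace α t + ∫ s in (0 : ℝ)..t, rateLaplace α (t - s) * m s = 1 := by
    intro t ht
    have := integral_exp_mul_rateDensity hα0 hm hm0 hm1 le_rfl ht
    simp only [zero_mul, neg_zero, Real.exp_zero, one_mul, zero_add] at this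
    rw [← this, hmass t ht]
  have hlap : ∀ k : ℕ, Tendsto (fun t => ∫ z, Real.exp (-(k * z)) ∂(scaledRateLaw α m t)) atTop
      (𝓝 (∫ z, Real.exp (-(k * z)) ∂(ageingLaw α))) := by
    intro k
    rcases Nat.eq_zero_or_pos k with rfl | hk
    · simp only [Nat.cast_zero, zero_mul, neg_zero, Real.exp_zero]
      refine tendsto_const_nhds.congr' ?_
      filter_upwards [eventually_ge_atTop 0] with t ht
      rw [integral_scaledRateLaw hm hm0 ht measurable_const]
      simp only [one_mul, hmass t ht]
      simp
    · refine (tendsto_laplace_rateDensity hα0 hα1 hm hm0 hm1 hren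
        (θ := k) (by exact_mod_cast hk)).congr' ?_
      filter_upwards [eventually_ge_atTop 0] with t ht
      rw [integral_scaledRateLaw hm hm0 ht (by fun_prop),
        ← integral_exp_mul_rateDensity hα0 hm hm0 hm1 (by positivity) ht]
      simp only [mul_assoc]
  obtain ⟨C, hC⟩ := hb
  have hlim := tendsto_integral_of_laplace
    ((eventually_ge_atTop 0).mono fun t ht => isFiniteMeasure_scaledRateLaw hα0 hm hm0 hm1 ht)
    ((eventually_gt_atTop 0).mono fun t ht => ae_pos_scaledRateLaw ht) hpos hlap
    (measurable_indicator_pos hp) (abs_indicator_pos_le hC) (isClosed_irregularSet hp)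
    (measure_irregularSet hpos hp) (fun z hz => continuousAt_indicator_pos hz)
  have hζ : ∫ z, Set.indicator (Set.Ioi 0) h z ∂(ageingLaw α) = ∫ z, h z ∂(ageingLaw α) := by
    refine integral_congr_ae ?_
    filter_upwards [hpos] with z hz
    exact Set.indicator_of_mem hz h
  rw [hζ] at hlim
  refine hlim.congr' ?_
  filter_upwards [eventually_gt_atTop 0] with t ht
  rw [integral_scaledRateLaw hm hm0 ht.le (measurable_indicator_pos hp)]
  refine integral_congr_ae ?_
  filter_upwards [ae_mem_rateLaw] with y hy
  rw [Set.indicator_of_mem (show t * y ∈ Set.Ioi 0 from mul_pos ht hy.1)]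

end

/-! ### Expectations of the walk -/

namespace IsTrapWalk

variable {Ω : Type*} [MeasurableSpace Ω] {N : ℕ} {x : ℕ → ℝ} {P : Measure Ω} {Y : ℝ → Ω → Fin N}

lemma measureReal_eq_walkProb (hY : IsTrapWalk N x P Y) {t : ℝ} (ht : 0 ≤ t) (j : Fin N) :
    P.real {ω | Y t ω = j} = walkProb N x t j := by
  have := hY.isProbabilityMeasure
  have hpair : ∀ i, P.real {ω | Y 0 ω = i ∧ Y t ω = j} = (N : ℝ)⁻¹ * transition N x t i j := by
    intro i
    have := hY.finiteDimensional 1 ![0, t] ![i, j] rfl (by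
      intro a b hab
      fin_cases a <;> fin_cases b <;> simp_all)
    simpa [Fin.forall_fin_two] using this
  have hmeas : ∀ i, MeasurableSet {ω | Y 0 ω = i ∧ Y t ω = j} := fun i =>
    (hY.measurable 0 le_rfl (measurableSet_singleton i)).inter
      (hY.measurable t ht (measurableSet_singleton j))
  have hunion : {ω | Y t ω = j} = ⋃ i, {ω | Y 0 ω = i ∧ Y t ω = j} := by
    ext ω
    simp
  rw [hunion, measureReal_iUnion_fintype _ hmeas, walkProb, Finset.mul_sum]
  · exact Finset.sum_congr rfl fun i _ => hpair i
  · intro i i' hii'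
    refine Set.disjoint_left.2 fun ω h1 h2 => hii' ?_
    exact h1.1.symm.trans h2.1

lemma integral_eq_walkMean (hY : IsTrapWalk N x P Y) {t : ℝ} (ht : 0 ≤ t) (f : Fin N → ℝ) :
    ∫ ω, f (Y t ω) ∂P = walkMean N x f t := by
  have := hY.isProbabilityMeasure
  have hm := hY.measurable t ht
  have : IsFiniteMeasure (P.map (Y t)) := inferInstance
  have hf : Measurable f := measurable_of_finite f
  rw [← integral_map (f := f) hm.aemeasurable hf.aestronglyMeasurable,
    integral_fintype Integrable.of_finite, walkMean]
  refine Finset.sum_congr rfl fun j _ => ?_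
  rw [map_measureReal_apply hm (measurableSet_singleton j), smul_eq_mul,
    ← hY.measureReal_eq_walkProb ht j]
  rfl

end IsTrapWalk

lemma isPiecewiseContinuousOnPos_indicator_Iic (a : ℝ) :
    IsPiecewiseContinuousOnPos (Set.indicator (Set.Iic a) 1) := by
  intro b c _
  refine (Set.finite_singleton a).subset ?_
  rintro z ⟨-, hz⟩
  by_contra hne
  refine hz ?_
  rcases lt_or_gt_of_ne (show z ≠ a from hne) with hlt | hgt
  · refine (continuousAt_const (y := (1 : ℝ))).congr ?_
    filter_upwards [Iio_mem_nhds hlt] with w hw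
    rw [Set.indicator_of_mem (Set.mem_Iic.2 (Set.mem_Iio.1 hw).le), Pi.one_apply]
  · refine (continuousAt_const (y := (0 : ℝ))).congr ?_
    filter_upwards [Ioi_mem_nhds hgt] with w hw
    rw [Set.indicator_of_notMem (fun h => not_le.2 (Set.mem_Ioi.1 hw) (Set.mem_Iic.1 h))]

end TrapModel

/-! ### Ageing of the trap model -/

theorem proposition2p8 {Ω : Type*} [MeasurableSpace Ω] (μ : Measure Ω) [IsProbabilityMeasure μ]
    (α : ℝ) (hα0 : 0 < α) (hα1 : α < 1)
    -- the energy landscape: i.i.d. exponential random variables with parameter `α`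
    (E : ℕ → Ω → ℝ) (hE_law : ∀ i, HasLaw (E i) (expMeasure α) μ) (hE_indep : iIndepFun E μ) :
    ∃ ζ : Measure ℝ,
      -- `ζ` is the law of `Z`: it exists, is unique, and has a continuous distribution function
      TrapModel.IsAgeingLaw α ζ ∧
      (∀ ζ' : Measure ℝ, TrapModel.IsAgeingLaw α ζ' → ζ' = ζ) ∧
      Continuous (fun z : ℝ => ζ.real (Set.Iic z)) ∧
      -- for almost every landscape, with `x i = exp (-E i)` and `τ i = exp (E i)`, and any
      -- realisations `Y N` of the walks on `N + 1` vertices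
      ∀ᵐ ω ∂μ, ∀ (Ω' : ℕ → Type*) [∀ N, MeasurableSpace (Ω' N)] (P : ∀ N, Measure (Ω' N))
        (Y : ∀ N, ℝ → Ω' N → Fin (N + 1)),
        (∀ N, TrapModel.IsTrapWalk (N + 1) (fun i => Real.exp (-E i ω)) (P N) (Y N)) →
        (∀ h : ℝ → ℝ, TrapModel.IsBoundedOnPos h → TrapModel.IsPiecewiseContinuousOnPos h →
          Integrable h ζ ∧
          TrapModel.HasIteratedLimit
            (fun N t => ∫ ω', h (t * Real.exp (-E (Y N t ω') ω)) ∂(P N))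
            (∫ z, h z ∂ζ) ∧
          ∀ γ : ℝ → ℂ, TrapModel.IsLoopAroundUnitInterval γ →
            (∀ t, 0 < t →
              Tendsto (fun N => ((∫ ω', h (t * Real.exp (-E (Y N t ω') ω)) ∂(P N) : ℝ) : ℂ))
                atTop (𝓝 (TrapModel.contourFormula α h γ t))) ∧
            Tendsto (TrapModel.contourFormula α h γ) atTop (𝓝 ((∫ z, h z ∂ζ : ℝ) : ℂ))) ∧
        (∀ u : ℝ, 0 < u →
          TrapModel.HasIteratedLimit
            (fun N t => (P N).real {ω' | u ≤ Real.exp (E (Y N t ω') ω) / t})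
            (ζ.real (Set.Iic u⁻¹))) := by
  have hprob := TrapModel.isProbabilityMeasure_ageingLaw hα0 hα1
  have hnull := TrapModel.nullSingletonClass_ageingLaw hα0 hα1
  refine ⟨TrapModel.ageingLaw α, TrapModel.isAgeingLaw_ageingLaw hα0 hα1,
    fun ζ' hζ' => hζ'.eq (TrapModel.isAgeingLaw_ageingLaw hα0 hα1),
    TrapModel.continuous_measureReal_Iic, ?_⟩
  filter_upwards [TrapModel.ae_isTypical hα0 hE_law hE_indep] with ω hω
  intro Ω' _ P Y hY
  set x : ℕ → ℝ := fun i => Real.exp (-E i ω) with hx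
  obtain ⟨m, hm, hm0, hm1, hlim⟩ := TrapModel.exists_limit_walkIntensity hα0 hω
  have hmass : ∀ t, 0 ≤ t → ∫ y, TrapModel.rateDensity m t y ∂(TrapModel.rateLaw α) = 1 :=
    fun t ht => TrapModel.integral_rateDensity hα0 hω hm hm0 hm1 hlim ht
  have hmean : ∀ (h : ℝ → ℝ) (N : ℕ) (t : ℝ), 0 < t →
      ∫ ω', h (t * Real.exp (-E (Y N t ω') ω)) ∂(P N) =
        TrapModel.walkMean (N + 1) x (fun j => h (t * x j)) t := fun h N t ht =>
    (hY N).integral_eq_walkMean ht.le fun j => h (t * x j)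
  have hlimN : ∀ h : ℝ → ℝ, TrapModel.IsBoundedOnPos h → TrapModel.IsPiecewiseContinuousOnPos h →
      ∀ t, 0 < t → Tendsto (fun N => ∫ ω', h (t * Real.exp (-E (Y N t ω') ω)) ∂(P N)) atTop
        (𝓝 (∫ y, h (t * y) * TrapModel.rateDensity m t y ∂(TrapModel.rateLaw α))) := by
    intro h hb hp t ht
    simp only [fun N => hmean h N t ht]
    exact TrapModel.tendsto_walkMean_rateDensity hα0 hω hm hm0 hm1 hlim (hb.comp_mul_left ht)
      (hp.comp_mul_left ht) ht.le
  have hiter : ∀ h : ℝ → ℝ, TrapModel.IsBoundedOnPos h → TrapModel.IsPiecewiseContinuousOnPos h →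
      TrapModel.HasIteratedLimit (fun N t => ∫ ω', h (t * Real.exp (-E (Y N t ω') ω)) ∂(P N))
        (∫ z, h z ∂(TrapModel.ageingLaw α)) := fun h hb hp =>
    ⟨_, hlimN h hb hp, TrapModel.tendsto_integral_mul_rateDensity hα0 hα1 hm hm0 hm1 hmass hb hp⟩
  refine ⟨fun h hb hp => ⟨TrapModel.integrable_of_isPiecewiseContinuousOnPos
    (TrapModel.ae_pos_ageingLaw hα0 hα1) hb hp, hiter h hb hp, fun γ hγ => ?_⟩, fun u hu => ?_⟩
  · have hcontour : ∀ t, 0 < t →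
        Tendsto (fun N => ((∫ ω', h (t * Real.exp (-E (Y N t ω') ω)) ∂(P N) : ℝ) : ℂ))
          atTop (𝓝 (TrapModel.contourFormula α h γ t)) := by
      intro t ht
      simp only [fun N => hmean h N t ht]
      rw [TrapModel.contourFormula_eq_contourLimit hα0]
      exact TrapModel.tendsto_walkMean hα0 hω (hb.comp_mul_left ht) (hp.comp_mul_left ht) hγ t
    refine ⟨hcontour, ?_⟩
    have hA := (Complex.continuous_ofReal.tendsto _).comp
      (TrapModel.tendsto_integral_mul_rateDensity hα0 hα1 hm hm0 hm1 hmass hb hp)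
    refine hA.congr' ?_
    filter_upwards [eventually_gt_atTop 0] with t ht
    exact tendsto_nhds_unique ((Complex.continuous_ofReal.tendsto _).comp (hlimN h hb hp t ht))
      (hcontour t ht)
  · -- `τ / t ≥ u` means `t x ≤ u⁻¹`
    obtain ⟨A, hA1, hA2⟩ := hiter (Set.indicator (Set.Iic u⁻¹) 1)
      ⟨1, fun z _ => by by_cases hz : z ∈ Set.Iic u⁻¹ <;> simp [Set.indicator, hz]⟩
      (TrapModel.isPiecewiseContinuousOnPos_indicator_Iic _)
    rw [integral_indicator_one measurableSet_Iic] at hA2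
    refine ⟨A, fun t ht => (hA1 t ht).congr fun N => ?_, hA2⟩
    have hset : {ω' | u ≤ Real.exp (E (Y N t ω') ω) / t} =
        (Y N t) ⁻¹' {j | t * x j ∈ Set.Iic u⁻¹} := by
      ext ω'
      have he := Real.exp_pos (E (Y N t ω') ω)
      simp only [Set.mem_ofPred_eq, Set.mem_preimage, Set.mem_Iic, hx, Real.exp_neg]
      rw [le_div_iff₀ ht, ← div_eq_mul_inv, div_le_iff₀ he, inv_mul_eq_div, le_div_iff₀ hu,
        mul_comm]
    have hmeas : MeasurableSet ((Y N t) ⁻¹' {j | t * x j ∈ Set.Iic u⁻¹}) :=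
      (hY N).measurable t ht.le (Set.toFinite _).measurableSet
    change ∫ ω', Set.indicator (Set.Iic u⁻¹) 1 (t * Real.exp (-E (Y N t ω') ω)) ∂(P N) =
      (P N).real {ω' | u ≤ Real.exp (E (Y N t ω') ω) / t}
    rw [hset, ← integral_indicator_one hmeas]
    rfl
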